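/- Let $p\ge 1$ be an integer, $d\ge 3$ a real number and $\beta=(\beta_0,\dots,\beta_{p-1}),\ \gamma=(\gamma_0,\dots,\gamma_{p-1})\in\mathbf R^p$. **QAOA.** For a graph $G$ on $[n]$ with adjacency matrix $J$ let $H[J]=\sum_{\{k,l\}\subset[n]}J_{kl}Z_kZ_l$, $H_B=\sum_kX_k$ and $$|\Psi(J,\beta,\gamma)\rangle=e^{-i\frac{\beta_{p-1}}2H_B}e^{-i\frac{\gamma_{p-1}}2H[J]}\cdots e^{-i\frac{\beta_0}2H_B}e^{-i\frac{\gamma_0}2H[J]}|+\rangle^{\otimes n}.$$ Let $\mathrm{ER}(n,\frac d{n-1})$ be the Erdős–Rényi random graph in which every pair of vertices is an edge independently with probability $\frac d{n-1}$ (defined for $n\ge d+1$). **Bitstrings.** For $s=s_0s_1\cdots s_{2p}\in\{0,1\}^{2p+1}$ let $L(s)=\max\{0\le j\le p:\ s_{p+k}=s_{p-k}\text{ for all }0\le k\le j\}$, and let $\mathcal L=\{s:\ s_0\ne s_p\}$ be the set of odd bitstrings; write $(-1)^{s\in\mathcal L}=-1$ if $s\in\mathcal L$ and $1$ otherwise.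 Let $$B_{\beta,s}=\prod_{0\le j<p}\left(\cos\tfrac{\beta_j}2\right)^{\mathbf 1[s_j=s_{j+1}]+\mathbf 1[s_{2p-j}=s_{2p-j-1}]}\left(i\sin\tfrac{\beta_j}2\right)^{\mathbf 1[s_j\ne s_{j+1}]+\mathbf 1[s_{2p-j}\ne s_{2p-j-1}]},$$ $$\varphi(\gamma,s)=\sum_{0\le j<p}\frac{\gamma_j}2\left((-1)^{s_{2p-j}}-(-1)^{s_j}\right),$$ and define $R_s$ by recursion on decreasing $L(s)$: $$R_s=\exp\Big(-d\Big(1-\tfrac12\sum_{t:\,L(t)=p}(-1)^{t\in\mathcal L}B_{\beta,t}e^{i\varphi(\gamma,s\oplus t)}\Big)\Big)\exp\Big(\tfrac d2\sum_{t:\,L(s)<L(t)<p}(-1)^{t\in\mathcal L}B_{\beta,t}R_te^{i\varphi(\gamma,s\oplus t)}\Big)$$ (for $L(s)\in\{p-1,p\}$ the second sum is empty). Put $$S^\infty_{u,v}=\tfrac14(-1)^{u\in\mathcal L}B_{\beta,u}R_u\,(-1)^{v\in\mathcal L}B_{\beta,v}R_v,\qquad S^\infty_u=\tfrac14B_{\beta,u}^2R_u^2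 .$$ **Theorem.** (i) For any total order $<$ on $\{0,1\}^{2p+1}$, $$\lim_{n\to\infty}\frac{\mathbf E_{J\sim\mathrm{ER}(n,\frac d{n-1})}\big[\langle\Psi(J,\beta,\gamma)|H[J]|\Psi(J,\beta,\gamma)\rangle\big]}{nd/2}=\sum_uS^\infty_u+2\sum_{u<v}(-1)^{u_p+v_p}e^{i\varphi(\gamma,u\oplus v)}S^\infty_{u,v},$$ where $u,v$ range over $\{0,1\}^{2p+1}$. (ii) All the numbers $R_u$, $u\in\{0,1\}^{2p+1}$, can be computed from $p,d,\beta,\gamma$ in time $O(16^p)$, with an absolute implied constant: a single program does so for all $p\ge1$, $d\ge 3$, $\beta$, $\gamma$ on a RAM with words of $O(p)$ bits and exact complex arithmetic, in which each elementary word operation or comparison, each memory access, and each complex addition, subtraction, multiplication or exponential takes one time unit. -/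

import Mathlib

/-! ### Bitstrings of length `2p + 1` -/

namespace QAOA

/-- Bitstrings `s = s_0 s_1 … s_{2p}`. -/
abbrev Bits (p : ℕ) : Type := Fin (2 * p + 1) → Bool

/-- The bit `s_j` (only ever used for `j ≤ 2p`). -/
def bit {p : ℕ} (s : Bits p) (j : ℕ) : Bool :=
  if h : j < 2 * p + 1 then s ⟨j, h⟩ else false

/-- Bitwise exclusive or `s ⊕ t`. -/
def bxor {p : ℕ} (s t : Bits p) : Bits p := fun j => xor (s j) (t j)

/-- The level of symmetry `L(s)`: the largest `j ≤ p` such that `s_{p+k} = s_{p-k}` for all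
`0 ≤ k ≤ j`. -/
def level {p : ℕ} (s : Bits p) : ℕ :=
  Nat.findGreatest (fun j => ∀ k ≤ j, bit s (p + k) = bit s (p - k)) p

/-- `s` is odd if `s_0 ≠ s_p`. -/
def IsOdd {p : ℕ} (s : Bits p) : Prop := bit s 0 ≠ bit s p

instance {p : ℕ} (s : Bits p) : Decidable (IsOdd s) := by
  unfold IsOdd; infer_instance

/-- `(-1)^b` for a bit `b`. -/
def spin (b : Bool) : ℝ := if b then -1 else 1

/-- `(-1)^{s ∈ 𝓛}`, where `𝓛` is the set of odd bitstrings. -/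
def parity {p : ℕ} (s : Bits p) : ℂ := if IsOdd s then -1 else 1

noncomputable section

/-- `cos (b/2)` if the two bits agree, `i sin (b/2)` if they differ. -/
def mixerAmp (b : ℝ) (x y : Bool) : ℂ :=
  if x = y then (Real.cos (b / 2) : ℂ) else Complex.I * (Real.sin (b / 2) : ℂ)

/-- The number `B_{β, s}`. -/
def B {p : ℕ} (β : Fin p → ℝ) (s : Bits p) : ℂ :=
  ∏ j : Fin p, mixerAmp (β j) (bit s j) (bit s (j + 1)) *
    mixerAmp (β j) (bit s (2 * p - j)) (bit s (2 * p - j - 1))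

/-- The number `φ(γ, s)`. -/
def phi {p : ℕ} (γ : Fin p → ℝ) (s : Bits p) : ℝ :=
  ∑ j : Fin p, γ j / 2 * (spin (bit s (2 * p - j)) - spin (bit s j))

/-- `e^{i φ(γ, s)}`. -/
def phase {p : ℕ} (γ : Fin p → ℝ) (s : Bits p) : ℂ :=
  Complex.exp (Complex.I * (phi γ s : ℂ))

/-- The numbers `R_s`, by recursion on decreasing level of symmetry. For `L(s) ≥ p - 1` the second
exponent is an empty sum. -/
def R {p : ℕ} (d : ℝ) (β γ : Fin p → ℝ) (s : Bits p) : ℂ :=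
  Complex.exp (-(d : ℂ) * (1 - 1 / 2 * ∑ t : Bits p,
      if level t = p then parity t * B β t * phase γ (bxor s t) else 0)) *
    Complex.exp ((d : ℂ) / 2 * ∑ t : Bits p,
      if _h : level s < level t ∧ level t < p then
        parity t * B β t * R d β γ t * phase γ (bxor s t) else 0)
termination_by p - level s
decreasing_by omega

/-- `S^∞_{u,v}`. -/
def Spair {p : ℕ} (d : ℝ) (β γ : Fin p → ℝ) (u v : Bits p) : ℂ :=
  (parity u * B β u * R d β γ u) * (parity v * B β v * R d β γ v) / 4

/-- `S^∞_u`. -/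
def Sdiag {p : ℕ} (d : ℝ) (β γ : Fin p → ℝ) (u : Bits p) : ℂ :=
  B β u ^ 2 * R d β γ u ^ 2 / 4

/-! ### QAOA for MaxCut on a graph -/

/-- Operators on `n` qubits, in the computational basis. -/
abbrev Op (n : ℕ) : Type := Matrix (Fin n → Bool) (Fin n → Bool) ℂ

/-- The Pauli operator `X_k`. -/
def pauliX {n : ℕ} (k : Fin n) : Op n :=
  Matrix.of fun x y => if x = Function.update y k (!y k) then 1 else 0

/-- The Pauli operator `Z_k`. -/
def pauliZ {n : ℕ} (k : Fin n) : Op n :=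
  Matrix.diagonal fun x => (spin (x k) : ℂ)

/-- The mixer Hamiltonian `∑_k X_k`. -/
def mixerH (n : ℕ) : Op n := ∑ k : Fin n, pauliX k

open Classical in
/-- The MaxCut Hamiltonian `∑_{{k,l} ⊂ [n]} J_{kl} Z_k Z_l`, `J` the adjacency matrix of `G`. -/
def costH {n : ℕ} (G : SimpleGraph (Fin n)) : Op n :=
  ∑ k : Fin n, ∑ l ∈ Finset.Ioi k, (if G.Adj k l then (1 : ℂ) else 0) • (pauliZ k * pauliZ l)

/-- The state `|+⟩^{⊗n}`. -/
def plusState (n : ℕ) : (Fin n → Bool) → ℂ := fun _ => ((√((2 : ℝ) ^ n))⁻¹ : ℝ)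

/-- The QAOA state; layer `0` acts first, and in each layer the cost operator acts before the
mixer. -/
def qaoaState {n p : ℕ} (G : SimpleGraph (Fin n)) (β γ : Fin p → ℝ) : (Fin n → Bool) → ℂ :=
  Fin.foldl p (fun ψ j =>
    Matrix.mulVec (NormedSpace.exp ((-(Complex.I * ((β j / 2 : ℝ) : ℂ))) • mixerH n))
      (Matrix.mulVec (NormedSpace.exp ((-(Complex.I * ((γ j / 2 : ℝ) : ℂ))) • costH G)) ψ))
    (plusState n)

/-- The energy `⟨Ψ| H |Ψ⟩`. -/
def energy {n p : ℕ} (G : SimpleGraph (Fin n)) (β γ : Fin p → ℝ) : ℂ :=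
  star (qaoaState G β γ) ⬝ᵥ Matrix.mulVec (costH G) (qaoaState G β γ)

/-- The edge probability `d / (n - 1)`; clamping to `[0, 1]` only matters for `n < d + 1`, when the
random graph is not defined. -/
def edgeProb (d : ℝ) (n : ℕ) : unitInterval :=
  Set.projIcc 0 1 zero_le_one (d / ((n : ℝ) - 1))

/-- The expected energy over the Erdős–Rényi graph on `n` vertices with edge probability
`d / (n - 1)`. -/
def expectedEnergy {p : ℕ} (d : ℝ) (β γ : Fin p → ℝ) (n : ℕ) : ℂ :=
  ∫ G, energy G β γ ∂(SimpleGraph.binomialRandom (Fin n) (edgeProb d n))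

/-! ### A word RAM with exact complex arithmetic

Words are natural numbers below `2 ^ w`; every elementary instruction and every test costs one time
unit. Complex numbers cannot be tested or converted to words. -/

/-- Binary operations on words. -/
inductive WordOp where
  | add | sub | and | xor | shl | shr

/-- The value of a binary operation. -/
def WordOp.eval : WordOp → ℕ → ℕ → ℕ
  | .add, a, b => a + b
  | .sub, a, b => a - b
  | .and, a, b => a &&& b
  | .xor, a, b => a ^^^ b
  | .shl, a, b => a <<< b
  | .shr, a, b => a >>> b

/-- Machine states: word registers, word memory, complex registers, complex memory. -/
structure State where
  reg : ℕ → ℕ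
  mem : ℕ → ℕ
  creg : ℕ → ℂ
  cmem : ℕ → ℂ

/-- Elementary instructions. Arguments of type `ℕ` are register numbers, except for the value `k`
of a word constant. Memory is addressed by the content of a word register. -/
inductive Instr where
  | wconst (r k : ℕ)
  | wop (o : WordOp) (r a b : ℕ)
  | wload (r a : ℕ)
  | wstore (a r : ℕ)
  | cconst (r : ℕ) (x y : ℚ)
  | cadd (r a b : ℕ)
  | csub (r a b : ℕ)
  | cmul (r a b : ℕ)
  | cexp (r a : ℕ)
  | cload (r a : ℕ)
  | cstore (a r : ℕ)

/-- The effect of an instruction. -/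
def Instr.step : Instr → State → State
  | .wconst r k, σ => { σ with reg := Function.update σ.reg r k }
  | .wop o r a b, σ => { σ with reg := Function.update σ.reg r (o.eval (σ.reg a) (σ.reg b)) }
  | .wload r a, σ => { σ with reg := Function.update σ.reg r (σ.mem (σ.reg a)) }
  | .wstore a r, σ => { σ with mem := Function.update σ.mem (σ.reg a) (σ.reg r) }
  | .cconst r x y, σ =>
      { σ with creg := Function.update σ.creg r ((x : ℂ) + (y : ℂ) * Complex.I) }
  | .cadd r a b, σ => { σ with creg := Function.update σ.creg r (σ.creg a + σ.creg b) }
  | .csub r a b, σ => { σ with creg := Function.update σ.creg r (σ.creg a - σ.creg b) }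
  | .cmul r a b, σ => { σ with creg := Function.update σ.creg r (σ.creg a * σ.creg b) }
  | .cexp r a, σ => { σ with creg := Function.update σ.creg r (Complex.exp (σ.creg a)) }
  | .cload r a, σ => { σ with creg := Function.update σ.creg r (σ.cmem (σ.reg a)) }
  | .cstore a r, σ => { σ with cmem := Function.update σ.cmem (σ.reg a) (σ.creg r) }

/-- Tests compare two word registers. -/
inductive Test where
  | lt (a b : ℕ)
  | eq (a b : ℕ)

/-- Truth of a test in a state. -/
def Test.Holds : Test → State → Prop
  | .lt a b, σ => σ.reg a < σ.reg b
  | .eq a b, σ => σ.reg a = σ.reg b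

/-- Programs. -/
inductive Prog where
  | skip
  | instr (i : Instr)
  | seq (P Q : Prog)
  | branch (b : Test) (P Q : Prog)
  | loop (b : Test) (P : Prog)

/-- `Exec w P σ τ t`: on words of length `w`, the program `P` started in `σ` halts in `τ` after `t`
time units. A computation in which a word overflows does not count as an execution. -/
inductive Exec (w : ℕ) : Prog → State → State → ℕ → Prop where
  | skip (σ : State) : Exec w .skip σ σ 0
  | instr (i : Instr) (σ : State) (h : ∀ r, (i.step σ).reg r < 2 ^ w) :
      Exec w (.instr i) σ (i.step σ) 1
  | seq {P Q : Prog} {σ τ ρ : State} {a b : ℕ} (hP : Exec w P σ τ a) (hQ : Exec w Q τ ρ b) :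
      Exec w (.seq P Q) σ ρ (a + b)
  | branchTrue {b : Test} {P Q : Prog} {σ τ : State} {a : ℕ} (hb : b.Holds σ)
      (hP : Exec w P σ τ a) : Exec w (.branch b P Q) σ τ (a + 1)
  | branchFalse {b : Test} {P Q : Prog} {σ τ : State} {a : ℕ} (hb : ¬ b.Holds σ)
      (hQ : Exec w Q σ τ a) : Exec w (.branch b P Q) σ τ (a + 1)
  | loopFalse {b : Test} {P : Prog} {σ : State} (hb : ¬ b.Holds σ) :
      Exec w (.loop b P) σ σ 1
  | loopTrue {b : Test} {P : Prog} {σ τ ρ : State} {a c : ℕ} (hb : b.Holds σ)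
      (hP : Exec w P σ τ a) (hL : Exec w (.loop b P) τ ρ c) :
      Exec w (.loop b P) σ ρ (a + c + 1)

/-- The input: `p` in word register `0`, and `d, β_0, …, β_{p-1}, γ_0, …, γ_{p-1}` in the complex
memory from address `0` on; everything else is `0`. -/
def inputState {p : ℕ} (d : ℝ) (β γ : Fin p → ℝ) : State where
  reg := fun r => if r = 0 then p else 0
  mem := fun _ => 0
  creg := fun _ => 0
  cmem := fun a =>
    if a = 0 then (d : ℂ)
    else if h : a - 1 < p then (β ⟨a - 1, h⟩ : ℂ)
    else if h : a - 1 - p < p then (γ ⟨a - 1 - p, h⟩ : ℂ)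
    else 0

/-- The number with binary digits `s_j`. -/
def code {p : ℕ} (s : Bits p) : ℕ := ∑ j, if s j then 2 ^ (j : ℕ) else 0

/-- The output `f`: entry `f u` is in the complex memory at address `code u`, relative to the base
address in word register `0`. -/
def State.Outputs {p : ℕ} (σ : State) (f : Bits p → ℂ) : Prop :=
  ∀ u, σ.cmem (σ.reg 0 + code u) = f u

end

end QAOA

/-! ### Symmetry of the weights under central flips, and the fixed-point equation for `R`. -/

namespace QAOA

/-! ### Levels of symmetry -/

/-! A closed path through the circuit gives every vertex a bitstring: positions `j < p` record the
ket, positions `2p - j` the bra, position `p` the measured bit. The mixers contribute a factor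
`amp`, half of `weight`, per vertex; each edge contributes a phase (`energy_eq`). Edges are
independent, so averaging turns the factor of each pair into `1 + q (e^{iφ} - 1)`, and by
exchangeability only one pair has to carry the pinned edge (`expectedEnergy_add_two`). The other `n
- 2` vertices form a mean-field partition sum `Zsum` in the field of the two strings `u`, `v` on
that pair, and the point is that it tends to `R_u R_v`.

The weights are complex and their absolute values may sum to far more than their total, so crude
estimates fail. The cure is a cancellation: flipping the central `2l + 1` bits of a string of level
`l < p` negates its weight but leaves its phase against every string of level at least `l` unchanged
(`weight_innerFlip`, `phase_bxor_innerFlip`). Hence flip-invariant weighted sums vanish on each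
level below the top, `R = 1` at the top, and `R_s = exp(d/2 * ∑ w_t R_t (e^{iφ(s ⊕ t)} - 1))`, where
`t` may run over all strings or only over the top level and those above `s` (`R_eq_exp_full`,
`R_eq_exp_sub_one`).

Convergence of `Zsum` goes by descending induction on the lowest admitted level `l`. Singling out
the `k` vertices of level `l` costs a binomial coefficient of order `n^k / k!`. On level `l` only
the flip-odd part of the field survives; it is `O(1/n)`, because the field is `1 + O(1/n)` and the
kernels of the other level-`l` vertices are flip-even. Thus each term has a finite limit, and a
level-`l` vertex `s` acts on the higher levels only by multiplying their limit by `R_s`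
(`exp_limExp_add`). Uniform bounds (`exists_norm_Zsum_le`) allow dominated convergence, and the
terms add up to an exponential series (`zsumTendsto_of_succ`).

For the running time, levels, weights and phases of all `2 * 4^p` strings are tabulated, so the
phase of `s ⊕ t` is one lookup at the xor of the codes. Descending through the levels, each string
below the top is charged one sum over all strings, in total `O((2 * 4^p)^2) = O(16^p)`; the
remaining work is `O(p * 4^p)` (`sum_visitTime_le`). -/

theorem level_le {p : ℕ} (s : Bits p) : level s ≤ p := Nat.findGreatest_le p

theorem bit_eq_of_le_level {p : ℕ} {s : Bits p} {k : ℕ} (h : k ≤ level s) :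
    bit s (p + k) = bit s (p - k) := by
  have h0 : (fun j => ∀ k ≤ j, bit s (p + k) = bit s (p - k)) 0 := by
    intro k hk
    obtain rfl : k = 0 := by omega
    rfl
  exact Nat.findGreatest_spec (P := fun j => ∀ k ≤ j, bit s (p + k) = bit s (p - k))
    (Nat.zero_le p) h0 k h

theorem le_level_iff {p : ℕ} {s : Bits p} {j : ℕ} (hj : j ≤ p) :
    j ≤ level s ↔ ∀ k ≤ j, bit s (p + k) = bit s (p - k) := by
  constructor
  · intro h k hk
    exact bit_eq_of_le_level (hk.trans h)
  · intro h
    exact Nat.le_findGreatest hj h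

theorem bit_level_ne {p : ℕ} {s : Bits p} (h : level s < p) :
    bit s (p + (level s + 1)) ≠ bit s (p - (level s + 1)) := by
  intro he
  have : level s + 1 ≤ level s := by
    rw [le_level_iff h]
    intro k hk
    rcases Nat.lt_or_ge k (level s + 1) with h' | h'
    · exact bit_eq_of_le_level (by omega)
    · obtain rfl : k = level s + 1 := by omega
      exact he
  omega

/-- Mirror image bits within the level of symmetry agree. -/
theorem bit_mirror {p : ℕ} {s : Bits p} {j : ℕ} (hj : j ≤ p) (h : p - j ≤ level s) :
    bit s (2 * p - j) = bit s j := by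
  have := bit_eq_of_le_level h
  rwa [show p + (p - j) = 2 * p - j by omega, show p - (p - j) = j by omega] at this

theorem bit_bxor {p : ℕ} (s t : Bits p) (j : ℕ) :
    bit (bxor s t) j = xor (bit s j) (bit t j) := by
  unfold bit bxor
  split_ifs <;> rfl

theorem spin_xor (a b : Bool) : spin (xor a b) = spin a * spin b := by
  cases a <;> cases b <;> simp [spin]

theorem spin_mul_self (a : Bool) : spin a * spin a = 1 := by
  cases a <;> simp [spin]

theorem bxor_comm {p : ℕ} (s t : Bits p) : bxor s t = bxor t s := by
  funext j
  exact Bool.xor_comm _ _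

theorem phi_bxor {p : ℕ} (γ : Fin p → ℝ) (s t : Bits p) :
    phi γ (bxor s t) = ∑ j : Fin p, γ j / 2 *
      (spin (bit s (2 * p - j)) * spin (bit t (2 * p - j)) - spin (bit s j) * spin (bit t j)) := by
  simp only [phi, bit_bxor, spin_xor]

theorem phase_bxor_self {p : ℕ} (γ : Fin p → ℝ) (s : Bits p) : phase γ (bxor s s) = 1 := by
  simp [phase, phi_bxor, spin_mul_self]

theorem norm_phase {p : ℕ} (γ : Fin p → ℝ) (s : Bits p) : ‖phase γ s‖ = 1 := by
  rw [phase, mul_comm]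
  exact Complex.norm_exp_ofReal_mul_I _

theorem phase_bxor_of_level_eq {p : ℕ} (γ : Fin p → ℝ) {s t : Bits p} (hs : level s = p)
    (ht : level t = p) : phase γ (bxor s t) = 1 := by
  have : phi γ (bxor s t) = 0 := by
    rw [phi_bxor]
    refine Finset.sum_eq_zero fun j _ => ?_
    rw [bit_mirror j.2.le (by omega), bit_mirror j.2.le (by omega)]
    ring
  simp [phase, this]

/-! ### Flipping the central bits -/

/-- Flip the bits `p - l, …, p + l`. -/
def innerFlip {p : ℕ} (l : ℕ) (t : Bits p) : Bits p :=
  fun i => if p ≤ i + l ∧ (i : ℕ) ≤ p + l then !t i else t i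

theorem innerFlip_innerFlip {p : ℕ} (l : ℕ) (t : Bits p) : innerFlip l (innerFlip l t) = t := by
  funext i
  simp only [innerFlip]
  split_ifs <;> simp

theorem bit_innerFlip {p l i : ℕ} (hi : i ≤ 2 * p) (t : Bits p) :
    bit (innerFlip l t) i = if p ≤ i + l ∧ i ≤ p + l then !bit t i else bit t i := by
  have hi' : i < 2 * p + 1 := by omega
  simp [bit, innerFlip, hi']

/-- The flipped window is symmetric about `p`, so mirror pairs are flipped together or not at all.
-/
theorem level_innerFlip {p : ℕ} (l : ℕ) (t : Bits p) : level (innerFlip l t) = level t := by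
  have key : ∀ j ≤ p, j ≤ level (innerFlip l t) ↔ j ≤ level t := by
    intro j hj
    rw [le_level_iff hj, le_level_iff hj]
    refine forall₂_congr fun k hk => ?_
    rw [bit_innerFlip (by omega), bit_innerFlip (by omega)]
    by_cases h : k ≤ l
    · rw [if_pos (by omega), if_pos (by omega)]
      simp
    · rw [if_neg (by omega), if_neg (by omega)]
  exact le_antisymm ((key _ (level_le _)).1 le_rfl) ((key _ (level_le _)).2 le_rfl)

theorem parity_eq_spin {p : ℕ} (s : Bits p) :
    parity s = ((spin (bit s 0) * spin (bit s p) : ℝ) : ℂ) := by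
  unfold parity
  by_cases h : IsOdd s
  · rw [if_pos h]
    unfold IsOdd at h
    revert h
    cases bit s 0 <;> cases bit s p <;> simp [spin]
  · rw [if_neg h]
    unfold IsOdd at h
    revert h
    cases bit s 0 <;> cases bit s p <;> simp [spin]

/-- Because `l < p`, bit `p` lies in the window and bit `0` does not. -/
theorem parity_innerFlip {p l : ℕ} (h : l < p) (t : Bits p) :
    parity (innerFlip l t) = -parity t := by
  rw [parity_eq_spin, parity_eq_spin, bit_innerFlip (by omega), bit_innerFlip (by omega),
    if_neg (by omega), if_pos (by omega)]
  cases bit t p <;> simp [spin]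

theorem mixerAmp_not_not (b : ℝ) (x y : Bool) : mixerAmp b (!x) (!y) = mixerAmp b x y := by
  cases x <;> cases y <;> simp [mixerAmp]

/-- Only the two links crossing the boundary of the window can change. Their inner ends agree and
their outer ends differ, so one carries a cosine and the other a sine of the same angle; the flip
exchanges them. -/
theorem B_innerFlip {p : ℕ} (β : Fin p → ℝ) {t : Bits p} (h : level t < p) :
    B β (innerFlip (level t) t) = B β t := by
  unfold B
  refine Finset.prod_congr rfl fun j _ => ?_
  have hj := j.2
  rw [bit_innerFlip (by omega), bit_innerFlip (by omega), bit_innerFlip (by omega),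
    bit_innerFlip (by omega)]
  rcases lt_trichotomy (p - j - 1) (level t) with h1 | h1 | h1
  · rw [if_pos (by omega), if_pos (by omega), if_pos (by omega), if_pos (by omega),
      mixerAmp_not_not, mixerAmp_not_not]
  · rw [if_neg (by omega), if_pos (by omega), if_neg (by omega), if_pos (by omega)]
    have e1 := bit_mirror (s := t) (j := j + 1) (by omega) (by omega)
    have e2 := bit_level_ne h
    rw [show p + (level t + 1) = 2 * p - j by omega,
      show p - (level t + 1) = (j : ℕ) by omega] at e2
    rw [show 2 * p - (j : ℕ) - 1 = 2 * p - (j + 1) by omega, e1]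
    revert e2
    generalize bit t (2 * p - j) = a
    generalize bit t j = b
    generalize bit t (j + 1) = c
    cases a <;> cases b <;> cases c <;> simp [mixerAmp, mul_comm]
  · rw [if_neg (by omega), if_neg (by omega), if_neg (by omega), if_neg (by omega)]

/-- Inside the window mirror terms of the exponent cancel before and after the flip; outside it
nothing changes. -/
theorem phase_bxor_innerFlip {p : ℕ} (γ : Fin p → ℝ) {l : ℕ} {s t : Bits p}
    (hs : l ≤ level s) (ht : l ≤ level t) :
    phase γ (bxor s (innerFlip l t)) = phase γ (bxor s t) := by
  have : phi γ (bxor s (innerFlip l t)) = phi γ (bxor s t) := by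
    rw [phi_bxor, phi_bxor]
    refine Finset.sum_congr rfl fun j _ => ?_
    have hj := j.2
    rw [bit_innerFlip (by omega), bit_innerFlip (by omega)]
    by_cases h : p - j ≤ l
    · rw [if_pos (by omega), if_pos (by omega), bit_mirror (s := s) hj.le (by omega),
        bit_mirror (s := t) hj.le (by omega)]
      ring
    · rw [if_neg (by omega), if_neg (by omega)]
  rw [phase, phase, this]

noncomputable section

/-- The weight `(-1)^{t ∈ 𝓛} B_{β,t}`. -/
def weight {p : ℕ} (β : Fin p → ℝ) (t : Bits p) : ℂ := parity t * B β t

theorem weight_innerFlip {p : ℕ} (β : Fin p → ℝ) {t : Bits p} (h : level t < p) :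
    weight β (innerFlip (level t) t) = -weight β t := by
  rw [weight, weight, parity_innerFlip h, B_innerFlip β h, neg_mul]

/-- One unfolding suffices: every string in either exponent has level at least that of `t`, so its
phase does not see the flip. -/
theorem R_innerFlip {p : ℕ} (d : ℝ) (β γ : Fin p → ℝ) (t : Bits p) :
    R d β γ (innerFlip (level t) t) = R d β γ t := by
  have key : ∀ t' : Bits p, level t ≤ level t' →
      phase γ (bxor (innerFlip (level t) t) t') = phase γ (bxor t t') := by
    intro t' h
    rw [bxor_comm, phase_bxor_innerFlip γ h le_rfl, bxor_comm]
  rw [R, R]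
  congr 3
  · congr 2
    refine Finset.sum_congr rfl fun t' _ => ?_
    split_ifs with h
    · rw [key t' (by rw [h]; exact level_le t)]
    · rfl
  · refine Finset.sum_congr rfl fun t' _ => ?_
    rw [level_innerFlip]
    split_ifs with h
    · rw [key t' h.1.le]
    · rfl

/-- Flip-invariant functions have zero weighted sum over a level below the top. -/
theorem sum_level_eq_zero {p : ℕ} (β : Fin p → ℝ) {l : ℕ} (hl : l < p) (F : Bits p → ℂ)
    (hF : ∀ t, level t = l → F (innerFlip l t) = F t) :
    ∑ t with level t = l, weight β t * F t = 0 := by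
  have h : ∑ t with level t = l, weight β t * F t = -∑ t with level t = l, weight β t * F t := by
    rw [← Finset.sum_neg_distrib]
    refine Finset.sum_nbij' (innerFlip l) (innerFlip l) ?_ ?_ ?_ ?_ ?_
    · intro t ht; simpa [level_innerFlip] using ht
    · intro t ht; simpa [level_innerFlip] using ht
    · intro t _; exact innerFlip_innerFlip l t
    · intro t _; exact innerFlip_innerFlip l t
    · intro t ht
      obtain rfl : level t = l := by simpa using ht
      rw [hF t rfl, weight_innerFlip β hl]
      ring
  exact self_eq_neg.1 h

/-! ### The weights as products along the string -/

theorem parity_eq {p : ℕ} (s : Bits p) :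
    parity s = ∏ j : Fin p, ((spin (bit s j) * spin (bit s (j + 1)) : ℝ) : ℂ) := by
  have h : ∀ m : ℕ, ∏ j ∈ Finset.range m, (spin (bit s j) * spin (bit s (j + 1))) =
      spin (bit s 0) * spin (bit s m) := by
    intro m
    induction m with
    | zero => simp [spin_mul_self]
    | succ m ih =>
      rw [Finset.prod_range_succ, ih]
      calc _ = spin (bit s 0) * (spin (bit s m) * spin (bit s m)) * spin (bit s (m + 1)) := by ring
        _ = _ := by rw [spin_mul_self, mul_one]
  rw [← Complex.ofReal_prod,
    Fin.prod_univ_eq_prod_range (fun j => spin (bit s j) * spin (bit s (j + 1))), h,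
    parity_eq_spin]

/-- The parity sign telescopes along the first half and there turns each `i sin` into `-i sin`. So
the weight is a product of ket amplitudes (angles `-β j`) and bra amplitudes (angles `β j`). -/
theorem weight_eq {p : ℕ} (β : Fin p → ℝ) (s : Bits p) :
    weight β s = ∏ j : Fin p, mixerAmp (-β j) (bit s j) (bit s (j + 1)) *
      mixerAmp (β j) (bit s (2 * p - j)) (bit s (2 * p - j - 1)) := by
  rw [weight, parity_eq, B, ← Finset.prod_mul_distrib]
  refine Finset.prod_congr rfl fun j _ => ?_
  rw [← mul_assoc]
  congr 1
  cases bit s j <;> cases bit s (j + 1) <;> simp [mixerAmp, spin, neg_div]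

/-- The bits are summed out from the left: each sum is independent of the next bit, and the last bit
is free, whence the 2. -/
theorem sum_chain (c : ℕ → ℂ) (f : ℕ → Bool → Bool → ℂ) (m : ℕ)
    (h : ∀ j y, ∑ x, f j x y = c j) :
    ∑ s : Fin (m + 1) → Bool, ∏ j : Fin m, f j (s j.castSucc) (s j.succ) =
      2 * ∏ j : Fin m, c j := by
  induction m generalizing c f with
  | zero => simp
  | succ m ih =>
    rw [← (Fin.consEquiv fun _ : Fin (m + 2) => Bool).sum_comp, Fintype.sum_prod_type_right]
    have := ih (fun j => c (j + 1)) (fun j => f (j + 1)) (fun j => h (j + 1))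
    rw [Fin.prod_univ_succ, mul_left_comm]
    simp only [Fin.val_succ]
    rw [← this, Finset.mul_sum]
    refine Finset.sum_congr rfl fun s _ => ?_
    simp only [Fin.prod_univ_succ (n := m)]
    simp only [Fin.consEquiv, Equiv.coe_fn_mk, Fin.castSucc_zero, Fin.cons_zero, Fin.cons_succ,
      Fin.val_zero, Fin.val_succ, ← Fin.succ_castSucc]
    rw [← Finset.sum_mul, h]

theorem sum_mixerAmp (b : ℝ) (y : Bool) :
    ∑ x, mixerAmp b x y = Complex.exp (Complex.I * ((b / 2 : ℝ) : ℂ)) := by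
  rw [mul_comm, Complex.exp_mul_I, Fintype.sum_bool]
  cases y <;> simp [mixerAmp, mul_comm, add_comm]

theorem mixerAmp_comm (b : ℝ) (x y : Bool) : mixerAmp b x y = mixerAmp b y x := by
  simp [mixerAmp, eq_comm]

/-- Along the string the angles read `-β_0, …, -β_{p-1}, β_{p-1}, …, β_0`, so the constants
`e^{ib/2}` left by the chain cancel in pairs. This is unitarity of the one-qubit circuit. -/
theorem sum_weight {p : ℕ} (β : Fin p → ℝ) : ∑ t : Bits p, weight β t = 2 := by
  let b : ℕ → ℝ := fun j => if h : j < p then -β ⟨j, h⟩ else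
    if h : 2 * p - 1 - j < p then β ⟨2 * p - 1 - j, h⟩ else 0
  have split : ∀ g : ℕ → ℂ, ∏ i ∈ Finset.range (2 * p), g i =
      ∏ j : Fin p, g j * g (2 * p - 1 - j) := by
    intro g
    rw [two_mul, Finset.prod_range_add, Finset.prod_mul_distrib,
      Fin.prod_univ_eq_prod_range g, Fin.prod_univ_eq_prod_range (fun j => g (p + p - 1 - j)),
      ← Finset.prod_range_reflect (fun x => g (p + x))]
    congr 1
    refine Finset.prod_congr rfl fun j hj => ?_
    have := Finset.mem_range.1 hj
    congr 1
    omega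
  have hb1 : ∀ j : Fin p, b j = -β j := fun j => by simp [b]
  have hb2 : ∀ j : Fin p, b (2 * p - 1 - j) = β j := fun j => by
    have hj := j.2
    have h1 : ¬ 2 * p - 1 - (j : ℕ) < p := by omega
    have h2 : 2 * p - 1 - (2 * p - 1 - (j : ℕ)) = j := by omega
    simp [b, h1, h2]
  have key : ∀ s : Bits p, weight β s = ∏ i : Fin (2 * p),
      mixerAmp (b i) (s i.castSucc) (s i.succ) := by
    intro s
    have e : ∀ i : Fin (2 * p), mixerAmp (b i) (s i.castSucc) (s i.succ) =
        mixerAmp (b i) (bit s i) (bit s (i + 1)) := by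
      intro i
      have h1 : (i : ℕ) < 2 * p + 1 := by omega
      simp only [bit, h1, Nat.add_lt_add_iff_right, i.2, dif_pos]
      rfl
    simp only [e]
    rw [Fin.prod_univ_eq_prod_range (fun i => mixerAmp (b i) (bit s i) (bit s (i + 1))), split,
      weight_eq]
    refine Finset.prod_congr rfl fun j _ => ?_
    rw [hb1, hb2]
    congr 1
    rw [mixerAmp_comm]
    have hj := j.2
    congr 2 <;> omega
  simp only [key]
  rw [sum_chain (fun j => Complex.exp (Complex.I * ((b j / 2 : ℝ) : ℂ)))
    (fun j => mixerAmp (b j)) (2 * p) (fun j y => sum_mixerAmp (b j) y),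
    Fin.prod_univ_eq_prod_range (fun j => Complex.exp (Complex.I * ((b j / 2 : ℝ) : ℂ))), split]
  rw [Finset.prod_eq_one, mul_one]
  intro j _
  rw [hb1, hb2, ← Complex.exp_add]
  simp [neg_div]

theorem sum_level_lt_eq_zero {p : ℕ} (β : Fin p → ℝ) {m : ℕ} (F : Bits p → ℂ)
    (hF : ∀ t, level t < m → level t < p → F (innerFlip (level t) t) = F t) :
    ∑ t with level t < m ∧ level t < p, weight β t * F t = 0 := by
  rw [← Finset.sum_fiberwise_of_maps_to (g := level) (t := Finset.range (min m p))]
  · refine Finset.sum_eq_zero fun l hl => ?_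
    have hl' : l < m ∧ l < p := by simpa using hl
    rw [Finset.filter_filter]
    rw [← sum_level_eq_zero β hl'.2 F fun t ht => by
      have := hF t (by omega) (by omega)
      rwa [ht] at this]
    refine Finset.sum_congr ?_ fun _ _ => rfl
    ext t
    simp only [Finset.mem_filter, Finset.mem_univ, true_and]
    omega
  · intro t ht
    simpa using ht

/-- Only the levels at least `m` and the top level contribute to a weighted sum that is
flip-invariant below `m`. -/
theorem sum_weight_mul_eq {p : ℕ} (β : Fin p → ℝ) (m : ℕ) (F : Bits p → ℂ)
    (hF : ∀ t, level t < m → level t < p → F (innerFlip (level t) t) = F t) :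
    ∑ t with m ≤ level t ∨ level t = p, weight β t * F t = ∑ t, weight β t * F t := by
  rw [← Finset.sum_filter_add_sum_filter_not Finset.univ
    (fun t : Bits p => m ≤ level t ∨ level t = p) (fun t => weight β t * F t)]
  rw [left_eq_add, ← sum_level_lt_eq_zero β F hF]
  refine Finset.sum_congr ?_ fun _ _ => rfl
  ext t
  have := level_le t
  simp only [Finset.mem_filter, Finset.mem_univ, true_and]
  omega

theorem sum_weight_top {p : ℕ} (β : Fin p → ℝ) : ∑ t with level t = p, weight β t = 2 := by
  have := sum_weight_mul_eq β p (fun _ => 1) fun _ _ _ => rfl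
  simp only [mul_one, sum_weight] at this
  rw [← this]
  refine Finset.sum_congr ?_ fun _ _ => rfl
  ext t
  have := level_le t
  simp only [Finset.mem_filter, Finset.mem_univ, true_and]
  omega

/-! ### The numbers `R_s` as a fixed point -/

theorem R_of_level_eq {p : ℕ} (d : ℝ) (β γ : Fin p → ℝ) {s : Bits p} (hs : level s = p) :
    R d β γ s = 1 := by
  have h1 : ∑ t : Bits p, (if level t = p then parity t * B β t * phase γ (bxor s t) else 0) =
      2 := by
    rw [← Finset.sum_filter, ← sum_weight_top β]
    refine Finset.sum_congr rfl fun t ht => ?_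
    rw [phase_bxor_of_level_eq γ hs (by simpa using ht), mul_one, weight]
  have h2 : ∑ t : Bits p, (if _h : level s < level t ∧ level t < p then
        parity t * B β t * R d β γ t * phase γ (bxor s t) else 0) = 0 := by
    refine Finset.sum_eq_zero fun t _ => ?_
    rw [dif_neg (by omega)]
  rw [R, h1, h2]
  norm_num

/-- Flip-invariance of `R` kills each lower level and `R = 1` at the top, so the threshold `m` is
immaterial. -/
theorem sum_weight_R {p : ℕ} (d : ℝ) (β γ : Fin p → ℝ) (m : ℕ) :
    ∑ t with m ≤ level t ∨ level t = p, weight β t * R d β γ t = 2 := by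
  have h1 := sum_weight_mul_eq β m (R d β γ) fun t _ _ => R_innerFlip d β γ t
  have h2 := sum_weight_mul_eq β p (R d β γ) fun t _ _ => R_innerFlip d β γ t
  rw [h1, ← h2, ← sum_weight_top β]
  refine Finset.sum_congr ?_ fun t ht => ?_
  · ext t
    have := level_le t
    simp only [Finset.mem_filter, Finset.mem_univ, true_and]
    omega
  · rw [R_of_level_eq d β γ (by simpa using ht), mul_one]

theorem R_eq_exp {p : ℕ} (d : ℝ) (β γ : Fin p → ℝ) (s : Bits p) :
    R d β γ s = Complex.exp (-d + d / 2 * ∑ t with level s + 1 ≤ level t ∨ level t = p,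
      weight β t * R d β γ t * phase γ (bxor s t)) := by
  rw [R, ← Complex.exp_add]
  congr 1
  have : ∑ t with level s + 1 ≤ level t ∨ level t = p,
      weight β t * R d β γ t * phase γ (bxor s t) =
      (∑ t : Bits p, if level t = p then parity t * B β t * phase γ (bxor s t) else 0) +
      ∑ t : Bits p, if _h : level s < level t ∧ level t < p then
        parity t * B β t * R d β γ t * phase γ (bxor s t) else 0 := by
    rw [Finset.sum_filter, ← Finset.sum_add_distrib]
    refine Finset.sum_congr rfl fun t _ => ?_
    have hle := level_le t
    by_cases ht : level t = p
    · rw [if_pos (Or.inr ht), if_pos ht, dif_neg (by omega), R_of_level_eq d β γ ht, weight]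
      ring
    · rw [if_neg ht]
      by_cases h : level s < level t
      · rw [if_pos (by omega), dif_pos ⟨h, by omega⟩, zero_add, weight]
      · rw [if_neg (by omega), dif_neg (by omega), zero_add]
  rw [this]
  ring

/-- The total 2 of the weighted `R_t` turns the constant `-d` into the subtracted 1 in each summand.
-/
theorem R_eq_exp_sub_one {p : ℕ} (d : ℝ) (β γ : Fin p → ℝ) (s : Bits p) :
    R d β γ s = Complex.exp (d / 2 * ∑ t with level s + 1 ≤ level t ∨ level t = p,
      weight β t * R d β γ t * (phase γ (bxor s t) - 1)) := by
  rw [R_eq_exp]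
  congr 1
  simp only [mul_sub, mul_one]
  rw [Finset.sum_sub_distrib, sum_weight_R]
  ring

/-- Below the top, strings no higher than `s` may be added for free: there the factor multiplying
the weight is flip-invariant. The limit of the two-vertex partition sum will appear in this form. -/
theorem R_eq_exp_full {p : ℕ} (d : ℝ) (β γ : Fin p → ℝ) (s : Bits p) :
    R d β γ s = Complex.exp (d / 2 * ∑ t,
      weight β t * R d β γ t * (phase γ (bxor s t) - 1)) := by
  rw [R_eq_exp_sub_one]
  congr 2
  have := sum_weight_mul_eq β (level s + 1)
    (fun t => R d β γ t * (phase γ (bxor s t) - 1)) fun t h1 h2 => by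
      rw [R_innerFlip, phase_bxor_innerFlip γ (by omega) le_rfl]
  simpa only [mul_assoc] using this

end

end QAOA

/-! ### Mean-field partition sums: splitting by level, and uniform bounds. -/

namespace QAOA

noncomputable section

open Filter Topology

/-! ### The averaged edge factor -/

/-- The mean of the edge factor between vertices with strings `s` and `t`, when the edge is present
with probability `q`. -/
def kern {p : ℕ} (γ : Fin p → ℝ) (q : ℝ) (s t : Bits p) : ℂ :=
  1 + q * (phase γ (bxor s t) - 1)

/-- The normalized weight of a string. -/
def amp {p : ℕ} (β : Fin p → ℝ) (s : Bits p) : ℂ := weight β s / 2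

theorem kern_comm {p : ℕ} (γ : Fin p → ℝ) (q : ℝ) (s t : Bits p) :
    kern γ q s t = kern γ q t s := by
  rw [kern, kern, bxor_comm]

/-- The kernel is a convex combination of 1 and a number of modulus 1. -/
theorem norm_kern_le_one {p : ℕ} (γ : Fin p → ℝ) {q : ℝ} (h0 : 0 ≤ q) (h1 : q ≤ 1)
    (s t : Bits p) : ‖kern γ q s t‖ ≤ 1 := by
  have : kern γ q s t = ((1 - q : ℝ) : ℂ) + (q : ℂ) * phase γ (bxor s t) := by
    rw [kern]
    push_cast
    ring
  rw [this]
  refine (norm_add_le _ _).trans ?_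
  rw [norm_mul, norm_phase, mul_one, Complex.norm_real, Complex.norm_real, Real.norm_of_nonneg h0,
    Real.norm_of_nonneg (by linarith)]
  linarith

theorem norm_kern_sub_one_le {p : ℕ} (γ : Fin p → ℝ) {q : ℝ} (h0 : 0 ≤ q)
    (s t : Bits p) : ‖kern γ q s t - 1‖ ≤ 2 * q := by
  have h : ‖phase γ (bxor s t) - 1‖ ≤ 2 := by
    refine (norm_sub_le _ _).trans ?_
    rw [norm_phase, norm_one]
    norm_num
  rw [kern, add_sub_cancel_left, norm_mul, Complex.norm_real, Real.norm_of_nonneg h0, mul_comm]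
  exact mul_le_mul_of_nonneg_right h h0

theorem kern_innerFlip {p : ℕ} (γ : Fin p → ℝ) (q : ℝ) {l : ℕ} {s t : Bits p}
    (hs : l ≤ level s) (ht : l ≤ level t) : kern γ q s (innerFlip l t) = kern γ q s t := by
  rw [kern, kern, phase_bxor_innerFlip γ hs ht]

theorem kern_of_level_eq {p : ℕ} (γ : Fin p → ℝ) (q : ℝ) {s t : Bits p}
    (hs : level s = p) (ht : level t = p) : kern γ q s t = 1 := by
  simp [kern, phase_bxor_of_level_eq γ hs ht]

/-! ### Partition sums over strings of bounded level -/

/-- The partition sum of `m` vertices carrying strings of level at least `l`, in the external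
field `f`. -/
def Zsum {p : ℕ} (β γ : Fin p → ℝ) (q : ℝ) (l : ℕ) : ℕ → (Bits p → ℂ) → ℂ
  | 0, _ => 1
  | m + 1, f => ∑ s with l ≤ level s,
      amp β s * f s * Zsum β γ q l m (fun t => f t * kern γ q s t)

/-- The sum over `k` vertices carrying strings of level `l`, the remaining ones being summed by
`Φ`. -/
def Ysum {p : ℕ} (β γ : Fin p → ℝ) (q : ℝ) (l : ℕ) (Φ : (Bits p → ℂ) → ℂ) :
    ℕ → (Bits p → ℂ) → ℂ
  | 0, f => Φ f
  | k + 1, f => ∑ s with level s = l,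
      amp β s * f s * Ysum β γ q l Φ k (fun t => f t * kern γ q s t)

/-- The functional `Φ` only depends on the values at strings of level at least `l`. -/
def DependsAbove {p : ℕ} (l : ℕ) (Φ : (Bits p → ℂ) → ℂ) : Prop :=
  ∀ f g : Bits p → ℂ, (∀ t, l ≤ level t → f t = g t) → Φ f = Φ g

theorem dependsAbove_Zsum {p : ℕ} (β γ : Fin p → ℝ) (q : ℝ) (l m : ℕ) :
    DependsAbove l (Zsum β γ q l m) := by
  induction m with
  | zero => intro f g _; rfl
  | succ m ih =>
    intro f g h
    simp only [Zsum]
    refine Finset.sum_congr rfl fun s hs => ?_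
    rw [h s (by simpa using hs), ih _ (fun t => g t * kern γ q s t) fun t ht => by rw [h t ht]]

theorem dependsAbove_Ysum {p : ℕ} (β γ : Fin p → ℝ) (q : ℝ) {l : ℕ} {Φ : (Bits p → ℂ) → ℂ}
    (hΦ : DependsAbove l Φ) (k : ℕ) : DependsAbove l (Ysum β γ q l Φ k) := by
  induction k with
  | zero => exact hΦ
  | succ k ih =>
    intro f g h
    simp only [Ysum]
    refine Finset.sum_congr rfl fun s hs => ?_
    rw [h s (by have : level s = l := by simpa using hs
                omega),
      ih _ (fun t => g t * kern γ q s t) fun t ht => by rw [h t ht]]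

theorem DependsAbove.mono {p : ℕ} {l l' : ℕ} (hl : l ≤ l') {Φ : (Bits p → ℂ) → ℂ}
    (h : DependsAbove l' Φ) : DependsAbove l Φ :=
  fun f g hfg => h f g fun t ht => hfg t (hl.trans ht)

/-- The kernel is symmetric, so vertices may be summed in any order; a new vertex moves past those
of level `l` into the inner functional. -/
theorem sum_mul_Ysum {p : ℕ} (β γ : Fin p → ℝ) (q : ℝ) (l k : ℕ) (Φ : (Bits p → ℂ) → ℂ)
    (S : Finset (Bits p)) (f : Bits p → ℂ) :
    ∑ s ∈ S, amp β s * f s * Ysum β γ q l Φ k (fun t => f t * kern γ q s t) =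
      Ysum β γ q l (fun g => ∑ s ∈ S, amp β s * g s * Φ (fun t => g t * kern γ q s t)) k f := by
  induction k generalizing f with
  | zero => rfl
  | succ k ih =>
    simp only [Ysum, ← ih, Finset.mul_sum]
    rw [Finset.sum_comm]
    refine Finset.sum_congr rfl fun t _ => Finset.sum_congr rfl fun s _ => ?_
    rw [kern_comm γ q s t]
    have : (fun u => f u * kern γ q s u * kern γ q t u) =
        fun u => f u * kern γ q t u * kern γ q s u := by
      funext u
      ring
    rw [this]
    ring

/-- This is Pascal's rule: the next vertex either lies above level `l` and joins the inner partition
sum, or lies on level `l` and joins the outer one. -/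
theorem Zsum_eq_sum_Ysum {p : ℕ} (β γ : Fin p → ℝ) (q : ℝ) (l m : ℕ) (f : Bits p → ℂ) :
    Zsum β γ q l m f = ∑ x ∈ Finset.HasAntidiagonal.antidiagonal m,
      (m.choose x.1 : ℂ) * Ysum β γ q l (Zsum β γ q (l + 1) x.2) x.1 f := by
  induction m generalizing f with
  | zero => simp [Zsum, Ysum]
  | succ m ih =>
    rw [Finset.sum_antidiagonal_choose_succ_mul
      (fun i j => Ysum β γ q l (Zsum β γ q (l + 1) j) i f)]
    rw [Zsum, ← Finset.sum_filter_add_sum_filter_not _ (fun s => l + 1 ≤ level s)]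
    congr 1
    · rw [Finset.filter_filter]
      have e : (Finset.univ.filter fun s : Bits p => l ≤ level s ∧ l + 1 ≤ level s) =
          Finset.univ.filter fun s => l + 1 ≤ level s := by
        ext s
        simp only [Finset.mem_filter, Finset.mem_univ, true_and]
        omega
      rw [e]
      simp only [ih, Finset.mul_sum]
      rw [Finset.sum_comm]
      refine Finset.sum_congr rfl fun x _ => ?_
      have := sum_mul_Ysum β γ q l x.1 (Zsum β γ q (l + 1) x.2)
        (Finset.univ.filter fun s => l + 1 ≤ level s) f
      have h2 : Zsum β γ q (l + 1) (x.2 + 1) = fun g => ∑ s with l + 1 ≤ level s,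
        amp β s * g s * Zsum β γ q (l + 1) x.2 (fun t => g t * kern γ q s t) := rfl
      rw [h2, ← this, Finset.mul_sum]
      refine Finset.sum_congr rfl fun s _ => ?_
      ring
    · rw [Finset.filter_filter]
      have e : (Finset.univ.filter fun s : Bits p => l ≤ level s ∧ ¬ l + 1 ≤ level s) =
          Finset.univ.filter fun s => level s = l := by
        ext s
        simp only [Finset.mem_filter, Finset.mem_univ, true_and]
        omega
      rw [e]
      simp only [ih, Finset.mul_sum]
      rw [Finset.sum_comm]
      refine Finset.sum_congr rfl fun x hx => ?_
      rw [Ysum, Finset.mul_sum]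
      have hx' : x.1 + x.2 = m := by simpa using hx
      rw [show m.choose x.2 = m.choose x.1 from by
        rw [← hx', Nat.choose_symm_add]]
      refine Finset.sum_congr rfl fun s _ => ?_
      ring

theorem Zsum_eq_sum_range {p : ℕ} (β γ : Fin p → ℝ) (q : ℝ) (l m : ℕ) (f : Bits p → ℂ) :
    Zsum β γ q l m f = ∑ k ∈ Finset.range (m + 1),
      (m.choose k : ℂ) * Ysum β γ q l (Zsum β γ q (l + 1) (m - k)) k f := by
  rw [Zsum_eq_sum_Ysum, Finset.Nat.sum_antidiagonal_eq_sum_range_succ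
    (fun i j => (m.choose i : ℂ) * Ysum β γ q l (Zsum β γ q (l + 1) j) i f)]

/-- On the strings of a level below the top, only the part of the field that is odd under the
central flip contributes. -/
theorem Ysum_succ_eq {p : ℕ} (β γ : Fin p → ℝ) (q : ℝ) {l : ℕ} (hl : l < p)
    {Φ : (Bits p → ℂ) → ℂ} (hΦ : DependsAbove l Φ) (k : ℕ) (f : Bits p → ℂ) :
    Ysum β γ q l Φ (k + 1) f = ∑ s with level s = l, amp β s * ((f s - f (innerFlip l s)) / 2) *
      Ysum β γ q l Φ k (fun t => f t * kern γ q s t) := by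
  -- The even part of the field cancels because the inner sum is itself flip-invariant in `s`: it
  -- only sees strings of level at least `l`, against which the flip of `s` is invisible.
  have h := sum_level_eq_zero β hl (fun s => (f s + f (innerFlip l s)) *
    Ysum β γ q l Φ k (fun t => f t * kern γ q s t)) fun s hs => by
      rw [innerFlip_innerFlip, add_comm]
      congr 1
      refine dependsAbove_Ysum β γ q hΦ k _ _ fun t ht => ?_
      rw [kern_comm, kern_innerFlip γ q ht hs.ge, kern_comm]
  rw [Ysum, ← sub_eq_zero, ← Finset.sum_sub_distrib]
  rw [← mul_right_inj' (show (4 : ℂ) ≠ 0 by norm_num), mul_zero, ← h, Finset.mul_sum]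
  refine Finset.sum_congr rfl fun s _ => ?_
  rw [amp]
  ring

/-- Top-level strings do not interact, so the partition sum factorizes over the vertices. -/
theorem Zsum_top {p : ℕ} (β γ : Fin p → ℝ) (q : ℝ) (m : ℕ) (f : Bits p → ℂ) :
    Zsum β γ q p m f = (∑ s with level s = p, amp β s * f s) ^ m := by
  induction m with
  | zero => simp [Zsum]
  | succ m ih =>
    have e : (Finset.univ.filter fun s : Bits p => p ≤ level s) =
        Finset.univ.filter fun s => level s = p := by
      ext s
      have := level_le s
      simp only [Finset.mem_filter, Finset.mem_univ, true_and]
      omega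
    rw [Zsum, pow_succ', Finset.sum_mul, e]
    refine Finset.sum_congr rfl fun s hs => ?_
    rw [← ih]
    congr 1
    refine dependsAbove_Zsum β γ q p m _ _ fun t ht => ?_
    rw [kern_of_level_eq γ q (by simpa using hs) (le_antisymm (level_le t) ht), mul_one]

theorem sum_amp_top {p : ℕ} (β : Fin p → ℝ) : ∑ s with level s = p, amp β s = 1 := by
  simp only [amp]
  rw [← Finset.sum_div, sum_weight_top]
  norm_num

/-! ### Uniform bounds -/

theorem norm_mul_sub_one_le {a b : ℂ} (hb : ‖b‖ ≤ 1) {x y : ℝ} (ha : ‖a - 1‖ ≤ x)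
    (hb' : ‖b - 1‖ ≤ y) : ‖a * b - 1‖ ≤ x + y := by
  have : a * b - 1 = (a - 1) * b + (b - 1) := by ring
  rw [this]
  refine (norm_add_le _ _).trans (add_le_add ?_ hb')
  rw [norm_mul]
  exact (mul_le_of_le_one_right (norm_nonneg _) hb).trans ha

theorem norm_mul_kern_le {p : ℕ} (γ : Fin p → ℝ) {q : ℝ} (h0 : 0 ≤ q) (h1 : q ≤ 1)
    {f : Bits p → ℂ} (hf : ∀ t, ‖f t‖ ≤ 1) (s t : Bits p) : ‖f t * kern γ q s t‖ ≤ 1 := by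
  rw [norm_mul]
  exact mul_le_one₀ (hf t) (norm_nonneg _) (norm_kern_le_one γ h0 h1 s t)

/-- The total weight. -/
def ampNorm {p : ℕ} (β : Fin p → ℝ) : ℝ := ∑ s, ‖amp β s‖

theorem ampNorm_nonneg {p : ℕ} (β : Fin p → ℝ) : 0 ≤ ampNorm β :=
  Finset.sum_nonneg fun _ _ => norm_nonneg _

theorem norm_sum_amp_mul_le {p : ℕ} (β : Fin p → ℝ) (S : Finset (Bits p)) {F : Bits p → ℂ}
    {c : ℝ} (hc : 0 ≤ c) (hF : ∀ s ∈ S, ‖F s‖ ≤ c) :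
    ‖∑ s ∈ S, amp β s * F s‖ ≤ ampNorm β * c := by
  calc ‖∑ s ∈ S, amp β s * F s‖ ≤ ∑ s ∈ S, ‖amp β s * F s‖ := norm_sum_le _ _
    _ ≤ ∑ s ∈ S, ‖amp β s‖ * c := Finset.sum_le_sum fun s hs => by
        rw [norm_mul]
        exact mul_le_mul_of_nonneg_left (hF s hs) (norm_nonneg _)
    _ ≤ ∑ s, ‖amp β s‖ * c := Finset.sum_le_sum_of_subset_of_nonneg (Finset.subset_univ _)
        fun _ _ _ => mul_nonneg (norm_nonneg _) hc
    _ = ampNorm β * c := by rw [← Finset.sum_mul, ampNorm]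

/-- Each vertex of level `l` costs a factor `ampNorm β * ε` from the odd part of the field and moves
the field from 1 by at most `2q` more. The odd part stays below `2ε`, since the new kernel is
flip-even on level `l` and has modulus at most 1. -/
theorem norm_Ysum_le {p : ℕ} (β γ : Fin p → ℝ) {q : ℝ} (h0 : 0 ≤ q) (h1 : q ≤ 1) {l : ℕ}
    (hl : l < p) {Φ : (Bits p → ℂ) → ℂ} (hΦ : DependsAbove l Φ) {c : ℝ}
    (hc : ∀ g : Bits p → ℂ, ∀ δ : ℝ, (∀ t, ‖g t‖ ≤ 1) → (∀ t, ‖g t - 1‖ ≤ δ) →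
      ‖Φ g‖ ≤ Real.exp (c * δ)) {ε : ℝ} (hε : 0 ≤ ε) (k : ℕ) (f : Bits p → ℂ) (δ : ℝ)
    (hf : ∀ t, ‖f t‖ ≤ 1) (hfδ : ∀ t, ‖f t - 1‖ ≤ δ)
    (hfε : ∀ t, level t = l → ‖f t - f (innerFlip l t)‖ ≤ 2 * ε) :
    ‖Ysum β γ q l Φ k f‖ ≤ (ampNorm β * ε) ^ k * Real.exp (c * (δ + 2 * q * k)) := by
  induction k generalizing f δ with
  | zero => simpa [Ysum] using hc f δ hf hfδ
  | succ k ih =>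
    rw [Ysum_succ_eq β γ q hl hΦ]
    simp only [mul_assoc (amp β _)]
    have key := norm_sum_amp_mul_le β (Finset.univ.filter fun s => level s = l)
      (F := fun s => (f s - f (innerFlip l s)) / 2 *
        Ysum β γ q l Φ k (fun t => f t * kern γ q s t))
      (c := ε * ((ampNorm β * ε) ^ k * Real.exp (c * (δ + 2 * q + 2 * q * k))))
      (by have := ampNorm_nonneg β; positivity) ?_
    · refine key.trans (le_of_eq ?_)
      push_cast
      ring_nf
    · intro s hs
      have hs' : level s = l := by simpa using hs
      rw [norm_mul]
      refine mul_le_mul ?_ ?_ (norm_nonneg _) hε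
      · have := hfε s hs'
        rw [norm_div, Complex.norm_ofNat]
        linarith
      · refine ih _ _ (norm_mul_kern_le γ h0 h1 hf s) (fun t => norm_mul_sub_one_le
          (norm_kern_le_one γ h0 h1 s t) (hfδ t) (norm_kern_sub_one_le γ h0 s t)) ?_
        intro t ht
        rw [kern_innerFlip γ q hs'.ge ht.ge, ← sub_mul, norm_mul]
        exact (mul_le_of_le_one_right (norm_nonneg _) (norm_kern_le_one γ h0 h1 s t)).trans
          (hfε t ht)

/-- Bounds uniform in the number of vertices exist only because the odd part of the field is
controlled by `δ`; a plain triangle inequality could give `ampNorm β ^ m`. The induction descends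
through the levels, with `i` the distance to the top. -/
theorem exists_norm_Zsum_le {p : ℕ} (β γ : Fin p → ℝ) (D : ℝ) (i l : ℕ) (hil : l + i = p) :
    ∃ C : ℝ, 0 ≤ C ∧ ∀ (q : ℝ) (m : ℕ) (f : Bits p → ℂ) (δ : ℝ), 0 ≤ q → q ≤ 1 →
      2 * q * m ≤ D → (∀ t, ‖f t‖ ≤ 1) → (∀ t, ‖f t - 1‖ ≤ δ) →
      ‖Zsum β γ q l m f‖ ≤ Real.exp (C * m * δ) := by
  induction i generalizing l with
  | zero =>
    obtain rfl : l = p := by omega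
    refine ⟨ampNorm β, ampNorm_nonneg β, fun q m f δ _ _ _ _ hδ => ?_⟩
    -- Any string serves here; it only witnesses that `δ` bounds a norm.
    have hδ0 : 0 ≤ δ := (norm_nonneg _).trans (hδ fun _ => false)
    rw [Zsum_top, norm_pow]
    have e : ∑ s with level s = l, amp β s * f s =
        1 + ∑ s with level s = l, amp β s * (f s - 1) := by
      simp only [mul_sub, mul_one]
      rw [Finset.sum_sub_distrib, sum_amp_top]
      ring
    have h1 : ‖∑ s with level s = l, amp β s * f s‖ ≤ Real.exp (ampNorm β * δ) := by
      rw [e]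
      refine (norm_add_le _ _).trans ?_
      rw [norm_one]
      have := norm_sum_amp_mul_le β (Finset.univ.filter fun s => level s = l)
        (F := fun s => f s - 1) hδ0 fun s _ => hδ s
      have h2 := Real.add_one_le_exp (ampNorm β * δ)
      linarith
    refine (pow_le_pow_left₀ (norm_nonneg _) h1 m).trans (le_of_eq ?_)
    rw [← Real.exp_nat_mul]
    ring_nf
  | succ i ih =>
    obtain ⟨C, hC, hZ⟩ := ih (l + 1) (by omega)
    refine ⟨C + ampNorm β * Real.exp (C * D), by
      have := ampNorm_nonneg β; positivity, fun q m f δ h0 h1 hqm hf hδ => ?_⟩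
    have hδ0 : 0 ≤ δ := (norm_nonneg _).trans (hδ fun _ => false)
    have hA := ampNorm_nonneg β
    have hY : ∀ k ∈ Finset.range (m + 1),
        ‖(m.choose k : ℂ) * Ysum β γ q l (Zsum β γ q (l + 1) (m - k)) k f‖ ≤
        Real.exp (C * m * δ) *
          ((ampNorm β * Real.exp (C * D) * δ) ^ k * 1 ^ (m - k) * (m.choose k)) := by
      intro k _
      rw [norm_mul, Complex.norm_natCast]
      have hb := norm_Ysum_le β γ h0 h1 (l := l) (by omega)
        ((dependsAbove_Zsum β γ q (l + 1) (m - k)).mono (Nat.le_succ l)) (c := C * m)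
        (fun g δ' hg hg' => by
          have hδ' : 0 ≤ δ' := (norm_nonneg _).trans (hg' fun _ => false)
          have hmk : ((m - k : ℕ) : ℝ) ≤ m := by exact_mod_cast Nat.sub_le m k
          refine (hZ q (m - k) g δ' h0 h1 (le_trans (by gcongr) hqm) hg hg').trans ?_
          gcongr)
        hδ0 k f δ hf hδ (fun t _ => by
          have e : f t - f (innerFlip l t) = (f t - 1) - (f (innerFlip l t) - 1) := by ring
          rw [e]
          refine (norm_sub_le _ _).trans ?_
          linarith [hδ t, hδ (innerFlip l t)])
      -- The field shift accumulated by `k` vertices costs at most a factor `exp (C * D)` for each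
      -- of them, because `2 * q * m ≤ D`.
      have h3 : Real.exp (C * m * (δ + 2 * q * k)) ≤
          Real.exp (C * m * δ) * Real.exp (C * D) ^ k := by
        rw [← Real.exp_nat_mul, ← Real.exp_add]
        refine Real.exp_le_exp.2 ?_
        have : C * (2 * q * m) * k ≤ C * D * k := by gcongr
        nlinarith
      calc (m.choose k : ℝ) * ‖Ysum β γ q l (Zsum β γ q (l + 1) (m - k)) k f‖
          ≤ (m.choose k : ℝ) * ((ampNorm β * δ) ^ k *
            (Real.exp (C * m * δ) * Real.exp (C * D) ^ k)) := by
            refine mul_le_mul_of_nonneg_left (hb.trans ?_) (Nat.cast_nonneg _)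
            exact mul_le_mul_of_nonneg_left h3 (by positivity)
        _ = _ := by
            rw [one_pow, mul_one, mul_pow, mul_pow, mul_pow]
            ring
    rw [Zsum_eq_sum_range]
    refine (norm_sum_le _ _).trans ((Finset.sum_le_sum hY).trans ?_)
    -- The binomial theorem sums over the number of level-`l` vertices, and `1 + x ≤ e^x` then gives
    -- the new constant.
    rw [← Finset.mul_sum, ← add_pow]
    have h4 : (ampNorm β * Real.exp (C * D) * δ + 1) ^ m ≤
        Real.exp (m * (ampNorm β * Real.exp (C * D) * δ)) := by
      rw [Real.exp_nat_mul]
      exact pow_le_pow_left₀ (by positivity) (Real.add_one_le_exp _) m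
    refine (mul_le_mul_of_nonneg_left h4 (Real.exp_pos _).le).trans (le_of_eq ?_)
    rw [← Real.exp_add]
    ring_nf

end

end QAOA

/-! ### The sparse limit of the partition sums. -/

namespace QAOA

noncomputable section

open Filter Topology

/-! ### Convergence of the partition sums -/

/-- Write the exponent as `(m n / n) * (n * log (1 + x n))`; since `x n → 0`, eventually `1 + x n ≠
0`. -/
theorem tendsto_one_add_pow_of_ratio {x : ℕ → ℂ} {m : ℕ → ℕ} {t : ℂ}
    (hx : Tendsto (fun n : ℕ => (n : ℂ) * x n) atTop (𝓝 t))
    (hm : Tendsto (fun n : ℕ => (m n : ℝ) / n) atTop (𝓝 1)) :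
    Tendsto (fun n => (1 + x n) ^ m n) atTop (𝓝 (Complex.exp t)) := by
  have hlog := Complex.tendsto_nat_mul_log_one_add_of_tendsto hx
  have hm' : Tendsto (fun n : ℕ => ((m n : ℂ) / n)) atTop (𝓝 1) := by
    have := (Complex.continuous_ofReal.tendsto 1).comp hm
    simpa [Function.comp_def] using this
  have hprod := (Complex.continuous_exp.tendsto _).comp (hm'.mul hlog)
  rw [one_mul] at hprod
  have hx0 : Tendsto x atTop (𝓝 0) := by
    have := hx.mul (tendsto_inv_atTop_nhds_zero_nat (𝕜 := ℂ))
    rw [mul_zero] at this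
    refine this.congr' ?_
    filter_upwards [eventually_ne_atTop 0] with n hn
    have : (n : ℂ) ≠ 0 := by exact_mod_cast hn
    field_simp
  refine hprod.congr' ?_
  filter_upwards [eventually_ne_atTop 0, hx0.eventually_ne (show (0 : ℂ) ≠ -1 by simp)] with n hn hne
  have hn' : (n : ℂ) ≠ 0 := by exact_mod_cast hn
  have h1 : (1 : ℂ) + x n ≠ 0 := fun h => hne (by linear_combination h)
  simp only [Function.comp_apply]
  rw [← mul_assoc, div_mul_cancel₀ _ hn', Complex.exp_nat_mul, Complex.exp_log h1]

/-- A sequence of edge probabilities in the sparse regime, with mean degree tending to `d`. -/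
structure Sparse (d : ℝ) (q : ℕ → ℝ) : Prop where
  nonneg : ∀ n, 0 ≤ q n
  le_one : ∀ n, q n ≤ 1
  tendsto : Tendsto (fun n : ℕ => (n : ℝ) * q n) atTop (𝓝 d)

theorem Sparse.tendsto_complex {d : ℝ} {q : ℕ → ℝ} (hq : Sparse d q) :
    Tendsto (fun n : ℕ => (n : ℂ) * (q n : ℂ)) atTop (𝓝 (d : ℂ)) := by
  have := (Complex.continuous_ofReal.tendsto d).comp hq.tendsto
  simpa [Function.comp_def] using this

theorem Sparse.tendsto_zero {d : ℝ} {q : ℕ → ℝ} (hq : Sparse d q) :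
    Tendsto (fun n : ℕ => (q n : ℂ)) atTop (𝓝 0) := by
  have := hq.tendsto_complex.mul (tendsto_inv_atTop_nhds_zero_nat (𝕜 := ℂ))
  rw [mul_zero] at this
  refine this.congr' ?_
  filter_upwards [eventually_ne_atTop 0] with n hn
  have : (n : ℂ) ≠ 0 := by exact_mod_cast hn
  field_simp

theorem tendsto_mul_kern_sub_one {p : ℕ} (γ : Fin p → ℝ) {d : ℝ} {q : ℕ → ℝ} (hq : Sparse d q)
    {f : ℕ → Bits p → ℂ} {g : Bits p → ℂ}
    (hg : ∀ t, Tendsto (fun n : ℕ => (n : ℂ) * (f n t - 1)) atTop (𝓝 (g t))) (s t : Bits p) :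
    Tendsto (fun n : ℕ => (n : ℂ) * (f n t * kern γ (q n) s t - 1)) atTop
      (𝓝 (g t + d * (phase γ (bxor s t) - 1))) := by
  have h1 : Tendsto (fun n => kern γ (q n) s t) atTop (𝓝 1) := by
    have := (hq.tendsto_zero.mul_const (phase γ (bxor s t) - 1)).const_add 1
    simpa [kern] using this
  have h2 := ((hg t).mul h1).add (hq.tendsto_complex.mul_const (phase γ (bxor s t) - 1))
  rw [mul_one] at h2
  refine h2.congr fun n => ?_
  rw [kern]
  ring

/-- The exponent of the limit of the partition sum over levels at least `l`. -/
def limExp {p : ℕ} (d : ℝ) (β γ : Fin p → ℝ) (l : ℕ) (g : Bits p → ℂ) : ℂ :=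
  ∑ s with l ≤ level s, amp β s * R d β γ s * g s

/-- This is where `R` enters: a vertex with string `s` shifts the rescaled field on the higher
levels by `d (e^{iφ} - 1)`, and the fixed-point equation says that the limit is thereby multiplied
by `R_s`. -/
theorem exp_limExp_add {p : ℕ} (d : ℝ) (β γ : Fin p → ℝ) (g : Bits p → ℂ) {s : Bits p}
    (hs : level s < p) :
    Complex.exp (limExp d β γ (level s + 1) (fun t => g t + d * (phase γ (bxor s t) - 1))) =
      Complex.exp (limExp d β γ (level s + 1) g) * R d β γ s := by
  rw [R_eq_exp_sub_one d β γ s, ← Complex.exp_add]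
  congr 1
  have e : (Finset.univ.filter fun t : Bits p => level s + 1 ≤ level t ∨ level t = p) =
      Finset.univ.filter fun t => level s + 1 ≤ level t := by
    ext t
    simp only [Finset.mem_filter, Finset.mem_univ, true_and]
    omega
  rw [e, limExp, limExp, Finset.mul_sum, ← Finset.sum_add_distrib]
  refine Finset.sum_congr rfl fun t _ => ?_
  rw [amp]
  ring

/-- The statement that the partition sums over levels at least `l` converge. -/
def ZsumTendsto {p : ℕ} (d : ℝ) (β γ : Fin p → ℝ) (l : ℕ) : Prop :=
  ∀ (q : ℕ → ℝ) (m : ℕ → ℕ) (f : ℕ → Bits p → ℂ) (g : Bits p → ℂ), Sparse d q →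
    Tendsto (fun n : ℕ => (m n : ℝ) / n) atTop (𝓝 1) → (∀ n t, ‖f n t‖ ≤ 1) →
    (∀ t, Tendsto (fun n : ℕ => (n : ℂ) * (f n t - 1)) atTop (𝓝 (g t))) →
    Tendsto (fun n => Zsum β γ (q n) l (m n) (f n)) atTop (𝓝 (Complex.exp (limExp d β γ l g)))

theorem zsumTendsto_top {p : ℕ} (d : ℝ) (β γ : Fin p → ℝ) : ZsumTendsto d β γ p := by
  intro q m f g _ hm _ hg
  simp only [Zsum_top]
  have e : ∀ n, ∑ s with level s = p, amp β s * f n s =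
      1 + ∑ s with level s = p, amp β s * (f n s - 1) := by
    intro n
    simp only [mul_sub, mul_one]
    rw [Finset.sum_sub_distrib, sum_amp_top]
    ring
  simp only [e]
  refine tendsto_one_add_pow_of_ratio ?_ hm
  have h1 : limExp d β γ p g = ∑ s with level s = p, amp β s * g s := by
    refine Finset.sum_congr ?_ fun s hs => ?_
    · ext s
      have := level_le s
      simp only [Finset.mem_filter, Finset.mem_univ, true_and]
      omega
    · rw [R_of_level_eq d β γ (by simpa using hs), mul_one]
  rw [h1]
  simp only [Finset.mul_sum]
  refine tendsto_finsetSum _ fun s _ => ?_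
  refine ((hg s).const_mul (amp β s)).congr fun n => ?_
  ring

/-- One factor `n` per vertex compensates the `1/n` in the odd part of the field. Vertices of the
same level do not affect each other's odd part, so in the limit they factorize and give a `k`-th
power. -/
theorem tendsto_pow_mul_Ysum {p : ℕ} {d : ℝ} {β γ : Fin p → ℝ} {l : ℕ} (hl : l < p)
    (hZ : ZsumTendsto d β γ (l + 1)) {q : ℕ → ℝ} (hq : Sparse d q) {m : ℕ → ℕ}
    (hm : Tendsto (fun n : ℕ => (m n : ℝ) / n) atTop (𝓝 1)) (k : ℕ) (f : ℕ → Bits p → ℂ)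
    (g : Bits p → ℂ) (hf : ∀ n t, ‖f n t‖ ≤ 1)
    (hg : ∀ t, Tendsto (fun n : ℕ => (n : ℂ) * (f n t - 1)) atTop (𝓝 (g t))) :
    Tendsto (fun n : ℕ => (n : ℂ) ^ k *
        Ysum β γ (q n) l (Zsum β γ (q n) (l + 1) (m n)) k (f n)) atTop
      (𝓝 ((∑ s with level s = l, amp β s * R d β γ s * ((g s - g (innerFlip l s)) / 2)) ^ k *
        Complex.exp (limExp d β γ (l + 1) g))) := by
  induction k generalizing f g with
  | zero => simpa [Ysum] using hZ q m f g hq hm hf hg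
  | succ k ih =>
    have hdep : ∀ n, DependsAbove l (Zsum β γ (q n) (l + 1) (m n)) := fun n =>
      (dependsAbove_Zsum β γ (q n) (l + 1) (m n)).mono (Nat.le_succ l)
    have e : ∀ n : ℕ, (n : ℂ) ^ (k + 1) *
        Ysum β γ (q n) l (Zsum β γ (q n) (l + 1) (m n)) (k + 1) (f n) =
        ∑ s with level s = l, amp β s *
          (((n : ℂ) * (f n s - 1) - n * (f n (innerFlip l s) - 1)) / 2) * ((n : ℂ) ^ k *
          Ysum β γ (q n) l (Zsum β γ (q n) (l + 1) (m n)) k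
            (fun t => f n t * kern γ (q n) s t)) := by
      intro n
      rw [Ysum_succ_eq β γ (q n) hl (hdep n), Finset.mul_sum]
      refine Finset.sum_congr rfl fun s _ => ?_
      ring
    simp only [e]
    rw [pow_succ', Finset.sum_mul, Finset.sum_mul]
    refine tendsto_finsetSum _ fun s hs => ?_
    have hs' : level s = l := by simpa using hs
    have h1 := ih (fun n t => f n t * kern γ (q n) s t)
      (fun t => g t + d * (phase γ (bxor s t) - 1))
      (fun n t => norm_mul_kern_le γ (hq.nonneg n) (hq.le_one n) (hf n) s t)
      (fun t => tendsto_mul_kern_sub_one γ hq hg s t)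
    -- The shift caused by `s` is flip-even on its own level, so the odd part is that of `g` alone.
    have h2 : ∑ s' with level s' = l, amp β s' * R d β γ s' *
        ((g s' + d * (phase γ (bxor s s') - 1) -
          (g (innerFlip l s') + d * (phase γ (bxor s (innerFlip l s')) - 1))) / 2) =
        ∑ s' with level s' = l, amp β s' * R d β γ s' * ((g s' - g (innerFlip l s')) / 2) := by
      refine Finset.sum_congr rfl fun s' hs2 => ?_
      have : level s' = l := by simpa using hs2
      rw [phase_bxor_innerFlip γ hs'.ge this.ge]
      ring
    have h3 := exp_limExp_add d β γ g (s := s) (by omega)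
    rw [hs'] at h3
    rw [h2, h3] at h1
    have h4 := ((((hg s).sub (hg (innerFlip l s))).div_const 2).const_mul (amp β s)).mul h1
    refine h4.trans (le_of_eq ?_)
    congr 1
    ring

/-- Against the flip-invariant `R` the even part of `g` drops out anyway, so the level-`l`
contribution takes the form of the terms of `limExp`. -/
theorem sum_level_R_odd_part {p : ℕ} (d : ℝ) (β γ : Fin p → ℝ) {l : ℕ} (hl : l < p)
    (g : Bits p → ℂ) :
    ∑ s with level s = l, amp β s * R d β γ s * ((g s - g (innerFlip l s)) / 2) =
      ∑ s with level s = l, amp β s * R d β γ s * g s := by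
  have h := sum_level_eq_zero β hl (fun s => R d β γ s * (g s + g (innerFlip l s))) fun s hs => by
    have := R_innerFlip d β γ s
    rw [hs] at this
    rw [this, innerFlip_innerFlip, add_comm]
  rw [← sub_eq_zero, ← Finset.sum_sub_distrib, ← mul_right_inj' (show (-4 : ℂ) ≠ 0 by norm_num),
    mul_zero, ← h, Finset.mul_sum]
  refine Finset.sum_congr rfl fun s _ => ?_
  rw [amp]
  ring

theorem tendsto_choose_div_pow {m : ℕ → ℕ}
    (hm : Tendsto (fun n : ℕ => (m n : ℝ) / n) atTop (𝓝 1)) (k : ℕ) :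
    Tendsto (fun n : ℕ => ((m n).choose k : ℂ) / (n : ℂ) ^ k) atTop
      (𝓝 (1 / (k.factorial : ℂ))) := by
  have hm' : Tendsto (fun n : ℕ => (m n : ℝ)) atTop atTop := by
    have := hm.pos_mul_atTop one_pos (tendsto_natCast_atTop_atTop (R := ℝ))
    refine this.congr' ?_
    filter_upwards [eventually_ne_atTop 0] with n hn
    have : (n : ℝ) ≠ 0 := by exact_mod_cast hn
    field_simp
  have hm2 : Tendsto m atTop atTop := tendsto_natCast_atTop_iff.1 hm'
  have h1 : Tendsto (fun n : ℕ => (n.choose k : ℝ) / ((n : ℝ) ^ k / k.factorial)) atTop (𝓝 1) := by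
    refine (Asymptotics.isEquivalent_iff_tendsto_one ?_).1 (isEquivalent_choose k)
    filter_upwards [eventually_ne_atTop 0] with n hn
    have : (n : ℝ) ≠ 0 := by exact_mod_cast hn
    positivity
  have h2 := ((h1.comp hm2).mul (hm.pow k)).mul_const (1 / (k.factorial : ℝ))
  have h3 : Tendsto (fun n : ℕ => ((m n).choose k : ℝ) / (n : ℝ) ^ k) atTop
      (𝓝 (1 / (k.factorial : ℝ))) := by
    rw [one_pow, one_mul, one_mul] at h2
    refine h2.congr' ?_
    filter_upwards [hm2.eventually_ne_atTop 0] with n hn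
    have h4 : (m n : ℝ) ≠ 0 := by exact_mod_cast hn
    have h5 : (k.factorial : ℝ) ≠ 0 := by positivity
    simp only [Function.comp_apply]
    rw [div_pow]
    field_simp
  have := (Complex.continuous_ofReal.tendsto _).comp h3
  simpa [Function.comp_def] using this

theorem tendsto_sub_const_div {m : ℕ → ℕ}
    (hm : Tendsto (fun n : ℕ => (m n : ℝ) / n) atTop (𝓝 1)) (k : ℕ) :
    Tendsto (fun n : ℕ => ((m n - k : ℕ) : ℝ) / n) atTop (𝓝 1) := by
  have h0 : Tendsto (fun n : ℕ => (k : ℝ) / n) atTop (𝓝 0) :=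
    tendsto_const_div_atTop_nhds_zero_nat (k : ℝ)
  have h1 := hm.sub h0
  rw [sub_zero] at h1
  refine tendsto_of_tendsto_of_tendsto_of_le_of_le h1 hm (fun n => ?_) (fun n => ?_)
  · simp only
    rw [← sub_div]
    refine div_le_div_of_nonneg_right ?_ (Nat.cast_nonneg n)
    have : m n ≤ (m n - k) + k := by omega
    have : (m n : ℝ) ≤ ((m n - k : ℕ) : ℝ) + k := by exact_mod_cast this
    linarith
  · simp only
    refine div_le_div_of_nonneg_right ?_ (Nat.cast_nonneg n)
    exact_mod_cast Nat.sub_le _ _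

theorem zsumTendsto_of_succ {p : ℕ} {d : ℝ} {β γ : Fin p → ℝ} {l : ℕ} (hl : l < p)
    (hZ : ZsumTendsto d β γ (l + 1)) : ZsumTendsto d β γ l := by
  intro q m f g hq hm hf hg
  -- The constant `4 * (d + 1)` bounds `2 * q n * m n`, since eventually `n * q n < d + 1` and `m n
  -- < 2 * n`.
  obtain ⟨C, hC, hbound⟩ := exists_norm_Zsum_le β γ (4 * (d + 1)) (p - (l + 1)) (l + 1) (by omega)
  set x : ℂ := ∑ s with level s = l, amp β s * R d β γ s * g s with hx
  set E : ℂ := Complex.exp (limExp d β γ (l + 1) g) with hE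
  have hlim : Complex.exp (limExp d β γ l g) = ∑' k : ℕ, x ^ k / (k.factorial : ℂ) * E := by
    rw [tsum_mul_right, ← congrFun (NormedSpace.exp_eq_tsum_div (𝔸 := ℂ)) x,
      ← Complex.exp_eq_exp_ℂ, hE, ← Complex.exp_add]
    congr 1
    rw [hx, limExp, limExp, ← Finset.sum_filter_add_sum_filter_not _ (fun s => level s = l),
      Finset.filter_filter, Finset.filter_filter]
    congr 1 <;> refine Finset.sum_congr ?_ fun _ _ => rfl
    · ext s
      simp only [Finset.mem_filter, Finset.mem_univ, true_and]
      omega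
    · ext s
      simp only [Finset.mem_filter, Finset.mem_univ, true_and]
      omega
  -- Extending to a series over all `k` is harmless: the binomial coefficient vanishes for `k > m
  -- n`, where the subtraction `m n - k` is truncated.
  have hsum : ∀ n, Zsum β γ (q n) l (m n) (f n) = ∑' k : ℕ, ((m n).choose k : ℂ) *
      Ysum β γ (q n) l (Zsum β γ (q n) (l + 1) (m n - k)) k (f n) := by
    intro n
    rw [Zsum_eq_sum_range, tsum_eq_sum]
    intro k hk
    have : m n < k := by simpa using hk
    rw [Nat.choose_eq_zero_of_lt this, Nat.cast_zero, zero_mul]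
  rw [hlim]
  simp only [hsum]
  set δ : ℕ → ℝ := fun n => ∑ t, ‖f n t - 1‖ with hδ
  have hδn : Tendsto (fun n : ℕ => (n : ℝ) * δ n) atTop (𝓝 (∑ t, ‖g t‖)) := by
    simp only [hδ, Finset.mul_sum]
    refine tendsto_finsetSum _ fun t _ => ?_
    refine (hg t).norm.congr fun n => ?_
    rw [norm_mul, Complex.norm_natCast]
  set c : ℝ := ∑ t, ‖g t‖ + 1 with hc
  have hc0 : 0 ≤ c := by positivity
  have hA := ampNorm_nonneg β
  have hδ0 : ∀ n, 0 ≤ δ n := fun n => Finset.sum_nonneg fun _ _ => norm_nonneg _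
  have hδt : ∀ n t, ‖f n t - 1‖ ≤ δ n := fun n t =>
    Finset.single_le_sum (f := fun t => ‖f n t - 1‖) (fun _ _ => norm_nonneg _) (Finset.mem_univ t)
  refine tendsto_tsum_of_dominated_convergence
    (bound := fun k => (ampNorm β * (2 * c) * Real.exp (C * (4 * (d + 1)))) ^ k / k.factorial *
      Real.exp (C * (2 * c)))
    ((Real.summable_pow_div_factorial _).mul_right _) ?_ ?_
  · intro k
    have h1 := (tendsto_choose_div_pow hm k).mul
      (tendsto_pow_mul_Ysum hl hZ hq (tendsto_sub_const_div hm k) k f g hf hg)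
    rw [sum_level_R_odd_part d β γ hl g] at h1
    have h2 : x ^ k / (k.factorial : ℂ) * E = 1 / (k.factorial : ℂ) * (x ^ k * E) := by ring
    rw [h2]
    refine h1.congr' ?_
    filter_upwards [eventually_ne_atTop 0] with n hn
    have : (n : ℂ) ≠ 0 := by exact_mod_cast hn
    field_simp
  · have e1 := hm.eventually (gt_mem_nhds (show (1 : ℝ) < 2 by norm_num))
    have e2 := hq.tendsto.eventually (gt_mem_nhds (show d < d + 1 by linarith))
    have e3 := hδn.eventually (gt_mem_nhds (show ∑ t, ‖g t‖ < c by linarith))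
    filter_upwards [e1, e2, e3, eventually_gt_atTop 0] with n h1 h2 h3 hn k
    have hn' : (0 : ℝ) < n := by exact_mod_cast hn
    have hm2 : (m n : ℝ) ≤ 2 * n := by
      rw [div_lt_iff₀ hn'] at h1
      exact h1.le
    have hq0 := hq.nonneg n
    have hqm : 2 * q n * m n ≤ 4 * (d + 1) := by
      calc 2 * q n * m n ≤ 2 * q n * (2 * n) := by gcongr
        _ = 4 * (n * q n) := by ring
        _ ≤ 4 * (d + 1) := by linarith
    have hδm : m n * δ n ≤ 2 * c := by
      calc m n * δ n ≤ 2 * n * δ n := mul_le_mul_of_nonneg_right hm2 (hδ0 n)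
        _ = 2 * (n * δ n) := by ring
        _ ≤ 2 * c := by linarith
    have hb := norm_Ysum_le β γ hq0 (hq.le_one n) hl
      ((dependsAbove_Zsum β γ (q n) (l + 1) (m n - k)).mono (Nat.le_succ l)) (c := C * m n)
      (fun g δ' hg hg' => by
        have hδ' : 0 ≤ δ' := (norm_nonneg _).trans (hg' fun _ => false)
        have hmk : ((m n - k : ℕ) : ℝ) ≤ m n := by exact_mod_cast Nat.sub_le (m n) k
        refine (hbound (q n) (m n - k) g δ' hq0 (hq.le_one n) (le_trans (by gcongr) hqm)
          hg hg').trans ?_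
        gcongr)
      (hδ0 n) k (f n) (δ n) (hf n) (hδt n) (fun t _ => by
        have e : f n t - f n (innerFlip l t) = (f n t - 1) - (f n (innerFlip l t) - 1) := by ring
        rw [e]
        refine (norm_sub_le _ _).trans ?_
        linarith [hδt n t, hδt n (innerFlip l t)])
    rw [norm_mul, Complex.norm_natCast]
    have h4 : Real.exp (C * m n * (δ n + 2 * q n * k)) ≤
        Real.exp (C * (2 * c)) * Real.exp (C * (4 * (d + 1))) ^ k := by
      rw [← Real.exp_nat_mul, ← Real.exp_add]
      refine Real.exp_le_exp.2 ?_
      have h5 : C * (2 * q n * m n) * k ≤ C * (4 * (d + 1)) * k := by gcongr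
      have h6 : C * (m n * δ n) ≤ C * (2 * c) := by gcongr
      nlinarith
    calc ((m n).choose k : ℝ) *
          ‖Ysum β γ (q n) l (Zsum β γ (q n) (l + 1) (m n - k)) k (f n)‖
        ≤ ((m n : ℝ) ^ k / k.factorial) * ((ampNorm β * δ n) ^ k *
          (Real.exp (C * (2 * c)) * Real.exp (C * (4 * (d + 1))) ^ k)) := by
          refine mul_le_mul (Nat.choose_le_pow_div k (m n)) (hb.trans ?_) (norm_nonneg _)
            (by positivity)
          have := hδ0 n
          exact mul_le_mul_of_nonneg_left h4 (by positivity)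
      _ = (ampNorm β * (m n * δ n) * Real.exp (C * (4 * (d + 1)))) ^ k / k.factorial *
          Real.exp (C * (2 * c)) := by
          simp only [mul_pow]
          ring
      _ ≤ _ := by
          have := hδ0 n
          gcongr

theorem zsumTendsto {p : ℕ} (d : ℝ) (β γ : Fin p → ℝ) {l : ℕ} (hl : l ≤ p) :
    ZsumTendsto d β γ l := by
  induction hl using Nat.decreasingInduction with
  | self => exact zsumTendsto_top d β γ
  | of_succ k hk ih => exact zsumTendsto_of_succ hk ih

/-- The partition sum in the field of two vertices with strings `u` and `v`. -/
theorem tendsto_Zsum_pair {p : ℕ} (d : ℝ) (β γ : Fin p → ℝ) {q : ℕ → ℝ} (hq : Sparse d q)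
    {m : ℕ → ℕ} (hm : Tendsto (fun n : ℕ => (m n : ℝ) / n) atTop (𝓝 1)) (u v : Bits p) :
    Tendsto (fun n => Zsum β γ (q n) 0 (m n) (fun t => kern γ (q n) u t * kern γ (q n) v t))
      atTop (𝓝 (R d β γ u * R d β γ v)) := by
  have h := zsumTendsto d β γ (Nat.zero_le p) q m
    (fun n t => kern γ (q n) u t * kern γ (q n) v t)
    (fun t => d * (phase γ (bxor u t) - 1) + d * (phase γ (bxor v t) - 1)) hq hm
    (fun n t => norm_mul_kern_le γ (hq.nonneg n) (hq.le_one n)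
      (norm_kern_le_one γ (hq.nonneg n) (hq.le_one n) u) v t)
    (fun t => tendsto_mul_kern_sub_one γ hq (fun t => by
      have := tendsto_mul_kern_sub_one γ hq (f := fun _ _ => 1) (g := fun _ => 0) (by simp) u t
      simpa using this) v t)
  refine h.trans (le_of_eq ?_)
  -- At level 0 the limiting exponent runs over all strings and is additive in the two fields, so it
  -- splits into the exponents of `R_u` and `R_v`.
  rw [R_eq_exp_full d β γ u, R_eq_exp_full d β γ v, ← Complex.exp_add]
  congr 2
  rw [limExp, Finset.mul_sum, Finset.mul_sum, ← Finset.sum_add_distrib]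
  refine Finset.sum_congr (by simp) fun s _ => ?_
  rw [amp]
  ring

end

end QAOA

/-! ### The energy of a fixed graph as a sum over strings at the vertices. -/

namespace QAOA

noncomputable section

/-! ### The mixer and the cost operator in the computational basis -/

/-- The entries of the (unnormalized) one-qubit Hadamard matrix. -/
def hadSign (a b : Bool) : ℂ := if a && b then -1 else 1

/-- The unnormalized Hadamard transform. -/
def hadamard (n : ℕ) : Op n := Matrix.of fun x z => ∏ k, hadSign (x k) (z k)

theorem sum_prod_bool {n : ℕ} (F : Fin n → Bool → ℂ) :
    ∑ z : Fin n → Bool, ∏ k, F k (z k) = ∏ k, ∑ b, F k b := by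
  rw [Finset.prod_univ_sum, Fintype.piFinset_univ]

theorem hadamard_mul_diagonal_mul_hadamard {n : ℕ} (c : ℂ) (x y : Fin n → Bool) :
    (hadamard n * Matrix.diagonal (fun z : Fin n → Bool => Complex.exp (c * ∑ k, (spin (z k) : ℂ))) *
      hadamard n) x y =
      ∏ k, ∑ b, hadSign (x k) b * Complex.exp (c * spin b) * hadSign b (y k) := by
  rw [← sum_prod_bool, Matrix.mul_apply]
  refine Finset.sum_congr rfl fun z _ => ?_
  rw [Matrix.mul_diagonal, hadamard, Matrix.of_apply, Matrix.of_apply, Finset.mul_sum,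
    Complex.exp_sum, ← Finset.prod_mul_distrib, ← Finset.prod_mul_distrib]

theorem hadamard_mul_self (n : ℕ) : hadamard n * hadamard n = (2 : ℂ) ^ n • (1 : Op n) := by
  ext x y
  have h := hadamard_mul_diagonal_mul_hadamard 0 x y
  simp only [zero_mul, Complex.exp_zero, Matrix.diagonal_one, mul_one] at h
  rw [h, Matrix.smul_apply, Matrix.one_apply]
  split_ifs with hxy
  · subst hxy
    have : ∀ k, ∑ b, hadSign (x k) b * hadSign b (x k) = 2 := by
      intro k
      cases x k <;> simp [hadSign]
      norm_num
    rw [Finset.prod_congr rfl fun k _ => this k]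
    simp
  · obtain ⟨k, hk⟩ := Function.ne_iff.1 hxy
    rw [Finset.prod_eq_zero (Finset.mem_univ k)]
    · simp
    · revert hk
      cases x k <;> cases y k <;> simp [hadSign]

theorem pauliX_mul_hadamard {n : ℕ} (k : Fin n) :
    pauliX k * hadamard n = hadamard n * pauliZ k := by
  ext x z
  rw [pauliZ, Matrix.mul_diagonal, Matrix.mul_apply,
    Finset.sum_eq_single (Function.update x k (!x k))]
  · have h1 : x = Function.update (Function.update x k (!x k)) k
        (!(Function.update x k (!x k)) k) := by
      simp
    rw [pauliX, Matrix.of_apply, if_pos h1, one_mul, hadamard, Matrix.of_apply, Matrix.of_apply,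
      ← Finset.mul_prod_erase _ _ (Finset.mem_univ k),
      ← Finset.mul_prod_erase _ (fun j => hadSign (x j) (z j)) (Finset.mem_univ k)]
    have h2 : ∏ j ∈ Finset.univ.erase k, hadSign (Function.update x k (!x k) j) (z j) =
        ∏ j ∈ Finset.univ.erase k, hadSign (x j) (z j) := by
      refine Finset.prod_congr rfl fun j hj => ?_
      rw [Function.update_of_ne (Finset.ne_of_mem_erase hj)]
    rw [h2, Function.update_self]
    cases x k <;> cases z k <;> simp [hadSign, spin]
  · intro y _ hy
    rw [pauliX, Matrix.of_apply, if_neg, zero_mul]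
    rintro rfl
    apply hy
    simp
  · simp

theorem isUnit_hadamard (n : ℕ) : IsUnit (hadamard n) := by
  have h : hadamard n * (((2 : ℂ) ^ n)⁻¹ • hadamard n) = 1 := by
    rw [Matrix.mul_smul, hadamard_mul_self, smul_smul, inv_mul_cancel₀ (pow_ne_zero n two_ne_zero), one_smul]
  exact IsUnit.of_mul_eq_one _ h

theorem mixerH_mul_hadamard (n : ℕ) :
    mixerH n * hadamard n = hadamard n * Matrix.diagonal (fun z => ∑ k, (spin (z k) : ℂ)) := by
  rw [mixerH, Finset.sum_mul]
  simp only [pauliX_mul_hadamard]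
  rw [← Finset.mul_sum]
  congr 1
  ext x y
  simp only [pauliZ, Matrix.sum_apply, Matrix.diagonal_apply]
  split_ifs <;> simp

theorem exp_diagonal_eq {X : Type*} [Fintype X] [DecidableEq X] (v : X → ℂ) :
    NormedSpace.exp (Matrix.diagonal v) = Matrix.diagonal (fun x => Complex.exp (v x)) := by
  rw [Matrix.exp_diagonal]
  congr 1
  funext x
  rw [Pi.coe_exp, Complex.exp_eq_exp_ℂ]

/-- The Hadamard transform diagonalizes the mixer, so the exponential factorizes over qubits into
`e^{-ibX/2} = cos (b/2) - i sin (b/2) X`; hence the angle `-b`. -/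
theorem exp_mixerH_apply {n : ℕ} (b : ℝ) (x y : Fin n → Bool) :
    NormedSpace.exp ((-(Complex.I * ((b / 2 : ℝ) : ℂ))) • mixerH n) x y =
      ∏ k, mixerAmp (-b) (x k) (y k) := by
  set c : ℂ := -(Complex.I * ((b / 2 : ℝ) : ℂ)) with hc
  have hu := isUnit_hadamard n
  have hdet := (Matrix.isUnit_iff_isUnit_det _).1 hu
  have h1 : c • mixerH n = hadamard n *
      Matrix.diagonal (fun z => c * ∑ k, (spin (z k) : ℂ)) * (hadamard n)⁻¹ := by
    have : Matrix.diagonal (fun z : Fin n → Bool => c * ∑ k, (spin (z k) : ℂ)) =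
        c • Matrix.diagonal (fun z => ∑ k, (spin (z k) : ℂ)) := by
      rw [← Matrix.diagonal_smul]
      rfl
    rw [this, Matrix.mul_smul, ← mixerH_mul_hadamard, Matrix.smul_mul, Matrix.mul_assoc,
      Matrix.mul_nonsing_inv _ hdet, mul_one]
  have hinv : (hadamard n)⁻¹ = ((2 : ℂ) ^ n)⁻¹ • hadamard n := by
    refine Matrix.inv_eq_right_inv ?_
    rw [Matrix.mul_smul, hadamard_mul_self, smul_smul, inv_mul_cancel₀ (pow_ne_zero n two_ne_zero), one_smul]
  rw [h1, Matrix.exp_conj _ _ hu, exp_diagonal_eq, hinv, Matrix.mul_smul, Matrix.smul_apply,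
    hadamard_mul_diagonal_mul_hadamard, smul_eq_mul]
  have h2 : ((2 : ℂ) ^ n)⁻¹ = ∏ _k : Fin n, (2 : ℂ)⁻¹ := by simp
  rw [h2, ← Finset.prod_mul_distrib]
  refine Finset.prod_congr rfl fun k _ => ?_
  have hcos : (Real.cos (-b / 2) : ℂ) = (Complex.exp c + Complex.exp (-c)) / 2 := by
    rw [hc, neg_div, Real.cos_neg, Complex.ofReal_cos, Complex.cos, neg_neg]
    ring_nf
  have hsin : Complex.I * (Real.sin (-b / 2) : ℂ) = (Complex.exp c - Complex.exp (-c)) / 2 := by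
    rw [hc, neg_div, Real.sin_neg, Complex.ofReal_neg, Complex.ofReal_sin, Complex.sin, neg_neg]
    ring_nf
    rw [Complex.I_sq]
    ring_nf
  unfold mixerAmp
  rw [hcos, hsin, Fintype.sum_bool]
  cases x k <;> cases y k <;> simp [hadSign, spin] <;> ring

open Classical in
/-- The eigenvalue of the cost operator at the basis state `x`. -/
def costVal {n : ℕ} (G : SimpleGraph (Fin n)) (x : Fin n → Bool) : ℝ :=
  ∑ k : Fin n, ∑ l ∈ Finset.Ioi k, if G.Adj k l then spin (x k) * spin (x l) else 0

theorem costH_eq {n : ℕ} (G : SimpleGraph (Fin n)) :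
    costH G = Matrix.diagonal fun x => (costVal G x : ℂ) := by
  classical
  ext x y
  simp only [costH, costVal, pauliZ, Matrix.diagonal_mul_diagonal, Matrix.sum_apply,
    Matrix.smul_apply, Matrix.diagonal_apply]
  split_ifs with h
  · push_cast
    refine Finset.sum_congr rfl fun k _ => Finset.sum_congr rfl fun l _ => ?_
    split_ifs <;> simp
  · simp

theorem exp_costH {n : ℕ} (G : SimpleGraph (Fin n)) (c : ℂ) :
    NormedSpace.exp (c • costH G) = Matrix.diagonal fun x => Complex.exp (c * costVal G x) := by
  rw [costH_eq, ← Matrix.diagonal_smul, exp_diagonal_eq]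
  rfl

/-! ### The state as a sum over paths -/

/-- The path `z_0, …, z_{p-1}` followed by `x`. -/
def pathExt {X : Type*} {p : ℕ} (z : Fin p → X) (x : X) (i : ℕ) : X :=
  if h : i < p then z ⟨i, h⟩ else x

/-- The induction peels off the last layer: its input becomes the endpoint of the shorter path, its
output is `x`. -/
theorem foldl_mulVec_eq_sum_paths {X : Type*} [Fintype X] {p : ℕ} (U : Fin p → X → X → ℂ)
    (D : Fin p → X → ℂ) (c : ℂ) (x : X) :
    Fin.foldl p (fun (ψ : X → ℂ) j y => ∑ y', U j y y' * (D j y' * ψ y')) (fun _ => c) x =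
      c * ∑ z : Fin p → X, ∏ j : Fin p, D j (z j) * U j (pathExt z x (j + 1)) (z j) := by
  induction p generalizing x with
  | zero => simp
  | succ p ih =>
    rw [Fin.foldl_succ_last]
    simp only [ih]
    rw [← (Fin.snocEquiv fun _ : Fin (p + 1) => X).sum_comp, Fintype.sum_prod_type, Finset.mul_sum]
    refine Finset.sum_congr rfl fun y _ => ?_
    simp only [Finset.mul_sum]
    refine Finset.sum_congr rfl fun z _ => ?_
    rw [Fin.prod_univ_castSucc]
    have h1 : ∀ j : Fin p, pathExt (Fin.snoc z y : Fin (p + 1) → X) x ((j.castSucc : ℕ) + 1) =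
        pathExt z y (j + 1) := by
      intro j
      have hj : (j : ℕ) + 1 < p + 1 := by omega
      simp only [pathExt, Fin.val_castSucc, hj, dif_pos]
      by_cases h : (j : ℕ) + 1 < p
      · rw [dif_pos h]
        exact Fin.snoc_castSucc (α := fun _ => X) y z ⟨j + 1, h⟩
      · rw [dif_neg h]
        have : (⟨j + 1, hj⟩ : Fin (p + 1)) = Fin.last p := by
          ext
          simp
          omega
        rw [this]
        exact Fin.snoc_last (α := fun _ => X) y z
    have h2 : pathExt (Fin.snoc z y : Fin (p + 1) → X) x ((Fin.last p : ℕ) + 1) = x := by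
      simp [pathExt]
    simp only [Fin.snocEquiv, Equiv.coe_fn_mk, h1, h2, Fin.snoc_castSucc, Fin.snoc_last]
    ring

/-- The value of the initial state. -/
def plusAmp (n : ℕ) : ℂ := ((√((2 : ℝ) ^ n))⁻¹ : ℝ)

theorem plusAmp_mul_star (n : ℕ) : star (plusAmp n) * plusAmp n = ((2 : ℂ) ^ n)⁻¹ := by
  rw [plusAmp, Complex.star_def, Complex.conj_ofReal, ← Complex.ofReal_mul, ← mul_inv,
    Real.mul_self_sqrt (by positivity)]
  push_cast
  rfl

theorem qaoaState_eq {n p : ℕ} (G : SimpleGraph (Fin n)) (β γ : Fin p → ℝ) (x : Fin n → Bool) :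
    qaoaState G β γ x = plusAmp n * ∑ z : Fin p → Fin n → Bool, ∏ j : Fin p,
      Complex.exp (-(Complex.I * ((γ j / 2 : ℝ) : ℂ)) * costVal G (z j)) *
        ∏ v, mixerAmp (-β j) (pathExt z x (j + 1) v) (z j v) := by
  rw [← foldl_mulVec_eq_sum_paths
    (fun j (y y' : Fin n → Bool) => ∏ v, mixerAmp (-β j) (y v) (y' v))
    (fun j y => Complex.exp (-(Complex.I * ((γ j / 2 : ℝ) : ℂ)) * costVal G y))]
  have h : ∀ (ψ : (Fin n → Bool) → ℂ) (j : Fin p),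
      Matrix.mulVec (NormedSpace.exp ((-(Complex.I * ((β j / 2 : ℝ) : ℂ))) • mixerH n))
        (Matrix.mulVec (NormedSpace.exp ((-(Complex.I * ((γ j / 2 : ℝ) : ℂ))) • costH G)) ψ) =
      fun y => ∑ y', (∏ v, mixerAmp (-β j) (y v) (y' v)) *
        (Complex.exp (-(Complex.I * ((γ j / 2 : ℝ) : ℂ)) * costVal G y') * ψ y') := by
    intro ψ j
    funext y
    rw [exp_costH, Matrix.mulVec, dotProduct]
    refine Finset.sum_congr rfl fun y' _ => ?_
    rw [exp_mixerH_apply, Matrix.mulVec_diagonal]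
  simp only [qaoaState, h]
  rfl

/-! ### The energy as a sum over strings at the vertices -/

/-- The strings at the vertices recorded by the two halves of a closed path through `x`. -/
def stringsEquiv (n p : ℕ) : (Fin n → Bits p) ≃
    (Fin n → Bool) × (Fin p → Fin n → Bool) × (Fin p → Fin n → Bool) where
  toFun s := (fun v => bit (s v) p, fun j v => bit (s v) j, fun j v => bit (s v) (2 * p - j))
  invFun a v i := if h : (i : ℕ) < p then a.2.1 ⟨i, h⟩ v else
    if h : 2 * p - i < p then a.2.2 ⟨2 * p - i, h⟩ v else a.1 v
  left_inv s := by
    funext v i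
    have hi := i.2
    simp only
    split_ifs with h1 h2
    · simp [bit, hi]
    · have h3 : 2 * p - (2 * p - (i : ℕ)) = i := by omega
      simp [h3, bit, hi]
    · have h3 : i = (⟨p, by omega⟩ : Fin (2 * p + 1)) := by
        ext
        simp
        omega
      have h4 : p < 2 * p + 1 := by omega
      rw [h3]
      simp [bit, h4]
  right_inv a := by
    obtain ⟨x, z, z'⟩ := a
    refine Prod.ext ?_ (Prod.ext ?_ ?_)
    · funext v
      have h4 : p < 2 * p + 1 := by omega
      have h5 : ¬ 2 * p - p < p := by omega
      simp [bit, h4, h5]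
    · funext j v
      have h4 : (j : ℕ) < 2 * p + 1 := by omega
      simp [bit, h4]
    · funext j v
      have hj := j.2
      have h4 : 2 * p - (j : ℕ) < 2 * p + 1 := by omega
      have h5 : ¬ 2 * p - (j : ℕ) < p := by omega
      have h6 : 2 * p - (2 * p - (j : ℕ)) = j := by omega
      simp [bit, h4, h5, h6]

theorem conj_mixerAmp (b : ℝ) (x y : Bool) :
    (starRingEnd ℂ) (mixerAmp (-b) x y) = mixerAmp b x y := by
  unfold mixerAmp
  split_ifs
  · rw [Complex.conj_ofReal, neg_div, Real.cos_neg]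
  · rw [map_mul, Complex.conj_I, Complex.conj_ofReal, neg_div, Real.sin_neg]
    simp

open Classical in
/-- The product over the edges of the factors `e^{iφ}`. -/
def edgeFactor {n p : ℕ} (γ : Fin p → ℝ) (G : SimpleGraph (Fin n)) (s : Fin n → Bits p) : ℂ :=
  ∏ k : Fin n, ∏ l ∈ Finset.Ioi k, if G.Adj k l then phase γ (bxor (s k) (s l)) else 1

/-- The product over edges and the product over layers are interchanged; in each layer the bra
carries `+γ j / 2` and the ket `-γ j / 2`. -/
theorem edgeFactor_eq {n p : ℕ} (γ : Fin p → ℝ) (G : SimpleGraph (Fin n)) (s : Fin n → Bits p) :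
    edgeFactor γ G s = ∏ j : Fin p,
      (Complex.exp (Complex.I * ((γ j / 2 : ℝ) : ℂ) *
          costVal G (fun v => bit (s v) (2 * p - j))) *
        Complex.exp (-(Complex.I * ((γ j / 2 : ℝ) : ℂ)) * costVal G (fun v => bit (s v) j))) := by
  classical
  simp only [← Complex.exp_add]
  rw [← Complex.exp_sum, edgeFactor]
  have h1 : ∀ k l : Fin n, (if G.Adj k l then phase γ (bxor (s k) (s l)) else 1) =
      Complex.exp (Complex.I * ((if G.Adj k l then phi γ (bxor (s k) (s l)) else 0 : ℝ) : ℂ)) := by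
    intro k l
    split_ifs
    · rfl
    · simp
  simp only [h1, ← Complex.exp_sum]
  congr 1
  simp only [← Finset.mul_sum, ← Complex.ofReal_sum]
  have h2 : ∀ j : Fin p, Complex.I * ((γ j / 2 : ℝ) : ℂ) *
        costVal G (fun v => bit (s v) (2 * p - j)) +
      -(Complex.I * ((γ j / 2 : ℝ) : ℂ)) * costVal G (fun v => bit (s v) j) =
      Complex.I * ((γ j / 2 * (costVal G (fun v => bit (s v) (2 * p - j)) -
        costVal G (fun v => bit (s v) j)) : ℝ) : ℂ) := by
    intro j
    push_cast
    ring
  simp only [h2, ← Finset.mul_sum, ← Complex.ofReal_sum]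
  congr 2
  simp only [costVal, ← Finset.sum_sub_distrib, Finset.mul_sum]
  rw [Finset.sum_comm]
  refine Finset.sum_congr rfl fun k _ => ?_
  rw [Finset.sum_comm]
  refine Finset.sum_congr rfl fun l _ => ?_
  split_ifs
  · rw [phi_bxor]
  · simp

/-- The cost operator is diagonal, so the ket and bra paths share the endpoint `x` and fit together
into one string per vertex. The normalization `2^{-n}` of the initial state becomes the factor 1/2
in each `amp`. -/
theorem energy_eq {n p : ℕ} (G : SimpleGraph (Fin n)) (β γ : Fin p → ℝ) :
    energy G β γ = ∑ s : Fin n → Bits p, (∏ v, amp β (s v)) *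
      (costVal G (fun v => bit (s v) p) * edgeFactor γ G s) := by
  have h1 : energy G β γ = ∑ x, ∑ z : Fin p → Fin n → Bool, ∑ z' : Fin p → Fin n → Bool,
      star (plusAmp n) * plusAmp n * costVal G x *
      ((∏ j : Fin p, Complex.exp (-(Complex.I * ((γ j / 2 : ℝ) : ℂ)) * costVal G (z j)) *
        ∏ v, mixerAmp (-β j) (pathExt z x (j + 1) v) (z j v)) *
      ∏ j : Fin p, Complex.exp (Complex.I * ((γ j / 2 : ℝ) : ℂ) * costVal G (z' j)) *
        ∏ v, mixerAmp (β j) (pathExt z' x (j + 1) v) (z' j v)) := by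
    rw [energy, dotProduct]
    refine Finset.sum_congr rfl fun x _ => ?_
    rw [costH_eq, Matrix.mulVec_diagonal, Pi.star_apply, qaoaState_eq, star_mul', star_sum]
    have h2 : ∀ z' : Fin p → Fin n → Bool, star (∏ j : Fin p,
        Complex.exp (-(Complex.I * ((γ j / 2 : ℝ) : ℂ)) * costVal G (z' j)) *
          ∏ v, mixerAmp (-β j) (pathExt z' x (j + 1) v) (z' j v)) =
        ∏ j : Fin p, Complex.exp (Complex.I * ((γ j / 2 : ℝ) : ℂ) * costVal G (z' j)) *
        ∏ v, mixerAmp (β j) (pathExt z' x (j + 1) v) (z' j v) := by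
      intro z'
      simp only [Complex.star_def, map_prod, map_mul, conj_mixerAmp, ← Complex.exp_conj, map_neg,
        Complex.conj_I, Complex.conj_ofReal, neg_mul, neg_neg]
    simp only [h2]
    rw [Finset.sum_comm]
    simp only [← Finset.mul_sum, ← Finset.sum_mul]
    ring
  have h3 : energy G β γ = ∑ a : (Fin n → Bool) × (Fin p → Fin n → Bool) × (Fin p → Fin n → Bool),
      star (plusAmp n) * plusAmp n * costVal G a.1 *
      ((∏ j : Fin p, Complex.exp (-(Complex.I * ((γ j / 2 : ℝ) : ℂ)) * costVal G (a.2.1 j)) *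
        ∏ v, mixerAmp (-β j) (pathExt a.2.1 a.1 (j + 1) v) (a.2.1 j v)) *
      ∏ j : Fin p, Complex.exp (Complex.I * ((γ j / 2 : ℝ) : ℂ) * costVal G (a.2.2 j)) *
        ∏ v, mixerAmp (β j) (pathExt a.2.2 a.1 (j + 1) v) (a.2.2 j v)) := by
    rw [h1]
    simp only [Fintype.sum_prod_type]
  rw [h3, ← (stringsEquiv n p).sum_comp]
  refine Finset.sum_congr rfl fun s _ => ?_
  have h4 : ∀ j : Fin p, pathExt (fun (j : Fin p) v => bit (s v) j) (fun v => bit (s v) p)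
      ((j : ℕ) + 1) = fun v => bit (s v) (j + 1) := by
    intro j
    unfold pathExt
    split_ifs with h
    · rfl
    · have : (j : ℕ) + 1 = p := by omega
      rw [this]
  have h5 : ∀ j : Fin p, pathExt (fun (j : Fin p) v => bit (s v) (2 * p - j))
      (fun v => bit (s v) p) ((j : ℕ) + 1) = fun v => bit (s v) (2 * p - j - 1) := by
    intro j
    unfold pathExt
    split_ifs with h
    · funext v
      congr 1
    · have : 2 * p - (j : ℕ) - 1 = p := by omega
      rw [this]
  have h6 : ∏ v, amp β (s v) = ((2 : ℂ) ^ n)⁻¹ * ∏ j : Fin p,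
      ((∏ v, mixerAmp (-β j) (bit (s v) (j + 1)) (bit (s v) j)) *
        ∏ v, mixerAmp (β j) (bit (s v) (2 * p - j - 1)) (bit (s v) (2 * p - j))) := by
    simp only [amp, weight_eq, ← Finset.prod_mul_distrib]
    rw [Finset.prod_div_distrib, Finset.prod_comm, div_eq_inv_mul]
    congr 1
    · simp
    · refine Finset.prod_congr rfl fun j _ => Finset.prod_congr rfl fun v _ => ?_
      rw [mixerAmp_comm, mixerAmp_comm (β j)]
  simp only [stringsEquiv, Equiv.coe_fn_mk, h4, h5]
  rw [h6, edgeFactor_eq, plusAmp_mul_star]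
  simp only [Finset.prod_mul_distrib]
  ring

end

end QAOA

/-! ### Averaging over the random graph and the limit of the energy. -/

namespace QAOA

noncomputable section

open MeasureTheory ProbabilityTheory unitInterval

/-! ### Products over unordered pairs -/

/-- The product of `f k l` over the pairs `k < l`. -/
def pairProd {n : ℕ} (f : Fin n → Fin n → ℂ) : ℂ := ∏ k : Fin n, ∏ l ∈ Finset.Ioi k, f k l

theorem pairProd_congr {n : ℕ} {f g : Fin n → Fin n → ℂ} (h : ∀ k l, k < l → f k l = g k l) :
    pairProd f = pairProd g :=
  Finset.prod_congr rfl fun k _ => Finset.prod_congr rfl fun l hl => h k l (by simpa using hl)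

-- Independence of the edges is phrased over unordered pairs, loops included; loops get the neutral
-- factor.
open Classical in
theorem pairProd_eq_prod_sym2 {n : ℕ} (F : Sym2 (Fin n) → ℂ) :
    pairProd (fun k l => F s(k, l)) = ∏ e : Sym2 (Fin n), if e.IsDiag then 1 else F e := by
  have h : ∏ e : Sym2 (Fin n), (if e.IsDiag then 1 else F e) =
      ∏ e : Sym2 (Fin n) with ¬ e.IsDiag, F e := by
    rw [Finset.prod_filter]
    refine Finset.prod_congr rfl fun e _ => ?_
    split_ifs <;> rfl
  rw [h, pairProd, Finset.prod_sigma']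
  refine Finset.prod_bij (fun a _ => s(a.1, a.2)) ?_ ?_ ?_ ?_
  · rintro ⟨k, l⟩ hkl
    have : k < l := by simpa using hkl
    simp [this.ne]
  · rintro ⟨k, l⟩ hkl ⟨k', l'⟩ hkl' he
    have h1 : k < l := by simpa using hkl
    have h2 : k' < l' := by simpa using hkl'
    rcases Sym2.eq_iff.1 he with ⟨h3, h4⟩ | ⟨h3, h4⟩
    · simp only at h3 h4
      subst h3 h4
      rfl
    · simp only at h3 h4
      subst h3 h4
      exact absurd h1 h2.asymm
  · intro e he
    induction e using Sym2.ind with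
    | _ k l =>
      have hne : k ≠ l := by simpa using he
      rcases lt_or_gt_of_ne hne with h1 | h1
      · exact ⟨⟨k, l⟩, by simpa using h1, rfl⟩
      · exact ⟨⟨l, k⟩, by simpa using h1, Sym2.eq_swap⟩
  · intro a _
    rfl

theorem pairProd_perm {n : ℕ} (F : Sym2 (Fin n) → ℂ) (τ : Equiv.Perm (Fin n)) :
    pairProd (fun k l => F s(τ k, τ l)) = pairProd (fun k l => F s(k, l)) := by
  classical
  have h := pairProd_eq_prod_sym2 fun e => F (e.map τ)
  simp only [Sym2.map_mk] at h
  rw [h, pairProd_eq_prod_sym2]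
  refine Fintype.prod_bijective (Sym2.map τ) ⟨Sym2.map.injective τ.injective, fun e => ?_⟩ _ _ ?_
  · refine ⟨e.map τ.symm, ?_⟩
    rw [Sym2.map_map]
    simp
  · intro e
    have : (e.map τ).IsDiag ↔ e.IsDiag := by
      induction e using Sym2.ind with
      | _ k l => simp
    simp only [this]

theorem pairProd_succ {n : ℕ} (f : Fin (n + 1) → Fin (n + 1) → ℂ) :
    pairProd f = (∏ j : Fin n, f 0 j.succ) * pairProd (fun k l => f k.succ l.succ) := by
  simp only [pairProd]
  rw [Fin.prod_univ_succ, Fin.prod_Ioi_zero]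
  simp only [Fin.prod_Ioi_succ]

/-! ### Expectations over the random graph -/

theorem integral_bernoulli_prop (q : I) (a : Prop) (F : Prop → ℂ) :
    ∫ x, F x ∂(toNNReal q • Measure.dirac a + toNNReal (σ q) • Measure.dirac False) =
      ((q : ℝ) : ℂ) * F a + (1 - ((q : ℝ) : ℂ)) * F False := by
  rw [integral_add_measure (Integrable.of_finite) (Integrable.of_finite),
    integral_smul_nnreal_measure, integral_smul_nnreal_measure, integral_dirac, integral_dirac]
  simp [NNReal.smul_def]

theorem integral_binomialRandom {n : ℕ} (q : I) (F : Fin n → Fin n → Prop → ℂ) :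
    ∫ G, pairProd (fun k l => F k l (G.Adj k l)) ∂(SimpleGraph.binomialRandom (Fin n) q) =
      pairProd fun k l => ((q : ℝ) : ℂ) * F k l True + (1 - ((q : ℝ) : ℂ)) * F k l False := by
  classical
  have hF : Measurable fun G : SimpleGraph (Fin n) => pairProd (fun k l => F k l (G.Adj k l)) := by
    unfold pairProd
    refine Finset.measurable_fun_prod _ fun k _ => Finset.measurable_fun_prod _ fun l _ => ?_
    exact measurable_from_top.comp (by fun_prop)
  have hS : Measurable fun S : Set (Sym2 (Fin n)) =>
      pairProd (fun k l => F k l ((SimpleGraph.fromEdgeSet S).Adj k l)) :=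
    hF.comp SimpleGraph.measurable_fromEdgeSet
  rw [SimpleGraph.binomialRandom_eq_map, integral_map
    SimpleGraph.measurable_fromEdgeSet.aemeasurable hF.aestronglyMeasurable, setBernoulli_eq_map,
    integral_map (by fun_prop) hS.aestronglyMeasurable, Measure.infinitePi_eq_pi]
  -- `F` need not be symmetric; `inf` and `sup` recover the pair in increasing order, the only order
  -- that occurs.
  have h1 : ∀ ω : Sym2 (Fin n) → Prop, pairProd (fun k l => F k l
      ((SimpleGraph.fromEdgeSet {e | ω e}).Adj k l)) =
      ∏ e : Sym2 (Fin n), (fun (e : Sym2 (Fin n)) (P : Prop) =>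
        if e.IsDiag then 1 else F e.inf e.sup P) e (ω e) := by
    intro ω
    simp only
    rw [← pairProd_eq_prod_sym2 fun e => F e.inf e.sup (ω e)]
    refine pairProd_congr fun k l hkl => ?_
    simp [hkl.ne, hkl.le]
  simp only [h1]
  refine (integral_fintype_prod_eq_prod (𝕜 := ℂ) (fun (e : Sym2 (Fin n)) (P : Prop) =>
    if e.IsDiag then 1 else F e.inf e.sup P)).trans ?_
  have h2 : ∀ e : Sym2 (Fin n), ∫ P, (if e.IsDiag then 1 else F e.inf e.sup P)
      ∂(toNNReal q • Measure.dirac (e ∈ Sym2.diagSetᶜ) + toNNReal (σ q) • Measure.dirac False) =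
      if e.IsDiag then 1 else
        ((q : ℝ) : ℂ) * F e.inf e.sup True + (1 - ((q : ℝ) : ℂ)) * F e.inf e.sup False := by
    intro e
    rw [integral_bernoulli_prop]
    split_ifs with he
    · ring
    · have : (e ∈ (Sym2.diagSetᶜ : Set (Sym2 (Fin n)))) = True := by simpa using he
      rw [this]
  simp only [h2]
  rw [← pairProd_eq_prod_sym2 fun e =>
    ((q : ℝ) : ℂ) * F e.inf e.sup True + (1 - ((q : ℝ) : ℂ)) * F e.inf e.sup False]
  refine pairProd_congr fun k l hkl => ?_
  simp [hkl.le]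

/-- With measurable singletons, every function on the finite space of graphs is integrable. -/
instance measurableSingletonClass_simpleGraph (n : ℕ) :
    MeasurableSingletonClass (SimpleGraph (Fin n)) where
  measurableSet_singleton G := by
    have h : ({G} : Set (SimpleGraph (Fin n))) = SimpleGraph.edgeSet ⁻¹' {G.edgeSet} := by
      ext G'
      simp
    rw [h]
    exact SimpleGraph.measurableEmbedding_edgeSet.measurable (measurableSet_singleton _)

open Classical in
/-- The mean edge factors when the edge `e₀` is required to be present. -/
def pinnedKern {n p : ℕ} (γ : Fin p → ℝ) (q : ℝ) (s : Fin n → Bits p) (e₀ : Sym2 (Fin n))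
    (k l : Fin n) : ℂ :=
  if s(k, l) = e₀ then q * phase γ (bxor (s k) (s l)) else kern γ q (s k) (s l)

-- The indicator of the pinned edge is absorbed into the factor of its own pair, which becomes 0
-- when the edge is absent; the product form is then averaged factor by factor.
open Classical in
theorem integral_adj_mul_edgeFactor {n p : ℕ} (γ : Fin p → ℝ) (q : I) (s : Fin n → Bits p)
    {k₀ l₀ : Fin n} (h : k₀ < l₀) :
    ∫ G : SimpleGraph (Fin n), (if G.Adj k₀ l₀ then 1 else 0) * edgeFactor γ G s
      ∂(SimpleGraph.binomialRandom (Fin n) q) = pairProd (pinnedKern γ q s s(k₀, l₀)) := by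
  have h1 : ∀ G : SimpleGraph (Fin n), (if G.Adj k₀ l₀ then 1 else 0) * edgeFactor γ G s =
      pairProd (fun k l => (fun (k l : Fin n) (P : Prop) => if s(k, l) = s(k₀, l₀) then
        (if P then phase γ (bxor (s k) (s l)) else 0) else
        (if P then phase γ (bxor (s k) (s l)) else 1)) k l (G.Adj k l)) := by
    intro G
    split_ifs with hG
    · rw [one_mul]
      refine pairProd_congr fun k l _ => ?_
      by_cases h2 : s(k, l) = s(k₀, l₀)
      · have h3 : G.Adj k l := by
          rcases Sym2.eq_iff.1 h2 with ⟨rfl, rfl⟩ | ⟨rfl, rfl⟩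
          · exact hG
          · exact hG.symm
        simp [h3]
      · simp [h2]
    · rw [zero_mul, pairProd, Finset.prod_eq_zero (Finset.mem_univ k₀)]
      rw [Finset.prod_eq_zero (Finset.mem_Ioi.2 h)]
      simp [hG]
  simp only [h1]
  rw [integral_binomialRandom q (fun (k l : Fin n) (P : Prop) => if s(k, l) = s(k₀, l₀) then
        (if P then phase γ (bxor (s k) (s l)) else 0) else
        (if P then phase γ (bxor (s k) (s l)) else 1))]
  refine pairProd_congr fun k l _ => ?_
  unfold pinnedKern kern
  simp only [if_true, if_false]
  split_ifs <;> ring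

/-- The contribution of the pair `e₀ = {k₀, l₀}` to the expected energy. -/
def pairTerm {n p : ℕ} (β γ : Fin p → ℝ) (q : ℝ) (k₀ l₀ : Fin n) : ℂ :=
  ∑ s : Fin n → Bits p, (∏ v, amp β (s v)) *
    (((spin (bit (s k₀) p) * spin (bit (s l₀) p) : ℝ) : ℂ) *
      pairProd (pinnedKern γ q s s(k₀, l₀)))

theorem integral_energy {n p : ℕ} (β γ : Fin p → ℝ) (q : I) :
    ∫ G, energy G β γ ∂(SimpleGraph.binomialRandom (Fin n) q) =
      ∑ k : Fin n, ∑ l ∈ Finset.Ioi k, pairTerm β γ q k l := by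
  classical
  have h1 : ∀ G : SimpleGraph (Fin n), energy G β γ = ∑ s : Fin n → Bits p,
      ∑ k : Fin n, ∑ l ∈ Finset.Ioi k, (∏ v, amp β (s v)) *
        ((spin (bit (s k) p) * spin (bit (s l) p) : ℝ) : ℂ) *
          ((if G.Adj k l then 1 else 0) * edgeFactor γ G s) := by
    intro G
    rw [energy_eq]
    refine Finset.sum_congr rfl fun s _ => ?_
    rw [costVal, Complex.ofReal_sum, Finset.sum_mul, Finset.mul_sum]
    refine Finset.sum_congr rfl fun k _ => ?_
    rw [Complex.ofReal_sum, Finset.sum_mul, Finset.mul_sum]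
    refine Finset.sum_congr rfl fun l _ => ?_
    split_ifs <;> simp
    ring
  simp only [h1]
  rw [integral_finsetSum _ fun _ _ => Integrable.of_finite]
  simp only [pairTerm]
  have h2 : ∀ s : Fin n → Bits p, ∫ G : SimpleGraph (Fin n), (∑ k : Fin n, ∑ l ∈ Finset.Ioi k,
      (∏ v, amp β (s v)) * ((spin (bit (s k) p) * spin (bit (s l) p) : ℝ) : ℂ) *
          ((if G.Adj k l then 1 else 0) * edgeFactor γ G s))
          ∂(SimpleGraph.binomialRandom (Fin n) q) =
      ∑ k : Fin n, ∑ l ∈ Finset.Ioi k, (∏ v, amp β (s v)) *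
        (((spin (bit (s k) p) * spin (bit (s l) p) : ℝ) : ℂ) *
          pairProd (pinnedKern γ q s s(k, l))) := by
    intro s
    rw [integral_finsetSum _ fun _ _ => Integrable.of_finite]
    refine Finset.sum_congr rfl fun k _ => ?_
    rw [integral_finsetSum _ fun _ _ => Integrable.of_finite]
    refine Finset.sum_congr rfl fun l hl => ?_
    rw [integral_const_mul, integral_adj_mul_edgeFactor γ q s (by simpa using hl)]
    ring
  simp only [h2]
  rw [Finset.sum_comm]
  refine Finset.sum_congr rfl fun k _ => ?_
  rw [Finset.sum_comm]

/-- Exchangeability: relabelling the vertices permutes the unordered pairs, and all factors are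
symmetric. -/
theorem pairTerm_perm {n p : ℕ} (β γ : Fin p → ℝ) (q : ℝ) (k l : Fin n)
    (τ : Equiv.Perm (Fin n)) : pairTerm β γ q (τ k) (τ l) = pairTerm β γ q k l := by
  classical
  unfold pairTerm
  refine Fintype.sum_equiv (Equiv.arrowCongr τ.symm (Equiv.refl _)) _ _ fun s => ?_
  have e : ∀ v, (Equiv.arrowCongr τ.symm (Equiv.refl (Bits p))) s v = s (τ v) := fun v => rfl
  simp only [e]
  rw [Equiv.prod_comp τ fun v => amp β (s v)]
  congr 2
  have hsym : ∀ a b : Fin n, pinnedKern γ q s s(τ k, τ l) a b =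
      pinnedKern γ q s s(τ k, τ l) b a := by
    intro a b
    unfold pinnedKern
    rw [Sym2.eq_swap, bxor_comm, kern_comm]
  have h := pairProd_perm (Sym2.lift ⟨pinnedKern γ q s s(τ k, τ l), hsym⟩) τ
  simp only [Sym2.lift_mk] at h
  rw [← h]
  refine pairProd_congr fun a b _ => ?_
  unfold pinnedKern
  have : s(τ a, τ b) = s(τ k, τ l) ↔ s(a, b) = s(k, l) := by
    rw [← Sym2.map_mk, ← Sym2.map_mk]
    exact (Sym2.map.injective τ.injective).eq_iff
  simp only [this, e]

theorem exists_perm_pair {n : ℕ} {k l : Fin (n + 2)} (h : k ≠ l) :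
    ∃ τ : Equiv.Perm (Fin (n + 2)), τ 0 = k ∧ τ 1 = l := by
  have h01 : (0 : Fin (n + 2)) ≠ 1 := by simp
  have ha : Equiv.swap 0 k l ≠ 0 := by
    intro he
    have := congrArg (Equiv.swap 0 k) he
    rw [Equiv.swap_apply_left, Equiv.swap_apply_self] at this
    exact h this.symm
  refine ⟨Equiv.swap 0 k * Equiv.swap 1 (Equiv.swap 0 k l), ?_, ?_⟩
  · rw [Equiv.Perm.mul_apply, Equiv.swap_apply_of_ne_of_ne h01 ha.symm, Equiv.swap_apply_left]
  · rw [Equiv.Perm.mul_apply, Equiv.swap_apply_left, Equiv.swap_apply_self]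

theorem Zsum_zero_eq {p : ℕ} (β γ : Fin p → ℝ) (q : ℝ) (m : ℕ) (f : Bits p → ℂ) :
    Zsum β γ q 0 m f = ∑ s : Fin m → Bits p, (∏ v, amp β (s v) * f (s v)) *
      pairProd fun k l => kern γ q (s k) (s l) := by
  induction m generalizing f with
  | zero => simp [Zsum, pairProd]
  | succ m ih =>
    rw [Zsum, ← (Fin.consEquiv fun _ : Fin (m + 1) => Bits p).sum_comp, Fintype.sum_prod_type]
    refine Finset.sum_congr (by simp) fun u _ => ?_
    rw [ih, Finset.mul_sum]
    refine Finset.sum_congr rfl fun s _ => ?_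
    simp only [Fin.consEquiv, Equiv.coe_fn_mk]
    rw [pairProd_succ, Fin.prod_univ_succ]
    simp only [Fin.cons_zero, Fin.cons_succ, ← mul_assoc, Finset.prod_mul_distrib]

/-- The strings at the vertices 0 and 1 are summed last. Their kernels with every other vertex
become the external field, and the pinned pair supplies `q` times a phase. -/
theorem pairTerm_zero_one {m p : ℕ} (β γ : Fin p → ℝ) (q : ℝ) :
    pairTerm β γ q (0 : Fin (m + 2)) 1 = q * ∑ u : Bits p, ∑ v : Bits p,
      amp β u * amp β v * ((spin (bit u p) * spin (bit v p) : ℝ) : ℂ) * phase γ (bxor u v) *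
        Zsum β γ q 0 m (fun t => kern γ q u t * kern γ q v t) := by
  classical
  unfold pairTerm
  rw [← (Fin.consEquiv fun _ : Fin (m + 2) => Bits p).sum_comp, Fintype.sum_prod_type,
    Finset.mul_sum]
  refine Finset.sum_congr rfl fun u _ => ?_
  rw [← (Fin.consEquiv fun _ : Fin (m + 1) => Bits p).sum_comp, Fintype.sum_prod_type,
    Finset.mul_sum]
  refine Finset.sum_congr rfl fun v _ => ?_
  rw [Zsum_zero_eq, Finset.mul_sum, Finset.mul_sum]
  refine Finset.sum_congr rfl fun s _ => ?_
  simp only [Fin.consEquiv, Equiv.coe_fn_mk]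
  rw [pairProd_succ, pairProd_succ, Fin.prod_univ_succ, Fin.prod_univ_succ,
    Fin.prod_univ_succ (n := m)]
  have e1 : (Fin.succ (0 : Fin (m + 1))) = 1 := rfl
  have e2 : (1 : Fin (m + 2)) = Fin.succ 0 := rfl
  have n1 : ∀ j : Fin m, ¬ s((0 : Fin (m + 2)), j.succ.succ) = s(0, 1) := by
    intro j hj
    rcases Sym2.eq_iff.1 hj with ⟨-, h⟩ | ⟨h, -⟩ <;> simp [Fin.ext_iff] at h
  have n2 : ∀ j : Fin m, ¬ s((1 : Fin (m + 2)), j.succ.succ) = s(0, 1) := by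
    intro j hj
    rcases Sym2.eq_iff.1 hj with ⟨h, -⟩ | ⟨-, h⟩ <;> simp [Fin.ext_iff] at h
  have n3 : ∀ i j : Fin m, ¬ s((i.succ.succ : Fin (m + 2)), j.succ.succ) = s(0, 1) := by
    intro i j hj
    rcases Sym2.eq_iff.1 hj with ⟨h, -⟩ | ⟨-, h⟩ <;> simp [Fin.ext_iff] at h
  simp only [pinnedKern, e1, n1, n2, n3, if_true, if_false]
  simp only [e2, Fin.cons_zero, Fin.cons_succ, Finset.prod_mul_distrib]
  ring

theorem sum_card_Ioi (n : ℕ) : 2 * ∑ k : Fin n, ((Finset.Ioi k).card : ℂ) = n * (n - 1) := by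
  have h1 : ∑ k : Fin n, (Finset.Ioi k).card = ∑ i ∈ Finset.range n, i := by
    simp only [Fin.card_Ioi]
    rw [Fin.sum_univ_eq_sum_range (fun k => n - 1 - k), Finset.sum_range_reflect (fun i => i)]
  have h2 := Finset.sum_range_id_mul_two n
  rw [← h1] at h2
  rcases n with _ | n
  · simp
  · have h3 : ((∑ k : Fin (n + 1), (Finset.Ioi k).card : ℕ) : ℂ) * 2 =
        (((n + 1) * (n + 1 - 1) : ℕ) : ℂ) := by exact_mod_cast h2
    push_cast at h3 ⊢
    rw [mul_comm, h3]
    simp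

theorem expectedEnergy_add_two {p : ℕ} (d : ℝ) (β γ : Fin p → ℝ) (m : ℕ) :
    2 * expectedEnergy d β γ (m + 2) = (m + 2) * (m + 1) * ((edgeProb d (m + 2) : ℝ) : ℂ) *
      ∑ u : Bits p, ∑ v : Bits p,
        amp β u * amp β v * ((spin (bit u p) * spin (bit v p) : ℝ) : ℂ) * phase γ (bxor u v) *
        Zsum β γ (edgeProb d (m + 2)) 0 m
          (fun t => kern γ (edgeProb d (m + 2)) u t * kern γ (edgeProb d (m + 2)) v t) := by
  rw [expectedEnergy, integral_energy]
  have h1 : ∀ k : Fin (m + 2), ∑ l ∈ Finset.Ioi k, pairTerm β γ (edgeProb d (m + 2)) k l =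
      (Finset.Ioi k).card * pairTerm β γ (edgeProb d (m + 2)) (0 : Fin (m + 2)) 1 := by
    intro k
    rw [← nsmul_eq_mul, ← Finset.sum_const]
    refine Finset.sum_congr rfl fun l hl => ?_
    have hkl : k < l := by simpa using hl
    obtain ⟨τ, rfl, rfl⟩ := exists_perm_pair hkl.ne
    exact pairTerm_perm β γ _ 0 1 τ
  simp only [h1]
  rw [← Finset.sum_mul, ← mul_assoc, sum_card_Ioi, pairTerm_zero_one]
  push_cast
  ring

/-! ### The limit of the expected energy -/

open Filter Topology

theorem sparse_edgeProb {d : ℝ} (hd : 0 ≤ d) : Sparse d (fun n => (edgeProb d n : ℝ)) where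
  nonneg n := (edgeProb d n).2.1
  le_one n := (edgeProb d n).2.2
  tendsto := by
    have h1 : Tendsto (fun n : ℕ => (n : ℝ) / ((n : ℝ) + (-1 : ℝ)) * d) atTop (𝓝 (1 * d)) :=
      (tendsto_natCast_div_add_atTop (-1 : ℝ)).mul_const d
    rw [one_mul] at h1
    refine h1.congr' ?_
    filter_upwards [eventually_ge_atTop (⌈d⌉₊ + 2)] with n hn
    have hn' : d + 2 ≤ n := by
      have : ((⌈d⌉₊ + 2 : ℕ) : ℝ) ≤ n := by exact_mod_cast hn
      push_cast at this
      linarith [Nat.le_ceil d]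
    have h2 : d / ((n : ℝ) - 1) ∈ Set.Icc (0 : ℝ) 1 :=
      ⟨div_nonneg hd (by linarith), (div_le_one (by linarith)).2 (by linarith)⟩
    rw [edgeProb, Set.projIcc_of_mem _ h2]
    simp only
    ring

theorem edgeProb_eq {d : ℝ} (hd : 0 ≤ d) {m : ℕ} (hm : d ≤ m + 1) :
    (edgeProb d (m + 2) : ℝ) = d / (m + 1) := by
  have e : ((m + 2 : ℕ) : ℝ) - 1 = m + 1 := by push_cast; ring
  have h2 : d / (((m + 2 : ℕ) : ℝ) - 1) ∈ Set.Icc (0 : ℝ) 1 := by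
    rw [e]
    exact ⟨div_nonneg hd (by positivity), (div_le_one (by positivity)).2 hm⟩
  rw [edgeProb, Set.projIcc_of_mem _ h2]
  simp only [e]

/-- As soon as `n - 1 ≥ d` the edge probability is not clamped, and the quotient is exactly the
finite double sum; only the partition sums inside it still need a limit. -/
theorem tendsto_expectedEnergy {p : ℕ} {d : ℝ} (hd : 0 < d) (β γ : Fin p → ℝ) :
    Tendsto (fun n : ℕ => expectedEnergy d β γ n / ((n : ℂ) * (d : ℂ) / 2)) atTop
      (𝓝 (∑ u : Bits p, ∑ v : Bits p, ((spin (bit u p) * spin (bit v p) : ℝ) : ℂ) *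
        phase γ (bxor u v) * Spair d β γ u v)) := by
  have hm : Tendsto (fun n : ℕ => ((n - 2 : ℕ) : ℝ) / n) atTop (𝓝 1) := by
    refine tendsto_sub_const_div (m := fun n => n) ?_ 2
    refine tendsto_const_nhds.congr' ?_
    filter_upwards [eventually_ne_atTop 0] with n hn
    rw [div_self (by exact_mod_cast hn)]
  have h1 : Tendsto (fun n : ℕ => ∑ u : Bits p, ∑ v : Bits p,
      amp β u * amp β v * ((spin (bit u p) * spin (bit v p) : ℝ) : ℂ) * phase γ (bxor u v) *
        Zsum β γ (edgeProb d n) 0 (n - 2)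
          (fun t => kern γ (edgeProb d n) u t * kern γ (edgeProb d n) v t)) atTop
      (𝓝 (∑ u : Bits p, ∑ v : Bits p,
        amp β u * amp β v * ((spin (bit u p) * spin (bit v p) : ℝ) : ℂ) * phase γ (bxor u v) *
          (R d β γ u * R d β γ v))) :=
    tendsto_finsetSum _ fun u _ => tendsto_finsetSum _ fun v _ =>
      (tendsto_Zsum_pair d β γ (sparse_edgeProb hd.le) hm u v).const_mul _
  have h2 : ∑ u : Bits p, ∑ v : Bits p, ((spin (bit u p) * spin (bit v p) : ℝ) : ℂ) *
        phase γ (bxor u v) * Spair d β γ u v = ∑ u : Bits p, ∑ v : Bits p,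
        amp β u * amp β v * ((spin (bit u p) * spin (bit v p) : ℝ) : ℂ) * phase γ (bxor u v) *
          (R d β γ u * R d β γ v) := by
    refine Finset.sum_congr rfl fun u _ => Finset.sum_congr rfl fun v _ => ?_
    rw [Spair, amp, amp, weight, weight]
    ring
  rw [h2]
  refine h1.congr' ?_
  filter_upwards [eventually_ge_atTop (⌈d⌉₊ + 2)] with n hn
  obtain ⟨m, rfl⟩ : ∃ m, n = m + 2 := ⟨n - 2, by omega⟩
  have hdm : d ≤ m + 1 := by
    have : (⌈d⌉₊ : ℝ) ≤ m := by exact_mod_cast (by omega : ⌈d⌉₊ ≤ m)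
    linarith [Nat.le_ceil d]
  have h3 := expectedEnergy_add_two d β γ m
  rw [Nat.add_sub_cancel]
  have hd' : (d : ℂ) ≠ 0 := by exact_mod_cast hd.ne'
  have hm1 : (m : ℂ) + 1 ≠ 0 := by exact_mod_cast Nat.succ_ne_zero m
  have hm2 : (m : ℂ) + 2 ≠ 0 := by exact_mod_cast Nat.succ_ne_zero (m + 1)
  set S := ∑ u : Bits p, ∑ v : Bits p,
      amp β u * amp β v * ((spin (bit u p) * spin (bit v p) : ℝ) : ℂ) * phase γ (bxor u v) *
        Zsum β γ (edgeProb d (m + 2)) 0 m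
          (fun t => kern γ (edgeProb d (m + 2)) u t * kern γ (edgeProb d (m + 2)) v t) with hS
  rw [edgeProb_eq hd.le hdm] at h3
  push_cast at h3 ⊢
  rw [eq_div_iff (by simp [hd', hm2])]
  field_simp at h3 ⊢
  linear_combination -h3

/-- The summand is symmetric, so every strict order selects half of the off-diagonal terms; on the
diagonal the phase is 1 and the signs square to 1. -/
theorem sum_pairs_eq {p : ℕ} (d : ℝ) (β γ : Fin p → ℝ) (lt : Bits p → Bits p → Prop)
    [IsStrictTotalOrder (Bits p) lt] [DecidableRel lt] :
    ∑ u : Bits p, ∑ v : Bits p, ((spin (bit u p) * spin (bit v p) : ℝ) : ℂ) *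
        phase γ (bxor u v) * Spair d β γ u v =
      ∑ u : Bits p, Sdiag d β γ u + 2 * ∑ u : Bits p, ∑ v : Bits p,
        if lt u v then ((spin (bit u p) * spin (bit v p) : ℝ) : ℂ) *
          phase γ (bxor u v) * Spair d β γ u v else 0 := by
  set T : Bits p → Bits p → ℂ := fun u v => ((spin (bit u p) * spin (bit v p) : ℝ) : ℂ) *
    phase γ (bxor u v) * Spair d β γ u v with hT
  have hsymm : ∀ u v, T u v = T v u := by
    intro u v
    simp only [hT, Spair]
    rw [bxor_comm, mul_comm (spin (bit u p))]
    ring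
  have hdiag : ∀ u, T u u = Sdiag d β γ u := by
    intro u
    simp only [hT, Spair, Sdiag]
    rw [spin_mul_self, phase_bxor_self]
    have h1 : parity u * parity u = 1 := by
      rw [parity]
      split_ifs <;> norm_num
    push_cast
    linear_combination (B β u ^ 2 * R d β γ u ^ 2 / 4) * h1
  have hsplit : ∀ u v, T u v = (if u = v then T u v else 0) + (if lt u v then T u v else 0) +
      (if lt v u then T v u else 0) := by
    intro u v
    rcases trichotomous_of lt u v with h | h | h
    · have h1 : u ≠ v := fun he => irrefl_of lt v (he ▸ h)
      have h2 : ¬ lt v u := asymm_of lt h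
      simp [h, h1, h2]
    · subst h
      simp [irrefl_of lt u]
    · have h1 : u ≠ v := fun he => irrefl_of lt v (he ▸ h)
      have h2 : ¬ lt u v := asymm_of lt h
      simp [h, h1, h2, hsymm u v]
  have h1 : ∑ u, ∑ v, T u v = ∑ u, ∑ v, ((if u = v then T u v else 0) +
      (if lt u v then T u v else 0) + (if lt v u then T v u else 0)) :=
    Finset.sum_congr rfl fun u _ => Finset.sum_congr rfl fun v _ => hsplit u v
  rw [h1]
  simp only [Finset.sum_add_distrib]
  rw [Finset.sum_comm (f := fun u v => if lt v u then T v u else 0)]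
  simp only [Finset.sum_ite_eq, Finset.mem_univ, if_true, hdiag]
  ring

end

end QAOA

/-! ### A time-bounded program logic, and the coding of strings as words. -/

namespace QAOA

/-! ### Reasoning about programs -/

/-- From `σ`, the program halts within `T` time units in a state satisfying `Q`. -/
def Runs (w : ℕ) (P : Prog) (σ : State) (T : ℕ) (Q : State → Prop) : Prop :=
  ∃ τ t, Exec w P σ τ t ∧ t ≤ T ∧ Q τ

theorem Runs.mono {w : ℕ} {P : Prog} {σ : State} {T T' : ℕ} {Q Q' : State → Prop}
    (h : Runs w P σ T Q) (hT : T ≤ T') (hQ : ∀ τ, Q τ → Q' τ) : Runs w P σ T' Q' := by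
  obtain ⟨τ, t, h1, h2, h3⟩ := h
  exact ⟨τ, t, h1, h2.trans hT, hQ τ h3⟩

theorem Runs.skip {w : ℕ} {σ : State} {Q : State → Prop} (h : Q σ) : Runs w .skip σ 0 Q :=
  ⟨σ, 0, .skip σ, le_rfl, h⟩

theorem Runs.seq {w : ℕ} {P P' : Prog} {σ : State} {T T' : ℕ} {Q Q' : State → Prop}
    (h : Runs w P σ T Q) (h' : ∀ τ, Q τ → Runs w P' τ T' Q') :
    Runs w (.seq P P') σ (T + T') Q' := by
  obtain ⟨τ, t, h1, h2, h3⟩ := h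
  obtain ⟨ρ, t', h4, h5, h6⟩ := h' τ h3
  exact ⟨ρ, t + t', .seq h1 h4, Nat.add_le_add h2 h5, h6⟩

theorem Runs.branch {w : ℕ} {b : Test} {P P' : Prog} {σ : State} {T : ℕ} {Q : State → Prop}
    (h : b.Holds σ → Runs w P σ T Q) (h' : ¬ b.Holds σ → Runs w P' σ T Q) :
    Runs w (.branch b P P') σ (T + 1) Q := by
  by_cases hb : b.Holds σ
  · obtain ⟨τ, t, h1, h2, h3⟩ := h hb
    exact ⟨τ, t + 1, .branchTrue hb h1, Nat.succ_le_succ h2, h3⟩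
  · obtain ⟨τ, t, h1, h2, h3⟩ := h' hb
    exact ⟨τ, t + 1, .branchFalse hb h1, Nat.succ_le_succ h2, h3⟩

/-- The cost may depend on the iteration; the amortized count needs this, as most visits to a string
are cheap. -/
theorem Runs.loop {w : ℕ} {b : Test} {P : Prog} (Inv : ℕ → State → Prop) (c : ℕ → ℕ) (n : ℕ)
    (hstep : ∀ i < n, ∀ σ, Inv i σ → b.Holds σ ∧ Runs w P σ (c i) (Inv (i + 1)))
    (hend : ∀ σ, Inv n σ → ¬ b.Holds σ) {σ : State} (h0 : Inv 0 σ) :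
    Runs w (.loop b P) σ (∑ i ∈ Finset.range n, (c i + 1) + 1) (Inv n) := by
  have key : ∀ k i, i + k = n → ∀ σ, Inv i σ →
      Runs w (.loop b P) σ (∑ j ∈ Finset.range k, (c (i + j) + 1) + 1) (Inv n) := by
    intro k
    induction k with
    | zero =>
      intro i hi σ hσ
      obtain rfl : i = n := by omega
      exact ⟨σ, 1, .loopFalse (hend σ hσ), by simp, hσ⟩
    | succ k ih =>
      intro i hi σ hσ
      obtain ⟨hb, τ, t, h1, h2, h3⟩ := hstep i (by omega) σ hσ
      obtain ⟨ρ, t', h4, h5, h6⟩ := ih (i + 1) (by omega) τ h3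
      refine ⟨ρ, t + t' + 1, .loopTrue hb h1 h4, ?_, h6⟩
      rw [Finset.sum_range_succ']
      have e : ∑ j ∈ Finset.range k, (c (i + 1 + j) + 1) =
          ∑ j ∈ Finset.range k, (c (i + (j + 1)) + 1) :=
        Finset.sum_congr rfl fun j _ => by rw [show i + 1 + j = i + (j + 1) by ring]
      rw [e] at h5
      simp only [add_zero]
      omega
  simpa using key n 0 (by simp) σ h0

/-- Straight-line programs. -/
def block : List Instr → Prog
  | [] => .skip
  | i :: is => .seq (.instr i) (block is)

/-- The effect of a straight-line program. -/
noncomputable def runBlock : List Instr → State → State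
  | [], σ => σ
  | i :: is, σ => runBlock is (i.step σ)

/-- All word registers hold words. -/
def Bdd (w : ℕ) (σ : State) : Prop := ∀ r, σ.reg r < 2 ^ w

/-- The instruction does not produce a word overflow. -/
def Instr.Safe (w : ℕ) : Instr → State → Prop
  | .wconst _ k, _ => k < 2 ^ w
  | .wop o _ a b, σ => o.eval (σ.reg a) (σ.reg b) < 2 ^ w
  | .wload _ a, σ => σ.mem (σ.reg a) < 2 ^ w
  | _, _ => True

/-- No instruction of a straight-line program produces a word overflow. -/
def SafeBlock (w : ℕ) : List Instr → State → Prop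
  | [], _ => True
  | i :: is, σ => i.Safe w σ ∧ SafeBlock w is (i.step σ)

theorem Bdd.step {w : ℕ} {i : Instr} {σ : State} (h : Bdd w σ) (hi : i.Safe w σ) :
    Bdd w (i.step σ) := by
  intro r
  cases i with
  | wconst r' k =>
    simp only [Instr.step, Function.update_apply]
    split_ifs
    · exact hi
    · exact h r
  | wop o r' a b =>
    simp only [Instr.step, Function.update_apply]
    split_ifs
    · exact hi
    · exact h r
  | wload r' a =>
    simp only [Instr.step, Function.update_apply]
    split_ifs
    · exact hi
    · exact h r
  | _ => exact h r

theorem Runs.block {w : ℕ} {is : List Instr} {σ : State} {Q : State → Prop} (hb : Bdd w σ)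
    (hs : SafeBlock w is σ) (hQ : Bdd w (runBlock is σ) → Q (runBlock is σ)) :
    Runs w (block is) σ is.length Q := by
  induction is generalizing σ with
  | nil => exact Runs.skip (hQ hb)
  | cons i is ih =>
    have h1 := hb.step hs.1
    rw [List.length_cons, Nat.add_comm]
    refine Runs.seq (Q := fun τ => τ = i.step σ) ⟨_, 1, .instr i σ h1, le_rfl, rfl⟩ ?_
    rintro τ rfl
    exact ih h1 hs.2 hQ

/-! ### Bitstrings as words -/

/-- The bitstring with code `k`. -/
def decode (p k : ℕ) : Bits p := fun j => k.testBit j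

theorem bit_decode {p k j : ℕ} (hj : j ≤ 2 * p) : bit (decode p k) j = k.testBit j := by
  have : j < 2 * p + 1 := by omega
  simp [bit, decode, this]

theorem sum_ite_two_pow_eq_ofBits {n : ℕ} (f : Fin n → Bool) :
    ∑ j, (if f j then 2 ^ (j : ℕ) else 0) = Nat.ofBits f := by
  induction n with
  | zero => simp [Nat.ofBits_zero]
  | succ n ih =>
    rw [Fin.sum_univ_succ, Nat.ofBits_succ, ← ih, Finset.mul_sum, add_comm]
    congr 1
    · refine Finset.sum_congr rfl fun j _ => ?_
      simp only [Function.comp_apply, Fin.val_succ, pow_succ']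
      split_ifs <;> simp
    · cases f 0 <;> simp

theorem code_lt {p : ℕ} (s : Bits p) : code s < 2 ^ (2 * p + 1) := by
  rw [code, sum_ite_two_pow_eq_ofBits]
  exact Nat.ofBits_lt_two_pow s

theorem decode_code {p : ℕ} (s : Bits p) : decode p (code s) = s := by
  funext j
  rw [decode, code, sum_ite_two_pow_eq_ofBits, Nat.testBit_ofBits_lt _ _ j.2]

theorem code_decode {p k : ℕ} (hk : k < 2 ^ (2 * p + 1)) : code (decode p k) = k := by
  refine Nat.eq_of_testBit_eq fun j => ?_
  by_cases hj : j < 2 * p + 1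
  · have := congrFun (decode_code (decode p k)) ⟨j, hj⟩
    exact this
  · have h2 : 2 ^ (2 * p + 1) ≤ 2 ^ j := Nat.pow_le_pow_right (by norm_num) (by omega)
    rw [Nat.testBit_lt_two_pow ((code_lt _).trans_le h2), Nat.testBit_lt_two_pow (hk.trans_le h2)]

theorem sum_bits_eq_sum_range {p : ℕ} (F : Bits p → ℂ) :
    ∑ t, F t = ∑ k ∈ Finset.range (2 ^ (2 * p + 1)), F (decode p k) := by
  refine Finset.sum_nbij' code (decode p) ?_ ?_ ?_ ?_ ?_
  · intro s _
    simpa using code_lt s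
  · intro k _
    simp
  · intro s _
    exact decode_code s
  · intro k hk
    exact code_decode (by simpa using hk)
  · intro s _
    rw [decode_code]

theorem decode_xor (p a b : ℕ) : decode p (a ^^^ b) = bxor (decode p a) (decode p b) := by
  funext j
  simp [decode, bxor, Nat.testBit_xor]

theorem shiftRight_and_one (k j : ℕ) : (k >>> j) &&& 1 = (k.testBit j).toNat := by
  rw [Nat.and_one_is_mod, Nat.toNat_testBit, Nat.shiftRight_eq_div_pow]

/-! ### The level computed from the outside -/

/-- The level computed from the first `J` mirror image pairs of bits. -/
def levelAux {p : ℕ} (s : Bits p) : ℕ → ℕ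
  | 0 => p
  | J + 1 => if bit s J = bit s (2 * p - J) then levelAux s J else p - 1 - J

/-- Scanning inwards, a later mismatch is nearer the centre and overrides earlier ones, so the
innermost mismatch decides. -/
theorem le_levelAux_iff {p : ℕ} (s : Bits p) {J : ℕ} (hJ : J ≤ p) {l : ℕ} (hl : l ≤ p) :
    l ≤ levelAux s J ↔ ∀ j < J, p - l ≤ j → bit s j = bit s (2 * p - j) := by
  induction J with
  | zero => simp [levelAux, hl]
  | succ J ih =>
    rw [levelAux]
    split_ifs with h
    · rw [ih (by omega)]
      constructor
      · intro h1 j hj hlj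
        rcases Nat.lt_succ_iff_lt_or_eq.1 hj with h2 | rfl
        · exact h1 j h2 hlj
        · exact h
      · intro h1 j hj
        exact h1 j (by omega)
    · constructor
      · intro h1 j hj hlj
        omega
      · intro h1
        by_contra h2
        exact h (h1 J (by omega) (by omega))

theorem levelAux_eq_level {p : ℕ} (s : Bits p) : levelAux s p = level s := by
  have hle : levelAux s p ≤ p := by
    have : ∀ J, levelAux s J ≤ p := by
      intro J
      induction J with
      | zero => exact le_rfl
      | succ J ih =>
        rw [levelAux]
        split_ifs
        · exact ih
        · omega
    exact this p
  have key : ∀ l ≤ p, l ≤ levelAux s p ↔ l ≤ level s := by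
    intro l hl
    rw [le_levelAux_iff s le_rfl hl, le_level_iff hl]
    constructor
    · intro h k hk
      rcases Nat.eq_zero_or_pos k with rfl | hk0
      · rfl
      · have := h (p - k) (by omega) (by omega)
        rw [show 2 * p - (p - k) = p + k by omega] at this
        exact this.symm
    · intro h j hj hlj
      have := h (p - j) (by omega)
      rw [show p + (p - j) = 2 * p - j by omega, show p - (p - j) = j by omega] at this
      exact this.symm
  exact le_antisymm ((key _ hle).1 le_rfl) ((key _ (level_le s)).2 le_rfl)

end QAOA

/-! ### The program, its memory layout, and the tables of levels, weights and phases. -/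

namespace QAOA

/-! ### The program -/

/-- Constants: the sizes and base addresses of the tables, `d`, `± i / 2`, `1 / 2` and `i`. -/
def setupCode : List Instr :=
  [.wconst 1 1, .wop .add 2 0 0, .wop .add 3 2 1, .wop .shl 3 1 3, .wop .add 4 3 3,
   .wop .add 5 4 3, .wconst 14 0, .wconst 6 0, .cload 0 6, .cconst 1 0 (1 / 2),
   .cconst 2 0 (-1 / 2), .cconst 3 (1 / 2) 0, .cconst 11 0 1]

/-- The bits `s_j, s_{j+1}, s_{2p-j}, s_{2p-j-1}` and the amplitudes for the angle `β_j`. -/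
def loadCode : List Instr :=
  [.wop .shr 9 6 8, .wop .and 9 9 1,
   .wop .add 13 8 1, .wop .shr 10 6 13, .wop .and 10 10 1,
   .wop .sub 13 2 8, .wop .shr 11 6 13, .wop .and 11 11 1,
   .wop .sub 13 13 1, .wop .shr 12 6 13, .wop .and 12 12 1,
   .wop .add 13 8 1, .cload 10 13, .wop .add 13 13 0, .cload 6 13,
   .cmul 7 1 10, .cexp 7 7, .cmul 8 2 10, .cexp 8 8, .cmul 7 7 3, .cmul 8 8 3,
   .cadd 10 7 8, .csub 9 8 7, .csub 8 7 8]

/-- Multiply the weight by the amplitude of the first half. -/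
def ketCode : Prog := .branch (.eq 9 10) (block [.cmul 4 4 10]) (block [.cmul 4 4 9])

/-- Multiply the weight by the amplitude of the second half. -/
def braCode : Prog := .branch (.eq 11 12) (block [.cmul 4 4 10]) (block [.cmul 4 4 8])

/-- Update the level and the phase. -/
def mirrorCode : Prog := .branch (.eq 9 11) .skip
  (.seq (block [.wop .sub 7 0 8, .wop .sub 7 7 1])
    (.branch (.lt 9 11) (block [.csub 5 5 6]) (block [.cadd 5 5 6])))

/-- Process the layer `j`. -/
def layerCode : Prog :=
  .seq (block loadCode) (.seq ketCode (.seq braCode (.seq mirrorCode (block [.wop .add 8 8 1]))))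

/-- Prepare the loop over the layers. -/
def initStringCode : List Instr :=
  [.wop .sub 7 2 0, .wconst 8 0, .cconst 4 1 0, .cconst 5 0 0]

/-- Store the level, the weight and the phase of a string. -/
def storeCode : List Instr :=
  [.wstore 6 7, .wop .add 13 3 6, .cstore 13 4, .cmul 5 5 11, .cexp 5 5, .wop .add 13 4 6,
   .cstore 13 5, .cconst 5 1 0, .wop .add 13 5 6, .cstore 13 5, .wop .add 6 6 1]

/-- Fill the tables for one string. -/
def stringCode : Prog :=
  .seq (block initStringCode) (.seq (.loop (.lt 8 0) layerCode) (block storeCode))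

/-- Add the contribution of one string `t` of high level. -/
def addCode : List Instr :=
  [.wop .add 13 3 7, .cload 5 13, .wop .xor 13 6 7, .wop .add 13 4 13, .cload 6 13,
   .cmul 5 5 6, .cadd 4 4 5]

/-- Process one string `t`. -/
def sumCode : Prog :=
  .seq (block [.wload 10 7]) (.seq (.branch (.lt 8 10) (block addCode) .skip)
    (block [.wop .add 7 7 1]))

/-- Store `R_s` and the weight times `R_s`. -/
def finishCode : List Instr :=
  [.cmul 4 4 3, .cmul 4 4 0, .csub 4 4 0, .cexp 4 4, .wop .add 13 5 6, .cstore 13 4,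
   .wop .add 13 3 6, .cload 5 13, .cmul 5 5 4, .cstore 13 5]

/-- Compute `R_s` for a string `s` of the current level. -/
def computeCode : Prog :=
  .seq (block [.cconst 4 0 0, .wconst 7 0]) (.seq (.loop (.lt 7 3) sumCode) (block finishCode))

/-- Process one string `s`. -/
def visitCode : Prog :=
  .seq (block [.wload 9 6]) (.seq (.branch (.eq 9 8) computeCode .skip)
    (block [.wop .add 6 6 1]))

/-- Process one level. -/
def levelCode : Prog :=
  .seq (block [.wop .sub 8 8 1, .wconst 6 0]) (.loop (.lt 6 3) visitCode)

/-- The program computing all the numbers `R_s`. -/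
def program : Prog :=
  .seq (block setupCode) (.seq (.loop (.lt 6 3) stringCode)
    (.seq (block [.wop .sub 8 2 0]) (.seq (.loop (.lt 14 8) levelCode)
      (block [.wop .sub 0 5 14]))))

noncomputable section

/-! ### Invariants -/

/-- The number of strings. -/
def size (p : ℕ) : ℕ := 2 ^ (2 * p + 1)

/-- The input occupies complex addresses `0, …, 2p`, so the first complex table, starting at `size
p`, does not overwrite it. -/
theorem two_mul_add_one_lt_size (p : ℕ) : 2 * p + 1 < size p := Nat.lt_two_pow_self

/-- The registers holding constants. -/
structure Consts (p : ℕ) (d : ℝ) (w : ℕ) (τ : State) : Prop where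
  bdd : Bdd w τ
  r0 : τ.reg 0 = p
  r1 : τ.reg 1 = 1
  r2 : τ.reg 2 = 2 * p
  r3 : τ.reg 3 = size p
  r4 : τ.reg 4 = 2 * size p
  r5 : τ.reg 5 = 3 * size p
  r14 : τ.reg 14 = 0
  c0 : τ.creg 0 = d
  c1 : τ.creg 1 = Complex.I / 2
  c2 : τ.creg 2 = -(Complex.I / 2)
  c3 : τ.creg 3 = 1 / 2
  c11 : τ.creg 11 = Complex.I

/-- The instruction does not change a register holding a constant. -/
def Instr.KeepsConsts : Instr → Prop
  | .wconst r _ => 5 < r ∧ r ≠ 14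
  | .wop _ r _ _ => 5 < r ∧ r ≠ 14
  | .wload r _ => 5 < r ∧ r ≠ 14
  | .wstore _ _ => True
  | .cconst r _ _ => 3 < r ∧ r ≠ 11
  | .cadd r _ _ => 3 < r ∧ r ≠ 11
  | .csub r _ _ => 3 < r ∧ r ≠ 11
  | .cmul r _ _ => 3 < r ∧ r ≠ 11
  | .cexp r _ => 3 < r ∧ r ≠ 11
  | .cload r _ => 3 < r ∧ r ≠ 11
  | .cstore _ _ => True

theorem Instr.KeepsConsts.reg_step {i : Instr} (h : i.KeepsConsts) (σ : State) {r : ℕ}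
    (hr : r ≤ 5 ∨ r = 14) : (i.step σ).reg r = σ.reg r := by
  cases i <;> simp only [Instr.KeepsConsts] at h <;> simp only [Instr.step] <;>
    exact Function.update_of_ne (by omega) _ _

theorem Instr.KeepsConsts.creg_step {i : Instr} (h : i.KeepsConsts) (σ : State) {r : ℕ}
    (hr : r ≤ 3 ∨ r = 11) : (i.step σ).creg r = σ.creg r := by
  cases i <;> simp only [Instr.KeepsConsts] at h <;> simp only [Instr.step] <;>
    exact Function.update_of_ne (by omega) _ _

theorem reg_runBlock {is : List Instr} (h : ∀ i ∈ is, i.KeepsConsts) (σ : State) {r : ℕ}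
    (hr : r ≤ 5 ∨ r = 14) : (runBlock is σ).reg r = σ.reg r := by
  induction is generalizing σ with
  | nil => rfl
  | cons i is ih =>
    rw [runBlock, ih (fun j hj => h j (List.mem_cons_of_mem _ hj)),
      (h i List.mem_cons_self).reg_step σ hr]

theorem creg_runBlock {is : List Instr} (h : ∀ i ∈ is, i.KeepsConsts) (σ : State) {r : ℕ}
    (hr : r ≤ 3 ∨ r = 11) : (runBlock is σ).creg r = σ.creg r := by
  induction is generalizing σ with
  | nil => rfl
  | cons i is ih =>
    rw [runBlock, ih (fun j hj => h j (List.mem_cons_of_mem _ hj)),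
      (h i List.mem_cons_self).creg_step σ hr]

theorem Consts.runBlock {p : ℕ} {d : ℝ} {w : ℕ} {τ : State} (h : Consts p d w τ)
    {is : List Instr} (hk : ∀ i ∈ is, i.KeepsConsts) (hb : Bdd w (runBlock is τ)) :
    Consts p d w (runBlock is τ) where
  bdd := hb
  r0 := (reg_runBlock hk τ (by omega)).trans h.r0
  r1 := (reg_runBlock hk τ (by omega)).trans h.r1
  r2 := (reg_runBlock hk τ (by omega)).trans h.r2
  r3 := (reg_runBlock hk τ (by omega)).trans h.r3
  r4 := (reg_runBlock hk τ (by omega)).trans h.r4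
  r5 := (reg_runBlock hk τ (by omega)).trans h.r5
  r14 := (reg_runBlock hk τ (by omega)).trans h.r14
  c0 := (creg_runBlock hk τ (by omega)).trans h.c0
  c1 := (creg_runBlock hk τ (by omega)).trans h.c1
  c2 := (creg_runBlock hk τ (by omega)).trans h.c2
  c3 := (creg_runBlock hk τ (by omega)).trans h.c3
  c11 := (creg_runBlock hk τ (by omega)).trans h.c11

/-- A vector of angles, extended by zero. -/
def extend {p : ℕ} (β : Fin p → ℝ) (j : ℕ) : ℝ := if h : j < p then β ⟨j, h⟩ else 0

/-- The input angles are in the complex memory. -/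
def Input {p : ℕ} (β γ : Fin p → ℝ) (cmem : ℕ → ℂ) : Prop :=
  ∀ j < p, cmem (j + 1) = extend β j ∧ cmem (j + 1 + p) = extend γ j

/-- The tables are filled for the strings with code below `i`. -/
def Tables {p : ℕ} (β γ : Fin p → ℝ) (i : ℕ) (mem : ℕ → ℕ) (cmem : ℕ → ℂ) : Prop :=
  ∀ k < i, mem k = level (decode p k) ∧ cmem (size p + k) = weight β (decode p k) ∧
    cmem (2 * size p + k) = phase γ (decode p k) ∧ cmem (3 * size p + k) = 1

/-- The factor of the layer `j` in the weight of `s`, first half. -/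
def ketAmp {p : ℕ} (β : Fin p → ℝ) (s : Bits p) (j : ℕ) : ℂ :=
  mixerAmp (-extend β j) (bit s j) (bit s (j + 1))

/-- The factor of the layer `j` in the weight of `s`, second half. -/
def braAmp {p : ℕ} (β : Fin p → ℝ) (s : Bits p) (j : ℕ) : ℂ :=
  mixerAmp (extend β j) (bit s (2 * p - j)) (bit s (2 * p - j - 1))

/-- The contribution of the layer `j` to the phase of `s`. -/
def layerPhi {p : ℕ} (γ : Fin p → ℝ) (s : Bits p) (j : ℕ) : ℝ :=
  extend γ j / 2 * (spin (bit s (2 * p - j)) - spin (bit s j))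

theorem prod_ketAmp_mul_braAmp {p : ℕ} (β : Fin p → ℝ) (s : Bits p) :
    ∏ j ∈ Finset.range p, (ketAmp β s j * braAmp β s j) = weight β s := by
  rw [weight_eq, ← Fin.prod_univ_eq_prod_range (fun j => ketAmp β s j * braAmp β s j)]
  refine Finset.prod_congr rfl fun j _ => ?_
  simp [ketAmp, braAmp, extend]

theorem sum_layerPhi {p : ℕ} (γ : Fin p → ℝ) (s : Bits p) :
    ∑ j ∈ Finset.range p, layerPhi γ s j = phi γ s := by
  rw [phi, ← Fin.sum_univ_eq_sum_range (fun j => layerPhi γ s j)]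
  refine Finset.sum_congr rfl fun j _ => ?_
  simp [layerPhi, extend]

/-- The state while the string with code `i` is processed. -/
structure LayerInv {p : ℕ} (d : ℝ) (β γ : Fin p → ℝ) (w i j lev : ℕ) (W : ℂ) (φ : ℝ)
    (τ : State) : Prop where
  consts : Consts p d w τ
  input : Input β γ τ.cmem
  tables : Tables β γ i τ.mem τ.cmem
  r6 : τ.reg 6 = i
  r7 : τ.reg 7 = lev
  r8 : τ.reg 8 = j
  c4 : τ.creg 4 = W
  c5 : τ.creg 5 = φ

/-- The data of the layer `j` are loaded. -/
structure LayerData {p : ℕ} (β γ : Fin p → ℝ) (s : Bits p) (j : ℕ) (τ : State) : Prop where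
  r9 : τ.reg 9 = (bit s j).toNat
  r10 : τ.reg 10 = (bit s (j + 1)).toNat
  r11 : τ.reg 11 = (bit s (2 * p - j)).toNat
  r12 : τ.reg 12 = (bit s (2 * p - j - 1)).toNat
  c6 : τ.creg 6 = extend γ j
  c8 : τ.creg 8 = Complex.I * (Real.sin (extend β j / 2) : ℂ)
  c9 : τ.creg 9 = -(Complex.I * (Real.sin (extend β j / 2) : ℂ))
  c10 : τ.creg 10 = (Real.cos (extend β j / 2) : ℂ)

theorem toNat_eq_toNat_iff (a b : Bool) : a.toNat = b.toNat ↔ a = b := by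
  cases a <;> cases b <;> simp

/-- The machine only has the exponential; cosine and `i sin` are assembled from `e^{± ib/2}`. -/
theorem half_exp_add (b : ℝ) : Complex.exp (Complex.I / 2 * b) * (1 / 2) +
    Complex.exp (-(Complex.I / 2) * b) * (1 / 2) = (Real.cos (b / 2) : ℂ) := by
  rw [Complex.ofReal_cos, Complex.cos]
  push_cast
  rw [show Complex.I / 2 * b = b / 2 * Complex.I by ring,
    show -(Complex.I / 2) * (b : ℂ) = -((b : ℂ) / 2) * Complex.I by ring]
  ring

theorem half_exp_sub (b : ℝ) : Complex.exp (Complex.I / 2 * b) * (1 / 2) -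
    Complex.exp (-(Complex.I / 2) * b) * (1 / 2) = Complex.I * (Real.sin (b / 2) : ℂ) := by
  rw [Complex.ofReal_sin, Complex.sin]
  push_cast
  rw [show Complex.I / 2 * b = b / 2 * Complex.I by ring,
    show -(Complex.I / 2) * (b : ℂ) = -((b : ℂ) / 2) * Complex.I by ring]
  ring_nf
  rw [Complex.I_sq]
  ring

section Layer

variable {p : ℕ} {d : ℝ} {β γ : Fin p → ℝ} {w i j lev : ℕ} {W : ℂ} {φ : ℝ} {τ : State}

theorem runs_loadCode (hw : 4 * size p ≤ 2 ^ w) (hi : i < size p) (hj : j < p)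
    (h : LayerInv d β γ w i j lev W φ τ) :
    Runs w (block loadCode) τ 24 fun τ' =>
      LayerInv d β γ w i j lev W φ τ' ∧ LayerData β γ (decode p i) j τ' := by
  have hN := two_mul_add_one_lt_size p
  have hsh : ∀ k, i >>> k < 2 ^ w := fun k => by
    have := Nat.shiftRight_le i k
    omega
  have hand : ∀ k, (i >>> k) &&& 1 < 2 ^ w := fun k => by
    have := Nat.and_le_left (n := i >>> k) (m := 1)
    have := hsh k
    omega
  refine Runs.block h.consts.bdd ?_ fun hb => ⟨⟨?_, h.input, h.tables, h.r6, h.r7, h.r8, h.c4,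
    h.c5⟩, ?_⟩
  · simp only [SafeBlock, loadCode, Instr.Safe, Instr.step, WordOp.eval, Function.update_apply,
      reduceIte, Nat.reduceEqDiff, true_and, and_true, h.consts.r0, h.consts.r1, h.consts.r2,
      h.r6, h.r8, hsh, hand]
    omega
  · exact h.consts.runBlock (by simp [loadCode, Instr.KeepsConsts]) hb
  -- Symbolic execution is definitional: with concrete register numbers, the final contents reduce
  -- by `rfl`.
  · have e9 : (runBlock loadCode τ).reg 9 = (τ.reg 6 >>> τ.reg 8) &&& τ.reg 1 := rfl
    have e10 : (runBlock loadCode τ).reg 10 = (τ.reg 6 >>> (τ.reg 8 + τ.reg 1)) &&& τ.reg 1 := rfl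
    have e11 : (runBlock loadCode τ).reg 11 = (τ.reg 6 >>> (τ.reg 2 - τ.reg 8)) &&& τ.reg 1 := rfl
    have e12 : (runBlock loadCode τ).reg 12 =
        (τ.reg 6 >>> (τ.reg 2 - τ.reg 8 - τ.reg 1)) &&& τ.reg 1 := rfl
    have f6 : (runBlock loadCode τ).creg 6 = τ.cmem (τ.reg 8 + τ.reg 1 + τ.reg 0) := rfl
    have f8 : (runBlock loadCode τ).creg 8 =
        Complex.exp (τ.creg 1 * τ.cmem (τ.reg 8 + τ.reg 1)) * τ.creg 3 -
        Complex.exp (τ.creg 2 * τ.cmem (τ.reg 8 + τ.reg 1)) * τ.creg 3 := rfl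
    have f9 : (runBlock loadCode τ).creg 9 =
        Complex.exp (τ.creg 2 * τ.cmem (τ.reg 8 + τ.reg 1)) * τ.creg 3 -
        Complex.exp (τ.creg 1 * τ.cmem (τ.reg 8 + τ.reg 1)) * τ.creg 3 := rfl
    have f10 : (runBlock loadCode τ).creg 10 =
        Complex.exp (τ.creg 1 * τ.cmem (τ.reg 8 + τ.reg 1)) * τ.creg 3 +
        Complex.exp (τ.creg 2 * τ.cmem (τ.reg 8 + τ.reg 1)) * τ.creg 3 := rfl
    rw [h.r6, h.r8, h.consts.r1] at e9 e10
    rw [h.r6, h.r8, h.consts.r1, h.consts.r2] at e11 e12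
    rw [h.r8, h.consts.r1, h.consts.r0, (h.input j hj).2] at f6
    rw [h.r8, h.consts.r1, (h.input j hj).1, h.consts.c1, h.consts.c2, h.consts.c3] at f8 f9 f10
    refine ⟨?_, ?_, ?_, ?_, f6, ?_, ?_, ?_⟩
    · rw [e9, shiftRight_and_one, bit_decode (by omega)]
    · rw [e10, shiftRight_and_one, bit_decode (by omega)]
    · rw [e11, shiftRight_and_one, bit_decode (by omega)]
    · rw [e12, shiftRight_and_one, bit_decode (by omega)]
    · rw [f8, half_exp_sub]
    · rw [f9, ← half_exp_sub]
      ring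
    · rw [f10, half_exp_add]

theorem runs_cmul_weight (h : LayerInv d β γ w i j lev W φ τ)
    (hd : LayerData β γ (decode p i) j τ) {r : ℕ} {x : ℂ} (hx : τ.creg r = x) :
    Runs w (block [.cmul 4 4 r]) τ 1 fun τ' =>
      LayerInv d β γ w i j lev (W * x) φ τ' ∧ LayerData β γ (decode p i) j τ' := by
  refine Runs.block h.consts.bdd ⟨trivial, trivial⟩ fun hb => ⟨⟨?_, h.input, h.tables, h.r6, h.r7,
    h.r8, ?_, h.c5⟩, hd.r9, hd.r10, hd.r11, hd.r12, hd.c6, hd.c8, hd.c9, hd.c10⟩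
  · exact h.consts.runBlock (by simp [Instr.KeepsConsts]) hb
  · have e : (runBlock [.cmul 4 4 r] τ).creg 4 = τ.creg 4 * τ.creg r := rfl
    rw [e, h.c4, hx]

theorem runs_ketCode (h : LayerInv d β γ w i j lev W φ τ)
    (hd : LayerData β γ (decode p i) j τ) :
    Runs w ketCode τ 2 fun τ' => LayerInv d β γ w i j lev (W * ketAmp β (decode p i) j) φ τ' ∧
      LayerData β γ (decode p i) j τ' := by
  refine Runs.branch (fun hb => ?_) fun hb => ?_
  · have hb' : τ.reg 9 = τ.reg 10 := hb
    rw [hd.r9, hd.r10, toNat_eq_toNat_iff] at hb'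
    refine runs_cmul_weight h hd ?_
    rw [hd.c10, ketAmp, mixerAmp, if_pos hb', neg_div, Real.cos_neg]
  · have hb' : ¬ τ.reg 9 = τ.reg 10 := hb
    rw [hd.r9, hd.r10, toNat_eq_toNat_iff] at hb'
    refine runs_cmul_weight h hd ?_
    rw [hd.c9, ketAmp, mixerAmp, if_neg hb', neg_div, Real.sin_neg]
    push_cast
    ring

theorem runs_braCode (h : LayerInv d β γ w i j lev W φ τ)
    (hd : LayerData β γ (decode p i) j τ) :
    Runs w braCode τ 2 fun τ' => LayerInv d β γ w i j lev (W * braAmp β (decode p i) j) φ τ' ∧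
      LayerData β γ (decode p i) j τ' := by
  refine Runs.branch (fun hb => ?_) fun hb => ?_
  · have hb' : τ.reg 11 = τ.reg 12 := hb
    rw [hd.r11, hd.r12, toNat_eq_toNat_iff] at hb'
    refine runs_cmul_weight h hd ?_
    rw [hd.c10, braAmp, mixerAmp, if_pos hb']
  · have hb' : ¬ τ.reg 11 = τ.reg 12 := hb
    rw [hd.r11, hd.r12, toNat_eq_toNat_iff] at hb'
    refine runs_cmul_weight h hd ?_
    rw [hd.c8, braAmp, mixerAmp, if_neg hb']

/-- Equal mirror bits contribute no phase; unequal ones have spins differing by `±2`, so the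
contribution is `±γ_j` without a division. -/
theorem runs_mirrorCode (hw : 4 * size p ≤ 2 ^ w)
    (h : LayerInv d β γ w i j lev W φ τ) (hd : LayerData β γ (decode p i) j τ) :
    Runs w mirrorCode τ 5 fun τ' => LayerInv d β γ w i j
      (if bit (decode p i) j = bit (decode p i) (2 * p - j) then lev else p - 1 - j) W
      (φ + layerPhi γ (decode p i) j) τ' := by
  have hN := two_mul_add_one_lt_size p
  refine Runs.branch (T := 4) (fun hb => ?_) fun hb => ?_
  · have hb' : τ.reg 9 = τ.reg 11 := hb
    rw [hd.r9, hd.r11, toNat_eq_toNat_iff] at hb'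
    refine (Runs.skip ?_).mono (Nat.zero_le _) fun _ h => h
    rw [if_pos hb', layerPhi, hb', sub_self, mul_zero, add_zero]
    exact h
  · have hb' : ¬ τ.reg 9 = τ.reg 11 := hb
    rw [hd.r9, hd.r11, toNat_eq_toNat_iff] at hb'
    rw [if_neg hb']
    refine Runs.seq (T := 2) (T' := 2) (Q := fun τ' => LayerInv d β γ w i j (p - 1 - j) W φ τ' ∧
      LayerData β γ (decode p i) j τ') (Runs.block h.consts.bdd ?_ fun hb => ⟨⟨?_, h.input,
        h.tables, h.r6, ?_, h.r8, h.c4, h.c5⟩, hd.r9, hd.r10, hd.r11, hd.r12, hd.c6, hd.c8,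
        hd.c9, hd.c10⟩) ?_
    · simp only [SafeBlock, Instr.Safe, Instr.step, WordOp.eval, Function.update_apply,
        reduceIte, Nat.reduceEqDiff, and_true, h.consts.r0, h.consts.r1, h.r8]
      omega
    · exact h.consts.runBlock (by simp [Instr.KeepsConsts]) hb
    · have e : (runBlock [.wop .sub 7 0 8, .wop .sub 7 7 1] τ).reg 7 =
        τ.reg 0 - τ.reg 8 - τ.reg 1 := rfl
      rw [e, h.consts.r0, h.consts.r1, h.r8]
      omega
    · rintro τ' ⟨h', hd'⟩
      refine Runs.branch (fun hlt => ?_) fun hlt => ?_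
      · have hlt' : τ'.reg 9 < τ'.reg 11 := hlt
        rw [hd'.r9, hd'.r11] at hlt'
        refine Runs.block h'.consts.bdd ⟨trivial, trivial⟩ fun hb => ⟨?_, h'.input, h'.tables,
          h'.r6, h'.r7, h'.r8, h'.c4, ?_⟩
        · exact h'.consts.runBlock (by simp [Instr.KeepsConsts]) hb
        · have e : (runBlock [.csub 5 5 6] τ').creg 5 = τ'.creg 5 - τ'.creg 6 := rfl
          rw [e, h'.c5, hd'.c6, layerPhi]
          revert hlt'
          cases bit (decode p i) j <;> cases bit (decode p i) (2 * p - j) <;> simp [spin]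
          ring
      · have hlt' : ¬ τ'.reg 9 < τ'.reg 11 := hlt
        rw [hd'.r9, hd'.r11] at hlt'
        refine Runs.block h'.consts.bdd ⟨trivial, trivial⟩ fun hb => ⟨?_, h'.input, h'.tables,
          h'.r6, h'.r7, h'.r8, h'.c4, ?_⟩
        · exact h'.consts.runBlock (by simp [Instr.KeepsConsts]) hb
        · have e : (runBlock [.cadd 5 5 6] τ').creg 5 = τ'.creg 5 + τ'.creg 6 := rfl
          rw [e, h'.c5, hd'.c6, layerPhi]
          revert hlt' hb'
          cases bit (decode p i) j <;> cases bit (decode p i) (2 * p - j) <;> simp [spin]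
          ring

/-- The state after `j` layers of the string with code `i`. -/
def LoopInv (d : ℝ) (β γ : Fin p → ℝ) (w i j : ℕ) (τ : State) : Prop :=
  LayerInv d β γ w i j (levelAux (decode p i) j)
    (∏ j' ∈ Finset.range j, (ketAmp β (decode p i) j' * braAmp β (decode p i) j'))
    (∑ j' ∈ Finset.range j, layerPhi γ (decode p i) j') τ

theorem runs_layerCode (hw : 4 * size p ≤ 2 ^ w) (hi : i < size p) (hj : j < p)
    (h : LoopInv d β γ w i j τ) : Runs w layerCode τ 34 (LoopInv d β γ w i (j + 1)) := by
  have hN := two_mul_add_one_lt_size p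
  refine (Runs.seq (runs_loadCode hw hi hj h) fun τ₁ h₁ => Runs.seq (runs_ketCode h₁.1 h₁.2)
    fun τ₂ h₂ => Runs.seq (runs_braCode h₂.1 h₂.2) fun τ₃ h₃ =>
    Runs.seq (runs_mirrorCode hw h₃.1 h₃.2) fun τ₄ h₄ =>
    Runs.block (is := [.wop .add 8 8 1]) (Q := LoopInv d β γ w i (j + 1)) h₄.consts.bdd ?_ fun hb => ⟨?_, h₄.input, h₄.tables,
      h₄.r6, ?_, ?_, ?_, ?_⟩).mono (by norm_num) fun _ h => h
  · simp only [SafeBlock, Instr.Safe, WordOp.eval, and_true, h₄.consts.r1, h₄.r8]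
    omega
  · exact h₄.consts.runBlock (by simp [Instr.KeepsConsts]) hb
  · exact h₄.r7
  · have e : (runBlock [.wop .add 8 8 1] τ₄).reg 8 = τ₄.reg 8 + τ₄.reg 1 := rfl
    rw [e, h₄.r8, h₄.consts.r1]
  · refine h₄.c4.trans ?_
    rw [Finset.prod_range_succ]
    ring
  · refine h₄.c5.trans ?_
    rw [Finset.sum_range_succ]

end Layer

/-- The state when the tables are filled for codes below `i`. -/
structure TableInv {p : ℕ} (d : ℝ) (β γ : Fin p → ℝ) (w i : ℕ) (τ : State) : Prop where
  consts : Consts p d w τ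
  input : Input β γ τ.cmem
  tables : Tables β γ i τ.mem τ.cmem
  r6 : τ.reg 6 = i

/-- The time is 4 for the preparation, 34 + 1 per layer including the test, 1 for the last test and
11 for storing. -/
theorem runs_stringCode {p : ℕ} {d : ℝ} {β γ : Fin p → ℝ} {w i : ℕ} {τ : State}
    (hw : 4 * size p ≤ 2 ^ w) (hi : i < size p) (h : TableInv d β γ w i τ) :
    Runs w stringCode τ (35 * p + 16) (TableInv d β γ w (i + 1)) := by
  have hN := two_mul_add_one_lt_size p
  have h1 : Runs w (block initStringCode) τ 4 (LoopInv d β γ w i 0) := by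
    refine Runs.block h.consts.bdd ?_ fun hb => ⟨?_, h.input, h.tables, h.r6, ?_, rfl, ?_, ?_⟩
    · simp only [SafeBlock, initStringCode, Instr.Safe, WordOp.eval, and_true,
        h.consts.r0, h.consts.r2]
      omega
    · exact h.consts.runBlock (by simp [initStringCode, Instr.KeepsConsts]) hb
    · have e : (runBlock initStringCode τ).reg 7 = τ.reg 2 - τ.reg 0 := rfl
      rw [e, h.consts.r0, h.consts.r2, levelAux]
      omega
    · have e : (runBlock initStringCode τ).creg 4 = ((1 : ℚ) : ℂ) + ((0 : ℚ) : ℂ) * Complex.I := rfl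
      rw [e]
      simp
    · have e : (runBlock initStringCode τ).creg 5 = ((0 : ℚ) : ℂ) + ((0 : ℚ) : ℂ) * Complex.I := rfl
      rw [e]
      simp
  refine (Runs.seq h1 fun τ₁ h₁ => Runs.seq (Runs.loop (LoopInv d β γ w i) (fun _ => 34) p
    (fun j hj σ hσ => ⟨?_, runs_layerCode hw hi hj hσ⟩) (fun σ hσ => ?_) h₁) fun τ₂ h₂ =>
    Runs.block (Q := TableInv d β γ w (i + 1)) h₂.consts.bdd ?_ fun hb => ⟨?_, ?_, ?_, ?_⟩).mono ?_
      fun _ h => h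
  · change σ.reg 8 < σ.reg 0
    rw [hσ.r8, hσ.consts.r0]
    exact hj
  · change ¬ σ.reg 8 < σ.reg 0
    rw [hσ.r8, hσ.consts.r0]
    exact lt_irrefl p
  · simp only [SafeBlock, storeCode, Instr.Safe, Instr.step, WordOp.eval, Function.update_apply,
      reduceIte, Nat.reduceEqDiff, true_and, and_true, h₂.consts.r1, h₂.consts.r3, h₂.consts.r4,
      h₂.consts.r5, h₂.r6]
    omega
  · exact h₂.consts.runBlock (by simp [storeCode, Instr.KeepsConsts]) hb
  · intro j hj
    have e : (runBlock storeCode τ₂).cmem = Function.update (Function.update (Function.update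
      τ₂.cmem (τ₂.reg 3 + τ₂.reg 6) (τ₂.creg 4)) (τ₂.reg 4 + τ₂.reg 6)
      (Complex.exp (τ₂.creg 5 * τ₂.creg 11))) (τ₂.reg 5 + τ₂.reg 6)
      (((1 : ℚ) : ℂ) + ((0 : ℚ) : ℂ) * Complex.I) := rfl
    rw [e, h₂.consts.r3, h₂.consts.r4, h₂.consts.r5, h₂.r6]
    have := h₂.input j hj
    constructor
    · rw [Function.update_of_ne (by omega), Function.update_of_ne (by omega),
        Function.update_of_ne (by omega), this.1]
    · rw [Function.update_of_ne (by omega), Function.update_of_ne (by omega),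
        Function.update_of_ne (by omega), this.2]
  · intro k hk
    have e : (runBlock storeCode τ₂).cmem = Function.update (Function.update (Function.update
      τ₂.cmem (τ₂.reg 3 + τ₂.reg 6) (τ₂.creg 4)) (τ₂.reg 4 + τ₂.reg 6)
      (Complex.exp (τ₂.creg 5 * τ₂.creg 11))) (τ₂.reg 5 + τ₂.reg 6)
      (((1 : ℚ) : ℂ) + ((0 : ℚ) : ℂ) * Complex.I) := rfl
    have e' : (runBlock storeCode τ₂).mem = Function.update τ₂.mem (τ₂.reg 6) (τ₂.reg 7) := rfl
    rw [e, e', h₂.consts.r3, h₂.consts.r4, h₂.consts.r5, h₂.r6, h₂.r7, h₂.c4, h₂.c5, h₂.consts.c11,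
      levelAux_eq_level, prod_ketAmp_mul_braAmp, sum_layerPhi]
    rcases Nat.lt_succ_iff_lt_or_eq.1 hk with hk' | rfl
    · obtain ⟨t1, t2, t3, t4⟩ := h₂.tables k hk'
      refine ⟨?_, ?_, ?_, ?_⟩
      · rw [Function.update_of_ne (by omega), t1]
      · rw [Function.update_of_ne (by omega), Function.update_of_ne (by omega),
          Function.update_of_ne (by omega), t2]
      · rw [Function.update_of_ne (by omega), Function.update_of_ne (by omega),
          Function.update_of_ne (by omega), t3]
      · rw [Function.update_of_ne (by omega), Function.update_of_ne (by omega),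
          Function.update_of_ne (by omega), t4]
    · refine ⟨?_, ?_, ?_, ?_⟩
      · rw [Function.update_self]
      · rw [Function.update_of_ne (by omega), Function.update_of_ne (by omega),
          Function.update_self]
      · rw [Function.update_of_ne (by omega), Function.update_self, phase, mul_comm]
      · rw [Function.update_self]
        simp
  · have e : (runBlock storeCode τ₂).reg 6 = τ₂.reg 6 + τ₂.reg 1 := rfl
    rw [e, h₂.r6, h₂.consts.r1]
  · rw [Finset.sum_const, Finset.card_range, smul_eq_mul]
    simp only [storeCode, List.length_cons, List.length_nil]
    omega

end

end QAOA

/-! ### Correctness and running time of the descent through the levels. -/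

namespace QAOA

noncomputable section

/-! ### The recursion over the levels -/

/-- The tables, when `R` is known for the strings with code in `D`. -/
structure RTables {p : ℕ} (d : ℝ) (β γ : Fin p → ℝ) (D : ℕ → Prop) (mem : ℕ → ℕ)
    (cmem : ℕ → ℂ) : Prop where
  lev : ∀ k < size p, mem k = level (decode p k)
  phase : ∀ k < size p, cmem (2 * size p + k) = phase γ (decode p k)
  done : ∀ k < size p, D k → cmem (3 * size p + k) = R d β γ (decode p k)
  doneWeight : ∀ k < size p, D k →
    cmem (size p + k) = weight β (decode p k) * R d β γ (decode p k)
  weight : ∀ k < size p, ¬ D k → cmem (size p + k) = weight β (decode p k)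

theorem RTables.congr {p : ℕ} {d : ℝ} {β γ : Fin p → ℝ} {D D' : ℕ → Prop} {mem : ℕ → ℕ}
    {cmem : ℕ → ℂ} (h : RTables d β γ D mem cmem) (hD : ∀ k < size p, D k ↔ D' k) :
    RTables d β γ D' mem cmem where
  lev := h.lev
  phase := h.phase
  done k hk hk' := h.done k hk ((hD k hk).2 hk')
  doneWeight k hk hk' := h.doneWeight k hk ((hD k hk).2 hk')
  weight k hk hk' := h.weight k hk fun h' => hk' ((hD k hk).1 h')

/-- The strings known when the level `l` has been processed up to code `i`. -/
def Known (p l i k : ℕ) : Prop := l < level (decode p k) ∨ level (decode p k) = l ∧ k < i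

/-- The state while the string with code `i` is visited for the level `l`. -/
structure VisitInv {p : ℕ} (d : ℝ) (β γ : Fin p → ℝ) (w l i : ℕ) (τ : State) : Prop where
  consts : Consts p d w τ
  tables : RTables d β γ (Known p l i) τ.mem τ.cmem
  r6 : τ.reg 6 = i
  r8 : τ.reg 8 = l

/-- The partial sum over the strings with code below `t`. -/
def partialSum {p : ℕ} (d : ℝ) (β γ : Fin p → ℝ) (l i t : ℕ) : ℂ :=
  ∑ k ∈ Finset.range t, if l < level (decode p k) then
    weight β (decode p k) * R d β γ (decode p k) * phase γ (bxor (decode p i) (decode p k)) else 0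

/-- As `i` lies below the top, the condition "of higher level" already includes the top level, where
`R = 1`; no separate sum is needed. -/
theorem exp_partialSum {p : ℕ} (d : ℝ) (β γ : Fin p → ℝ) {i : ℕ}
    (hi : level (decode p i) < p) :
    Complex.exp (partialSum d β γ (level (decode p i)) i (size p) * (1 / 2) * d - d) =
      R d β γ (decode p i) := by
  rw [R_eq_exp]
  congr 1
  have e : (Finset.univ.filter fun t : Bits p =>
      level (decode p i) + 1 ≤ level t ∨ level t = p) =
      Finset.univ.filter fun t => level (decode p i) < level t := by
    ext t
    simp only [Finset.mem_filter, Finset.mem_univ, true_and]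
    omega
  rw [e, Finset.sum_filter, sum_bits_eq_sum_range, partialSum, size]
  ring

/-- The state while the sum for the string with code `i` is computed. -/
structure SumInv {p : ℕ} (d : ℝ) (β γ : Fin p → ℝ) (w l i t : ℕ) (τ : State) : Prop extends
    VisitInv d β γ w l i τ where
  r7 : τ.reg 7 = t
  c4 : τ.creg 4 = partialSum d β γ l i t

section Levels

variable {p : ℕ} {d : ℝ} {β γ : Fin p → ℝ} {w l i t : ℕ} {τ : State}

theorem runs_sumCode (hw : 4 * size p ≤ 2 ^ w) (hi : i < size p) (ht : t < size p)
    (h : SumInv d β γ w l i t τ) : Runs w sumCode τ 10 (SumInv d β γ w l i (t + 1)) := by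
  have hN := two_mul_add_one_lt_size p
  have hlev := level_le (decode p t)
  have hx : i ^^^ t < size p := Nat.xor_lt_two_pow hi ht
  have h1 : Runs w (block [.wload 10 7]) τ 1 fun τ' =>
      SumInv d β γ w l i t τ' ∧ τ'.reg 10 = level (decode p t) := by
    refine Runs.block h.consts.bdd ?_ fun hb =>
      ⟨⟨⟨?_, h.tables, h.r6, h.r8⟩, h.r7, h.c4⟩, ?_⟩
    · simp only [SafeBlock, Instr.Safe, and_true, h.r7, h.tables.lev t ht]
      omega
    · exact h.consts.runBlock (by simp [Instr.KeepsConsts]) hb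
    · have e : (runBlock [.wload 10 7] τ).reg 10 = τ.mem (τ.reg 7) := rfl
      rw [e, h.r7, h.tables.lev t ht]
  have h2 : ∀ τ, (SumInv d β γ w l i t τ ∧ τ.reg 10 = level (decode p t)) →
      Runs w (.branch (.lt 8 10) (block addCode) .skip) τ 8 fun τ' =>
        VisitInv d β γ w l i τ' ∧ τ'.reg 7 = t ∧ τ'.creg 4 = partialSum d β γ l i (t + 1) := by
    rintro τ ⟨h, h10⟩
    refine Runs.branch (T := 7) (fun hb => ?_) fun hb => ?_
    · have hb' : τ.reg 8 < τ.reg 10 := hb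
      rw [h.r8, h10] at hb'
      refine Runs.block h.consts.bdd ?_ fun hb => ⟨⟨?_, h.tables, h.r6, h.r8⟩, h.r7, ?_⟩
      · simp only [SafeBlock, addCode, Instr.Safe, Instr.step, WordOp.eval, Function.update_apply,
          reduceIte, Nat.reduceEqDiff, true_and, and_true, h.consts.r3, h.consts.r4, h.r6, h.r7]
        omega
      · exact h.consts.runBlock (by simp [addCode, Instr.KeepsConsts]) hb
      · have e : (runBlock addCode τ).creg 4 = τ.creg 4 + τ.cmem (τ.reg 3 + τ.reg 7) *
          τ.cmem (τ.reg 4 + (τ.reg 6 ^^^ τ.reg 7)) := rfl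
        rw [e, h.c4, h.consts.r3, h.consts.r4, h.r6, h.r7, h.tables.phase _ hx,
          h.tables.doneWeight t ht (Or.inl hb'), decode_xor, partialSum, partialSum,
          Finset.sum_range_succ, if_pos hb']
    · have hb' : ¬ τ.reg 8 < τ.reg 10 := hb
      rw [h.r8, h10] at hb'
      refine (Runs.skip ⟨h.toVisitInv, h.r7, ?_⟩).mono (Nat.zero_le _) fun _ h => h
      rw [h.c4, partialSum, partialSum, Finset.sum_range_succ, if_neg hb', add_zero]
  refine Runs.seq (T' := 9) h1 fun τ₁ h₁ => Runs.seq (T' := 1) (h2 τ₁ h₁) fun τ₂ h₂ => ?_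
  obtain ⟨hv, h7, h4⟩ := h₂
  refine Runs.block (is := [.wop .add 7 7 1]) hv.consts.bdd ?_ fun hb =>
    ⟨⟨?_, hv.tables, hv.r6, hv.r8⟩, ?_, h4⟩
  · simp only [SafeBlock, Instr.Safe, WordOp.eval, and_true, hv.consts.r1, h7]
    omega
  · exact hv.consts.runBlock (by simp [Instr.KeepsConsts]) hb
  · have e : (runBlock [.wop .add 7 7 1] τ₂).reg 7 = τ₂.reg 7 + τ₂.reg 1 := rfl
    rw [e, h7, hv.consts.r1]

/-- The time is 2 for the preparation, 10 + 1 per string `t`, 1 for the last test and 10 for the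
final block. The sum reads only strictly higher levels, so entries of the current level can be
overwritten during the pass. -/
theorem runs_computeCode (hw : 4 * size p ≤ 2 ^ w) (hl : l < p) (hi : i < size p)
    (hlev : level (decode p i) = l) (h : VisitInv d β γ w l i τ) :
    Runs w computeCode τ (11 * size p + 13) fun τ' => Consts p d w τ' ∧
      RTables d β γ (Known p l (i + 1)) τ'.mem τ'.cmem ∧ τ'.reg 6 = i ∧ τ'.reg 8 = l := by
  have hN := two_mul_add_one_lt_size p
  have h1 : Runs w (block [.cconst 4 0 0, .wconst 7 0]) τ 2 (SumInv d β γ w l i 0) := by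
    refine Runs.block h.consts.bdd ?_ fun hb => ⟨⟨?_, h.tables, h.r6, h.r8⟩, rfl, ?_⟩
    · simp only [SafeBlock, Instr.Safe, and_true, true_and]
      omega
    · exact h.consts.runBlock (by simp [Instr.KeepsConsts]) hb
    · have e : (runBlock [.cconst 4 0 0, .wconst 7 0] τ).creg 4 =
        ((0 : ℚ) : ℂ) + ((0 : ℚ) : ℂ) * Complex.I := rfl
      rw [e]
      simp [partialSum]
  refine (Runs.seq h1 fun τ₁ h₁ => Runs.seq (Runs.loop (SumInv d β γ w l i) (fun _ => 10) (size p)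
    (fun t ht σ hσ => ⟨?_, runs_sumCode hw hi ht hσ⟩) (fun σ hσ => ?_) h₁) fun τ₂ h₂ =>
    Runs.block (is := finishCode) h₂.consts.bdd ?_ fun hb => ⟨?_, ?_, h₂.r6, h₂.r8⟩).mono ?_
      fun _ h => h
  · change σ.reg 7 < σ.reg 3
    rw [hσ.r7, hσ.consts.r3]
    exact ht
  · change ¬ σ.reg 7 < σ.reg 3
    rw [hσ.r7, hσ.consts.r3]
    exact lt_irrefl _
  · simp only [SafeBlock, finishCode, Instr.Safe, Instr.step, WordOp.eval, Function.update_apply,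
      reduceIte, Nat.reduceEqDiff, true_and, and_true, h₂.consts.r3, h₂.consts.r5, h₂.r6]
    omega
  · rw [Finset.sum_const, Finset.card_range, smul_eq_mul]
    simp only [finishCode, List.length_cons, List.length_nil]
    omega
  · exact h₂.consts.runBlock (by simp [finishCode, Instr.KeepsConsts]) hb
  · have e : (runBlock finishCode τ₂).cmem =
        Function.update (Function.update τ₂.cmem (τ₂.reg 5 + τ₂.reg 6)
          (Complex.exp (τ₂.creg 4 * τ₂.creg 3 * τ₂.creg 0 - τ₂.creg 0)))
        (τ₂.reg 3 + τ₂.reg 6)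
        (Function.update τ₂.cmem (τ₂.reg 5 + τ₂.reg 6)
          (Complex.exp (τ₂.creg 4 * τ₂.creg 3 * τ₂.creg 0 - τ₂.creg 0)) (τ₂.reg 3 + τ₂.reg 6) *
          Complex.exp (τ₂.creg 4 * τ₂.creg 3 * τ₂.creg 0 - τ₂.creg 0)) := rfl
    have e' : (runBlock finishCode τ₂).mem = τ₂.mem := rfl
    -- The entry of `i` is still the bare weight, so multiplying it by `R` now is correct.
    have hnot : ¬ Known p l i i := by
      unfold Known
      omega
    have hexp := exp_partialSum d β γ (i := i) (by omega)
    rw [hlev] at hexp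
    rw [e, e', h₂.consts.r3, h₂.consts.r5, h₂.r6, h₂.c4, h₂.consts.c3, h₂.consts.c0, hexp,
      Function.update_of_ne (by omega), h₂.tables.weight i hi hnot]
    have hknown : ∀ k, k ≠ i → (Known p l (i + 1) k ↔ Known p l i k) := by
      intro k hk
      unfold Known
      omega
    refine ⟨h₂.tables.lev, fun k hk => ?_, fun k hk hD => ?_, fun k hk hD => ?_, fun k hk hD => ?_⟩
    · rw [Function.update_of_ne (by omega), Function.update_of_ne (by omega),
        h₂.tables.phase k hk]
    · rw [Function.update_of_ne (by omega)]
      by_cases hki : k = i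
      · subst hki
        rw [Function.update_self]
      · rw [Function.update_of_ne (by omega), h₂.tables.done k hk ((hknown k hki).1 hD)]
    · by_cases hki : k = i
      · subst hki
        rw [Function.update_self]
      · rw [Function.update_of_ne (by omega), Function.update_of_ne (by omega),
          h₂.tables.doneWeight k hk ((hknown k hki).1 hD)]
    · have hki : k ≠ i := by
        rintro rfl
        exact hD (Or.inr ⟨hlev, Nat.lt_succ_self k⟩)
      rw [Function.update_of_ne (by omega), Function.update_of_ne (by omega),
        h₂.tables.weight k hk fun h' => hD ((hknown k hki).2 h')]

/-- The time to visit one string. -/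
def visitTime (p l i : ℕ) : ℕ :=
  3 + if level (decode p i) = l then 11 * size p + 13 else 0

theorem runs_visitCode (hw : 4 * size p ≤ 2 ^ w) (hl : l < p) (hi : i < size p)
    (h : VisitInv d β γ w l i τ) :
    Runs w visitCode τ (visitTime p l i) (VisitInv d β γ w l (i + 1)) := by
  have hN := two_mul_add_one_lt_size p
  have hlevel := level_le (decode p i)
  have h1 : Runs w (block [.wload 9 6]) τ 1 fun τ' =>
      VisitInv d β γ w l i τ' ∧ τ'.reg 9 = level (decode p i) := by
    refine Runs.block h.consts.bdd ?_ fun hb => ⟨⟨?_, h.tables, h.r6, h.r8⟩, ?_⟩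
    · simp only [SafeBlock, Instr.Safe, and_true, h.r6, h.tables.lev i hi]
      omega
    · exact h.consts.runBlock (by simp [Instr.KeepsConsts]) hb
    · have e : (runBlock [.wload 9 6] τ).reg 9 = τ.mem (τ.reg 6) := rfl
      rw [e, h.r6, h.tables.lev i hi]
  have h2 : ∀ τ, (VisitInv d β γ w l i τ ∧ τ.reg 9 = level (decode p i)) →
      Runs w (.branch (.eq 9 8) computeCode .skip) τ
        ((if level (decode p i) = l then 11 * size p + 13 else 0) + 1) fun τ' =>
        Consts p d w τ' ∧ RTables d β γ (Known p l (i + 1)) τ'.mem τ'.cmem ∧ τ'.reg 6 = i ∧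
          τ'.reg 8 = l := by
    rintro τ ⟨h, h9⟩
    refine Runs.branch (fun hb => ?_) fun hb => ?_
    · have hb' : τ.reg 9 = τ.reg 8 := hb
      rw [h.r8, h9] at hb'
      rw [if_pos hb']
      exact runs_computeCode hw hl hi hb' h
    · have hb' : ¬ τ.reg 9 = τ.reg 8 := hb
      rw [h.r8, h9] at hb'
      rw [if_neg hb']
      refine Runs.skip ⟨h.consts, h.tables.congr fun k _ => ?_, h.r6, h.r8⟩
      unfold Known
      by_cases hki : k = i
      · subst hki
        simp [hb']
      · omega
  refine (Runs.seq h1 fun τ₁ h₁ => Runs.seq (h2 τ₁ h₁) fun τ₂ h₂ =>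
    Runs.block (is := [.wop .add 6 6 1]) (Q := VisitInv d β γ w l (i + 1)) h₂.1.bdd ?_
      fun hb => ⟨?_, h₂.2.1, ?_, h₂.2.2.2⟩).mono ?_ fun _ h => h
  · simp only [SafeBlock, Instr.Safe, WordOp.eval, and_true, h₂.1.r1, h₂.2.2.1]
    omega
  · exact h₂.1.runBlock (by simp [Instr.KeepsConsts]) hb
  · have e : (runBlock [.wop .add 6 6 1] τ₂).reg 6 = τ₂.reg 6 + τ₂.reg 1 := rfl
    rw [e, h₂.2.2.1, h₂.1.r1]
  · rw [visitTime]
    simp only [List.length_cons, List.length_nil]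
    omega

/-- The state when the levels from `l` on have been processed. -/
structure LevelInv (d : ℝ) (β γ : Fin p → ℝ) (w l : ℕ) (τ : State) : Prop where
  consts : Consts p d w τ
  tables : RTables d β γ (fun k => l ≤ level (decode p k)) τ.mem τ.cmem
  r8 : τ.reg 8 = l

theorem runs_levelCode (hw : 4 * size p ≤ 2 ^ w) (hl : l < p)
    (h : LevelInv d β γ w (l + 1) τ) :
    Runs w levelCode τ (∑ i ∈ Finset.range (size p), (visitTime p l i + 1) + 3)
      (LevelInv d β γ w l) := by
  have hN := two_mul_add_one_lt_size p
  have h1 : Runs w (block [.wop .sub 8 8 1, .wconst 6 0]) τ 2 (VisitInv d β γ w l 0) := by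
    refine Runs.block h.consts.bdd ?_ fun hb => ⟨?_, h.tables.congr fun k _ => ?_, rfl, ?_⟩
    · simp only [SafeBlock, Instr.Safe, WordOp.eval, and_true, h.r8, h.consts.r1]
      omega
    · exact h.consts.runBlock (by simp [Instr.KeepsConsts]) hb
    · unfold Known
      omega
    · have e : (runBlock [.wop .sub 8 8 1, .wconst 6 0] τ).reg 8 = τ.reg 8 - τ.reg 1 := rfl
      rw [e, h.r8, h.consts.r1]
      omega
  refine (Runs.seq h1 fun τ₁ h₁ => Runs.loop (VisitInv d β γ w l) (visitTime p l) (size p)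
    (fun i hi σ hσ => ⟨?_, runs_visitCode hw hl hi hσ⟩) (fun σ hσ => ?_) h₁).mono (by omega) ?_
  · change σ.reg 6 < σ.reg 3
    rw [hσ.r6, hσ.consts.r3]
    exact hi
  · change ¬ σ.reg 6 < σ.reg 3
    rw [hσ.r6, hσ.consts.r3]
    exact lt_irrefl _
  · intro τ' h'
    refine ⟨h'.consts, h'.tables.congr fun k hk => ?_, h'.r8⟩
    unfold Known
    omega

end Levels

/-! ### The whole program -/

theorem extend_input {p : ℕ} (d : ℝ) (β γ : Fin p → ℝ) : Input β γ (inputState d β γ).cmem := by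
  intro j hj
  constructor
  · simp [inputState, extend, hj]
  · have h1 : ¬ j + p < p := by omega
    have h2 : j + 1 + p - 1 = j + p := by omega
    simp [inputState, extend, hj, h1, h2]

theorem runs_setupCode {p : ℕ} (d : ℝ) (β γ : Fin p → ℝ) {w : ℕ} (hw : 4 * size p ≤ 2 ^ w) :
    Runs w (block setupCode) (inputState d β γ) 13 (TableInv d β γ w 0) := by
  have hN := two_mul_add_one_lt_size p
  have r0 : (inputState d β γ).reg 0 = p := rfl
  have hshl : 1 <<< (p + p + 1) = size p := by
    rw [Nat.one_shiftLeft, size, two_mul]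
  refine Runs.block ?_ ?_ fun hb => ⟨⟨hb, rfl, rfl, ?_, ?_, ?_, ?_, rfl, ?_, ?_, ?_, ?_, ?_⟩,
    extend_input d β γ, ?_, rfl⟩
  · intro r
    simp only [inputState]
    split_ifs <;> omega
  · simp only [SafeBlock, setupCode, Instr.Safe, Instr.step, WordOp.eval, Function.update_apply,
      reduceIte, Nat.reduceEqDiff, zero_ne_one, and_true, r0, hshl]
    omega
  · change p + p = 2 * p
    ring
  · exact hshl
  · change 1 <<< (p + p + 1) + 1 <<< (p + p + 1) = 2 * size p
    rw [hshl]
    ring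
  · change 1 <<< (p + p + 1) + 1 <<< (p + p + 1) + 1 <<< (p + p + 1) = 3 * size p
    rw [hshl]
    ring
  · rfl
  · change ((0 : ℚ) : ℂ) + ((1 / 2 : ℚ) : ℂ) * Complex.I = Complex.I / 2
    push_cast
    ring
  · change ((0 : ℚ) : ℂ) + ((-1 / 2 : ℚ) : ℂ) * Complex.I = -(Complex.I / 2)
    push_cast
    ring
  · change ((1 / 2 : ℚ) : ℂ) + ((0 : ℚ) : ℂ) * Complex.I = 1 / 2
    push_cast
    ring
  · change ((0 : ℚ) : ℂ) + ((1 : ℚ) : ℂ) * Complex.I = Complex.I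
    push_cast
    ring
  · intro k hk
    omega

/-- The time bound of the program. -/
def totalTime (p : ℕ) : ℕ :=
  13 + ((∑ _i ∈ Finset.range (size p), (35 * p + 16 + 1) + 1) + (1 +
    ((∑ m ∈ Finset.range p, (∑ i ∈ Finset.range (size p), (visitTime p (p - 1 - m) i + 1) + 3 + 1)
      + 1) + 1)))

theorem runs_program {p : ℕ} (d : ℝ) (β γ : Fin p → ℝ) {w : ℕ} (hw : 4 * size p ≤ 2 ^ w) :
    Runs w program (inputState d β γ) (totalTime p) fun τ => τ.Outputs (R d β γ) := by
  have hN := two_mul_add_one_lt_size p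
  refine Runs.seq (runs_setupCode d β γ hw) fun τ₁ h₁ => Runs.seq (Runs.loop (TableInv d β γ w)
    (fun _ => 35 * p + 16) (size p) (fun i hi σ hσ => ⟨?_, runs_stringCode hw hi hσ⟩)
    (fun σ hσ => ?_) h₁) fun τ₂ h₂ => Runs.seq (T := 1) (Q := LevelInv d β γ w p)
    (Runs.block (is := [.wop .sub 8 2 0]) h₂.consts.bdd ?_ fun hb => ⟨?_, ?_, ?_⟩) fun τ₃ h₃ =>
    Runs.seq (Runs.loop (fun m => LevelInv d β γ w (p - m))
      (fun m => ∑ i ∈ Finset.range (size p), (visitTime p (p - 1 - m) i + 1) + 3) p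
      (fun m hm σ hσ => ⟨?_, ?_⟩) (fun σ hσ => ?_) h₃) fun τ₄ h₄ =>
    Runs.block (is := [.wop .sub 0 5 14]) h₄.consts.bdd ?_ fun hb => ?_
  · change σ.reg 6 < σ.reg 3
    rw [hσ.r6, hσ.consts.r3]
    exact hi
  · change ¬ σ.reg 6 < σ.reg 3
    rw [hσ.r6, hσ.consts.r3]
    exact lt_irrefl _
  · simp only [SafeBlock, Instr.Safe, WordOp.eval, and_true, h₂.consts.r2, h₂.consts.r0]
    omega
  · exact h₂.consts.runBlock (by simp [Instr.KeepsConsts]) hb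
  -- The table of `R` was preset to 1, which is already right at the top level; lower levels are
  -- overwritten later.
  · refine ⟨fun k hk => (h₂.tables k hk).1, fun k hk => (h₂.tables k hk).2.2.1,
      fun k hk hD => ?_, fun k hk hD => ?_, fun k hk _ => (h₂.tables k hk).2.1⟩
    · rw [R_of_level_eq d β γ (le_antisymm (level_le _) hD)]
      exact (h₂.tables k hk).2.2.2
    · rw [R_of_level_eq d β γ (le_antisymm (level_le _) hD), mul_one]
      exact (h₂.tables k hk).2.1
  · have e : (runBlock [.wop .sub 8 2 0] τ₂).reg 8 = τ₂.reg 2 - τ₂.reg 0 := rfl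
    rw [e, h₂.consts.r2, h₂.consts.r0]
    omega
  · change σ.reg 14 < σ.reg 8
    rw [hσ.consts.r14, hσ.r8]
    omega
  · have e1 : p - m = p - 1 - m + 1 := by omega
    have e2 : p - (m + 1) = p - 1 - m := by omega
    rw [e1] at hσ
    rw [e2]
    exact runs_levelCode hw (by omega) hσ
  · change ¬ σ.reg 14 < σ.reg 8
    rw [hσ.consts.r14, hσ.r8]
    omega
  · simp only [SafeBlock, Instr.Safe, WordOp.eval, and_true, h₄.consts.r5, h₄.consts.r14]
    omega
  -- The last instruction subtracts the zero register, which serves as a move of the output base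
  -- address into register 0.
  · intro u
    have e : (runBlock [.wop .sub 0 5 14] τ₄).reg 0 = τ₄.reg 5 - τ₄.reg 14 := rfl
    have e' : (runBlock [.wop .sub 0 5 14] τ₄).cmem = τ₄.cmem := rfl
    rw [e, e', h₄.consts.r5, h₄.consts.r14, Nat.sub_zero,
      h₄.tables.done (code u) (code_lt u) (by simp), decode_code]

/-- Interchanging the sums shows the amortization: each string has a single level, so it pays for
the long computation at most once, while the cheap scan is repeated `p` times. -/
theorem sum_visitTime_le (p : ℕ) :
    ∑ m ∈ Finset.range p, ∑ i ∈ Finset.range (size p), (visitTime p (p - 1 - m) i + 1) ≤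
      p * (size p * 4) + size p * (11 * size p + 13) := by
  have h1 : ∑ m ∈ Finset.range p, ∑ i ∈ Finset.range (size p), (visitTime p (p - 1 - m) i + 1) =
      p * (size p * 4) + ∑ i ∈ Finset.range (size p), ∑ m ∈ Finset.range p,
        if level (decode p i) = p - 1 - m then 11 * size p + 13 else 0 := by
    rw [Finset.sum_comm (s := Finset.range (size p))]
    have : ∀ m, ∑ i ∈ Finset.range (size p), (visitTime p (p - 1 - m) i + 1) = size p * 4 +
        ∑ i ∈ Finset.range (size p),
          if level (decode p i) = p - 1 - m then 11 * size p + 13 else 0 := by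
      intro m
      rw [show size p * 4 = ∑ _i ∈ Finset.range (size p), 4 by simp, ← Finset.sum_add_distrib]
      refine Finset.sum_congr rfl fun i _ => ?_
      rw [visitTime]
      omega
    simp only [this]
    rw [Finset.sum_add_distrib, Finset.sum_const, Finset.card_range, smul_eq_mul]
  rw [h1]
  refine Nat.add_le_add_left ?_ _
  have h2 : ∀ i ∈ Finset.range (size p), (∑ m ∈ Finset.range p,
      if level (decode p i) = p - 1 - m then 11 * size p + 13 else 0) ≤ 11 * size p + 13 := by
    intro i _
    calc (∑ m ∈ Finset.range p,
        if level (decode p i) = p - 1 - m then 11 * size p + 13 else 0)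
        ≤ ∑ m ∈ Finset.range p,
          if p - 1 - level (decode p i) = m then 11 * size p + 13 else 0 := by
          refine Finset.sum_le_sum fun m hm => ?_
          have := Finset.mem_range.1 hm
          split_ifs <;> omega
      _ ≤ 11 * size p + 13 := by
          rw [Finset.sum_ite_eq]
          split_ifs <;> omega
  refine (Finset.sum_le_sum h2).trans ?_
  rw [Finset.sum_const, Finset.card_range, smul_eq_mul]

/-- With `x = 4 ^ p` and `p < x`, every term is at most a constant multiple of `x * x`; 300 leaves
slack. -/
theorem totalTime_le (p : ℕ) : totalTime p ≤ 300 * 16 ^ p := by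
  have h1 := sum_visitTime_le p
  have h2 : p < 4 ^ p := Nat.lt_pow_self (by norm_num)
  have h3 : size p = 2 * 4 ^ p := by
    rw [size, pow_succ, pow_mul]
    ring
  have h4 : (16 : ℕ) ^ p = 4 ^ p * 4 ^ p := by
    rw [← mul_pow]
    norm_num
  have e : totalTime p = size p * (35 * p + 17) + (∑ m ∈ Finset.range p,
      ∑ i ∈ Finset.range (size p), (visitTime p (p - 1 - m) i + 1)) + p * 4 + 17 := by
    unfold totalTime
    simp only [add_assoc, Finset.sum_add_distrib, Finset.sum_const, Finset.card_range, smul_eq_mul]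
    ring
  rw [e, h4]
  rw [h3] at h1 ⊢
  generalize 4 ^ p = x at *
  have hx : 1 ≤ x := by omega
  have h5 : p * x ≤ x * x := Nat.mul_le_mul_right x h2.le
  have h6 : x ≤ x * x := Nat.le_mul_of_pos_left x hx
  nlinarith

theorem exists_program : ∃ (P : Prog) (c C : ℕ), ∀ (p : ℕ) (_ : 1 ≤ p) (d : ℝ) (_ : 3 ≤ d)
    (β γ : Fin p → ℝ), ∃ (σ : State) (t : ℕ),
      Exec (c * p) P (inputState d β γ) σ t ∧ t ≤ C * 16 ^ p ∧ σ.Outputs (R d β γ) := by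
  refine ⟨program, 5, 300, fun p hp d _ β γ => ?_⟩
  -- All addresses lie below `4 * size p = 2 ^ (2p + 3)`, and `2p + 3 ≤ 5p` because `p ≥ 1`.
  have hw : 4 * size p ≤ 2 ^ (5 * p) := by
    rw [size, show 4 * 2 ^ (2 * p + 1) = 2 ^ (2 * p + 3) by ring]
    exact Nat.pow_le_pow_right (by norm_num) (by omega)
  obtain ⟨σ, t, h1, h2, h3⟩ := runs_program d β γ hw
  exact ⟨σ, t, h1, h2.trans (totalTime_le p), h3⟩

end

end QAOA

open Filter Topology in
theorem theorem1 :
    (∀ (p : ℕ) (_ : 1 ≤ p) (d : ℝ) (_ : 3 ≤ d) (β γ : Fin p → ℝ)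
      (lt : QAOA.Bits p → QAOA.Bits p → Prop) [IsStrictTotalOrder (QAOA.Bits p) lt]
      [DecidableRel lt],
      Tendsto (fun n : ℕ => QAOA.expectedEnergy d β γ n / ((n : ℂ) * (d : ℂ) / 2)) atTop
        (𝓝 (∑ u : QAOA.Bits p, QAOA.Sdiag d β γ u +
          2 * ∑ u : QAOA.Bits p, ∑ v : QAOA.Bits p,
            if lt u v then
              ((QAOA.spin (QAOA.bit u p) * QAOA.spin (QAOA.bit v p) : ℝ) : ℂ) *
                QAOA.phase γ (QAOA.bxor u v) * QAOA.Spair d β γ u v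
            else 0))) ∧
    (∃ (P : QAOA.Prog) (c C : ℕ), ∀ (p : ℕ) (_ : 1 ≤ p) (d : ℝ) (_ : 3 ≤ d) (β γ : Fin p → ℝ),
      ∃ (σ : QAOA.State) (t : ℕ),
        QAOA.Exec (c * p) P (QAOA.inputState d β γ) σ t ∧ t ≤ C * 16 ^ p ∧
          σ.Outputs (QAOA.R d β γ)) := by
  refine ⟨fun p _ d hd β γ lt _ _ => ?_, QAOA.exists_program⟩
  rw [← QAOA.sum_pairs_eq d β γ lt]
  exact QAOA.tendsto_expectedEnergy (by linarith) β γ
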